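/- **Setting.** Let $G$ be a compact (not necessarily connected) Lie group, $H\subset G$ a closed subgroup with $G/H$ connected and simply connected, $\mathfrak g\supset\mathfrak h$ the Lie algebras, $B$ the Killing form of $\mathfrak g$ and $\mathfrak z(\mathfrak g)$ its centre. Assume that the isotropy representation of $H$ on $\mathfrak g/\mathfrak h$ has finite kernel, and that $\mathfrak m$ is an $\mathrm{Ad}(H)$-invariant complement of $\mathfrak h$ which is the direct sum $\mathfrak m=\mathfrak m_1\oplus\dots\oplus\mathfrak m_d$, $d>1$, of pairwise inequivalent irreducible real $H$-modules. Let $H^0$ be the identity component of $H$ and fix an $H\cdot Z_G(H^0)$-invariant Euclidean scalar product $g_1$ on $\mathfrak g/\mathfrak h\cong\mathfrak m$, also regarded as a form on $\mathfrak g$ with $g_1(\mathfrak h,\mathfrak g)=0$. The invariant metrics on $G/H$ are $g=\sum_i s_i\,g_1|_{\mathfrak m_i}$ with $s\in(\mathbb R_{>0})^d$. Fix $\theta$ with $|\theta|<1$. **Moment map.** For an invariant metric $g$ with Ricci operator $\mathrm{Ric}_g\in\mathrm{End}(\mathfrak m)$ at the base point, and $B_g=g^{-1}B|_{\mathfrak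 m}$, put $$\ell_\theta(g)=\operatorname{trace}\bigl(-(1+\theta)\mathrm{Ric}_g-B_g\bigr),\qquad \mu(g)=\ell_\theta(g)^{-1}\bigl(-(1+\theta)\mathrm{Ric}_g-B_g\bigr).$$ An $H$-invariant diagonal operator $A$ on $\mathfrak m$ is identified with the point $x\in\mathbb R^d$, $x_i=\operatorname{trace}(A|_{\mathfrak m_i})$; the weight $\varepsilon_i$ (the eigenvalue of $A$ on $\mathfrak m_i$) is thereby identified, through the trace form, with the $i$-th coordinate vector of $\mathbb R^d$. Let $\Delta$ be the convex hull of all $\varepsilon_i+\varepsilon_j-\varepsilon_k$ with $g_1([\mathfrak m_i,\mathfrak m_j],\mathfrak m_k)\neq0$ and all $\varepsilon_r$ with $B(\mathfrak m_r,\mathfrak m_r)\ne0$, and let $\Gamma=\partial\Delta$ be its boundary relative to its affine span (the closure of the image of $\mu$ is $\Delta$). **Geometry at $x$.** For $g=\sum_i s_i\,g_1|_{\mathfrak m_i}$ let $a_i>0$ be given by $\ell_0(g)\,s_i=\ell_0(g_1)\,a_i^2$, let $T_a$ be the identity on $\mathfrak h$ and multiplication by $a_i$ on $\mathfrak m_i$,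 and put $[Y,Z]_g=T_a[T_a^{-1}Y,T_a^{-1}Z]$ on $\mathfrak h+\mathfrak m$. For $x\in\Delta$ let $[\cdot,\cdot]_x$ be the limit of $[\cdot,\cdot]_g$ as $\mu(g)\to x$, and let $(M(x),g_1)$ be the germ of homogeneous Riemannian space with transitive Lie algebra $\mathfrak g_x=(\mathfrak h+\mathfrak m,[\cdot,\cdot]_x)$, stability subalgebra $\mathfrak h$ and scalar product $g_1$ on $\mathfrak m$. It is called locally Euclidean if its Riemann curvature tensor vanishes. **Lemma.** Let $x\in\mathbb R^d$. Then $x$ lies in $\Gamma$ and the geometry $(M(x),g_1)$ is locally Euclidean if and only if there is a subset $I\subset\{1,\dots,d\}$ such that $x$ belongs to the convex hull of $\{\varepsilon_i : i\in I\}$ and the subspace $\mathfrak m_I=\bigoplus_{i\in I}\mathfrak m_i$ satisfies $$[\mathfrak m_I,\mathfrak m_I]=[\mathfrak m_I,\mathfrak h]=\mathfrak m_I\cap\mathfrak z(\mathfrak g)=0 .$$ -/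

import Mathlib

open scoped Manifold ContDiff Topology

noncomputable section

namespace LocalGeometry

/-! ### Reductive splittings and infinitesimal homogeneous Riemannian geometries -/

/-- A splitting `V = 𝔥 ⊕ 𝔪₁ ⊕ ⋯ ⊕ 𝔪_d` of a real vector space. -/
structure Splitting {V : Type*} [AddCommGroup V] [Module ℝ V]
    (𝔥 : Submodule ℝ V) (d : ℕ) where
  /-- the summands `𝔪ᵢ` -/
  comp : Fin d → Submodule ℝ V
  indep : iSupIndep comp
  isCompl : IsCompl 𝔥 (⨆ i, comp i)

namespace Splitting

section Linear

variable {V : Type*} [AddCommGroup V] [Module ℝ V] {𝔥 : Submodule ℝ V} {d : ℕ}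
  (S : Splitting 𝔥 d)

/-- The complement `𝔪 = 𝔪₁ ⊕ ⋯ ⊕ 𝔪_d` of `𝔥`. -/
def 𝔪 : Submodule ℝ V := ⨆ i, S.comp i

/-- The subspace `𝔪_I = ⨁_{i ∈ I} 𝔪ᵢ`. -/
def 𝔪sub (I : Set (Fin d)) : Submodule ℝ V := ⨆ i ∈ I, S.comp i

theorem isCompl_comp (i : Fin d) :
    IsCompl (S.comp i) (𝔥 ⊔ ⨆ (j : Fin d) (_ : j ≠ i), S.comp j) := by
  have hm : (⨆ i, S.comp i) = S.comp i ⊔ ⨆ (j : Fin d) (_ : j ≠ i), S.comp j := by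
    apply le_antisymm
    · refine iSup_le fun j => ?_
      by_cases hj : j = i
      · subst hj; exact le_sup_left
      · exact le_sup_of_le_right (le_iSup₂_of_le j hj le_rfl)
    · exact sup_le (le_iSup _ i) (iSup₂_le fun j _ => le_iSup _ j)
  have hc := S.isCompl
  rw [hm] at hc
  refine ⟨?_, ?_⟩
  · rw [sup_comm]
    exact (S.indep i).disjoint_sup_right_of_disjoint_sup_left hc.symm.disjoint
  · rw [codisjoint_iff]
    have h := hc.sup_eq_top
    rw [← h]
    ac_rfl

/-- The projection of `V` onto `𝔪ᵢ` along the other summands. -/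
def proj (i : Fin d) : V →ₗ[ℝ] V := (S.comp i).projection _ (S.isCompl_comp i)

/-- The projection of `V` onto `𝔥` along `𝔪`. -/
def projH : V →ₗ[ℝ] V := 𝔥.projection S.𝔪 S.isCompl

/-- The projection of `V` onto `𝔪` along `𝔥`. -/
def projM : V →ₗ[ℝ] S.𝔪 := S.𝔪.projectionOnto 𝔥 S.isCompl.symm

/-- The operator `T_a`: the identity on `𝔥`, multiplication by `aᵢ` on `𝔪ᵢ`. -/
def T (a : Fin d → ℝ) : V →ₗ[ℝ] V := S.projH + ∑ i, a i • S.proj i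

/-- The operation `(Y, Z) ↦ T_a [T_a⁻¹ Y, T_a⁻¹ Z]`. -/
def rescale (a : Fin d → ℝ) (b : V →ₗ[ℝ] V →ₗ[ℝ] V) : V →ₗ[ℝ] V →ₗ[ℝ] V :=
  (b.compl₁₂ (S.T a⁻¹) (S.T a⁻¹)).compr₂ (S.T a)

/-- The form which is `sᵢ g₁` on `𝔪ᵢ`; the summands `𝔥, 𝔪₁, …, 𝔪_d` are pairwise orthogonal and
`𝔥` is its kernel. For `s ∈ (ℝ_{>0})^d` these are all the invariant metrics, in the coordinates
`ℳ(G, H) = (ℝ_{>0})^d`. -/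
def metric (g₁ : LinearMap.BilinForm ℝ V) (s : Fin d → ℝ) : LinearMap.BilinForm ℝ V :=
  ∑ i, s i • g₁.compl₁₂ (S.proj i) (S.proj i)

/-- Raising an index: `sharp q φ` is the vector of `𝔪` with `q (sharp q φ) Z = φ Z` for `Z ∈ 𝔪`
(and `0` if `q` is degenerate on `𝔪`, which is not the case for a metric). -/
def sharp [FiniteDimensional ℝ V] (q : LinearMap.BilinForm ℝ V) :
    Module.Dual ℝ S.𝔪 →ₗ[ℝ] S.𝔪 := by
  classical
  exact if h : (q.restrict S.𝔪).Nondegenerate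
    then ((LinearMap.BilinForm.toDual (q.restrict S.𝔪) h).symm : _ →ₗ[ℝ] _) else 0

/-- The Koszul expression
`½ (q([X,Y],Z) - q([Y,Z],X) + q([Z,X],Y))`, `X, Y, Z ∈ 𝔪`, for a bracket `b` and a form `q` on `V`
with kernel `𝔥`. -/
def koszul (b : V →ₗ[ℝ] V →ₗ[ℝ] V) (q : LinearMap.BilinForm ℝ V) :
    S.𝔪 →ₗ[ℝ] S.𝔪 →ₗ[ℝ] Module.Dual ℝ S.𝔪 :=
  LinearMap.mk₂ ℝ
    (fun X Y =>
      { toFun := fun Z => (1 / 2 : ℝ) * (q (b X Y) Z - q (b Y Z) X + q (b Z X) Y)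
        map_add' := fun Z Z' => by
          simp only [Submodule.coe_add, map_add, LinearMap.add_apply]; ring
        map_smul' := fun c Z => by
          simp only [Submodule.coe_smul, map_smul, LinearMap.smul_apply, smul_eq_mul,
            RingHom.id_apply]; ring })
    (fun X X' Y => by
      ext Z
      simp only [Submodule.coe_add, map_add, LinearMap.add_apply, LinearMap.coe_mk,
        AddHom.coe_mk]; ring)
    (fun c X Y => by
      ext Z
      simp only [Submodule.coe_smul, map_smul, LinearMap.smul_apply, smul_eq_mul,
        LinearMap.coe_mk, AddHom.coe_mk]; ring)
    (fun X Y Y' => by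
      ext Z
      simp only [Submodule.coe_add, map_add, LinearMap.add_apply, LinearMap.coe_mk,
        AddHom.coe_mk]; ring)
    (fun c X Y => by
      ext Z
      simp only [Submodule.coe_smul, map_smul, LinearMap.smul_apply, smul_eq_mul,
        LinearMap.coe_mk, AddHom.coe_mk]; ring)

variable [FiniteDimensional ℝ V]

/-- The Nomizu operator `Λ(X)Y = ½ [X,Y]_𝔪 + U(X,Y)` of the Levi-Civita connection at the base
point of the homogeneous geometry given by the bracket `b` on `V = 𝔥 + 𝔪` and the metric `q`. -/
def nomizu (b : V →ₗ[ℝ] V →ₗ[ℝ] V) (q : LinearMap.BilinForm ℝ V) :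
    S.𝔪 →ₗ[ℝ] S.𝔪 →ₗ[ℝ] S.𝔪 := (S.koszul b q).compr₂ (S.sharp q)

/-- The Riemann curvature tensor at the base point,
`R(X,Y) = [Λ(X), Λ(Y)] - Λ([X,Y]_𝔪) - ad([X,Y]_𝔥)|_𝔪`. -/
def riemann (b : V →ₗ[ℝ] V →ₗ[ℝ] V) (q : LinearMap.BilinForm ℝ V) :
    S.𝔪 →ₗ[ℝ] S.𝔪 →ₗ[ℝ] Module.End ℝ S.𝔪 :=
  LinearMap.mk₂ ℝ
    (fun X Y => S.nomizu b q X ∘ₗ S.nomizu b q Y - S.nomizu b q Y ∘ₗ S.nomizu b q X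
      - S.nomizu b q (S.projM (b X Y))
      - S.projM ∘ₗ b (S.projH (b X Y)) ∘ₗ S.𝔪.subtype)
    (fun X X' Y => by
      ext1 Z
      simp only [Submodule.coe_add, map_add, LinearMap.add_apply, LinearMap.sub_apply,
        LinearMap.comp_apply, Submodule.subtype_apply]; abel)
    (fun c X Y => by
      ext1 Z
      simp only [Submodule.coe_smul, map_smul, LinearMap.smul_apply, LinearMap.sub_apply,
        LinearMap.comp_apply, Submodule.subtype_apply, smul_sub])
    (fun X Y Y' => by
      ext1 Z
      simp only [Submodule.coe_add, map_add, LinearMap.add_apply, LinearMap.sub_apply,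
        LinearMap.comp_apply, Submodule.subtype_apply]; abel)
    (fun c X Y => by
      ext1 Z
      simp only [Submodule.coe_smul, map_smul, LinearMap.smul_apply, LinearMap.sub_apply,
        LinearMap.comp_apply, Submodule.subtype_apply, smul_sub])

/-- The Ricci tensor `ric(Y,Z) = trace (X ↦ R(X,Y)Z)`. -/
def ricci (b : V →ₗ[ℝ] V →ₗ[ℝ] V) (q : LinearMap.BilinForm ℝ V) :
    LinearMap.BilinForm ℝ S.𝔪 :=
  LinearMap.mk₂ ℝ
    (fun Y Z => LinearMap.trace ℝ S.𝔪 (((S.riemann b q).flip Y).flip Z))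
    (fun Y Y' Z => by
      rw [← map_add]; congr 1; ext1 X
      simp only [LinearMap.flip_apply, LinearMap.add_apply, map_add])
    (fun c Y Z => by
      rw [← map_smul]; congr 1; ext1 X
      simp only [LinearMap.flip_apply, LinearMap.smul_apply, map_smul])
    (fun Y Z Z' => by
      rw [← map_add]; congr 1; ext1 X
      simp only [LinearMap.flip_apply, LinearMap.add_apply, map_add])
    (fun c Y Z => by
      rw [← map_smul]; congr 1; ext1 X
      simp only [LinearMap.flip_apply, LinearMap.smul_apply, map_smul])

/-- The Ricci operator: `q(Ric Y, Z) = ric(Y, Z)`. -/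
def ricciOp (b : V →ₗ[ℝ] V →ₗ[ℝ] V) (q : LinearMap.BilinForm ℝ V) : Module.End ℝ S.𝔪 :=
  S.sharp q ∘ₗ S.ricci b q

/-- The homogeneous geometry with bracket `b` on `𝔥 + 𝔪`, stability subalgebra `𝔥` and metric `q`
is locally Euclidean: its Riemann curvature tensor vanishes. -/
def IsLocallyEuclidean (b : V →ₗ[ℝ] V →ₗ[ℝ] V) (q : LinearMap.BilinForm ℝ V) : Prop :=
  ∀ X Y Z : S.𝔪, S.riemann b q X Y Z = 0

end Linear

/-! ### Moment map, moment polytope, geometries at infinity -/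

section Moment

variable {𝔤 : Type*} [LieRing 𝔤] [LieAlgebra ℝ 𝔤] [FiniteDimensional ℝ 𝔤]
  {𝔥 : Submodule ℝ 𝔤} {d : ℕ} (S : Splitting 𝔥 d)

/-- The bracket of a Lie algebra as a bilinear map. -/
def lieBracket (𝔤 : Type*) [LieRing 𝔤] [LieAlgebra ℝ 𝔤] : 𝔤 →ₗ[ℝ] 𝔤 →ₗ[ℝ] 𝔤 :=
  (LieAlgebra.ad ℝ 𝔤 : 𝔤 →ₗ[ℝ] Module.End ℝ 𝔤)

/-- The operator `B_{G/H,g} = g⁻¹ B|_𝔪` of the Killing form `B` of `𝔤`. -/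
def killingOp (g : LinearMap.BilinForm ℝ 𝔤) : Module.End ℝ S.𝔪 :=
  S.sharp g ∘ₗ (killingForm ℝ 𝔤).restrict S.𝔪

/-- The operator `-(1 + θ) Ric_{G/H,g} - B_{G/H,g}` on `𝔪`. -/
def momentOp (θ : ℝ) (g : LinearMap.BilinForm ℝ 𝔤) : Module.End ℝ S.𝔪 :=
  -(1 + θ) • S.ricciOp (lieBracket 𝔤) g - S.killingOp g

/-- The modified scalar curvature `ℓ_θ(G/H,g) = trace (-(1 + θ) Ric_{G/H,g} - B_{G/H,g})`. -/
def ell (θ : ℝ) (g : LinearMap.BilinForm ℝ 𝔤) : ℝ := LinearMap.trace ℝ S.𝔪 (S.momentOp θ g)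

/-- The moment map `μ_θ(g) = (-(1 + θ) Ric_{G/H,g} - B_{G/H,g}) / ℓ_θ(G/H,g)`, as a point of `ℝ^d`.
An `H`-invariant diagonal operator `A` has the coordinates `xᵢ = trace (A|_{𝔪ᵢ})`, so that
`trace A = ∑ xᵢ`. -/
def moment (θ : ℝ) (g : LinearMap.BilinForm ℝ 𝔤) (i : Fin d) : ℝ :=
  LinearMap.trace ℝ S.𝔪 (S.projM ∘ₗ S.proj i ∘ₗ S.𝔪.subtype ∘ₗ S.momentOp θ g) / S.ell θ g

/-- The weight `εᵢ` (eigenvalue on `𝔪ᵢ`) of the space `ℝ^d` of diagonal operators. The trace form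
identifies it with the operator `(dim 𝔪ᵢ)⁻¹ id` on `𝔪ᵢ`, `0` on the other `𝔪ⱼ`, i.e. with
the `i`-th coordinate vector. -/
def weight (i : Fin d) : Fin d → ℝ := Pi.single i 1

/-- The moment polytope `Δ`: the convex hull of the weights `εᵢ + εⱼ - εₖ` with
`g₁([𝔪ᵢ,𝔪ⱼ], 𝔪ₖ) ≠ 0` and `εᵣ` with `B(𝔪ᵣ,𝔪ᵣ) ≠ 0`. -/
def polytope (g₁ : LinearMap.BilinForm ℝ 𝔤) : Set (Fin d → ℝ) :=
  convexHull ℝ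
    ({w | ∃ i j k, (∃ X ∈ S.comp i, ∃ Y ∈ S.comp j, ∃ Z ∈ S.comp k, g₁ ⁅X, Y⁆ Z ≠ 0) ∧
        w = weight i + weight j - weight k} ∪
      {w | ∃ r, (∃ X ∈ S.comp r, ∃ Y ∈ S.comp r, killingForm ℝ 𝔤 X Y ≠ 0) ∧ w = weight r})

/-- The set `Γ = ∂Δ` of points at infinity: the boundary of `Δ` relative to its affine span. -/
def infinity (g₁ : LinearMap.BilinForm ℝ 𝔤) : Set (Fin d → ℝ) :=
  intrinsicFrontier ℝ (S.polytope g₁)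

/-- The coefficients `aᵢ > 0` of the diagonal operator `a` on `𝔪` with
`ℓ₀(G/H,g) g(Y,Y) = ℓ₀(G/H,g₁) g₁(aY,aY)`, for `g = ∑ sᵢ g₁|_{𝔪ᵢ}`. -/
def scaling (g₁ : LinearMap.BilinForm ℝ 𝔤) (s : Fin d → ℝ) (i : Fin d) : ℝ :=
  √(S.ell 0 (S.metric g₁ s) * s i / S.ell 0 g₁)

/-- The bracket `[·,·]_x` of the Lie algebra `𝔤_x`, `x = μ(g)` an interior point of `Δ`,
`g = ∑ sᵢ g₁|_{𝔪ᵢ}`: `[T_a Y, T_a Z]_x = T_a [Y, Z]`. -/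
def interiorBracket (g₁ : LinearMap.BilinForm ℝ 𝔤) (s : Fin d → ℝ) : 𝔤 →ₗ[ℝ] 𝔤 →ₗ[ℝ] 𝔤 :=
  S.rescale (S.scaling g₁ s) (lieBracket 𝔤)

/-- The filter on the parameters `s ∈ (ℝ_{>0})^d` of metrics `g` along which `μ_θ(g)` tends
to `x`. -/
def approach (θ : ℝ) (g₁ : LinearMap.BilinForm ℝ 𝔤) (x : Fin d → ℝ) : Filter (Fin d → ℝ) :=
  Filter.comap (fun s => S.moment θ (S.metric g₁ s)) (𝓝 x) ⊓ Filter.principal {s | ∀ i, 0 < s i}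

/-- `b` is the bracket `[·,·]_x` at the point `x` of `Δ`, the closure of the image of the moment
map `μ_θ`: it is the value at `x` of the continuous extension of the brackets of the
interior points. -/
def IsBracketAt [TopologicalSpace 𝔤] (θ : ℝ) (g₁ : LinearMap.BilinForm ℝ 𝔤) (x : Fin d → ℝ)
    (b : 𝔤 →ₗ[ℝ] 𝔤 →ₗ[ℝ] 𝔤) : Prop :=
  (S.approach θ g₁ x).NeBot ∧
    ∀ Y Z : 𝔤, Filter.Tendsto (fun s => S.interiorBracket g₁ s Y Z) (S.approach θ g₁ x)
      (𝓝 (b Y Z))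

/-- The geometry `(M(x), g₁)` is locally Euclidean. -/
def IsLocallyEuclideanAt [TopologicalSpace 𝔤] (θ : ℝ) (g₁ : LinearMap.BilinForm ℝ 𝔤)
    (x : Fin d → ℝ) : Prop :=
  ∃ b, S.IsBracketAt θ g₁ x b ∧ S.IsLocallyEuclidean b g₁

end Moment

end Splitting

/-! ### Homogeneous spaces of Lie groups -/

section Group

variable {E : Type*} [NormedAddCommGroup E] [NormedSpace ℝ E]
  {G : Type*} [TopologicalSpace G] [ChartedSpace E G] [Group G]

instance [FiniteDimensional ℝ E] : FiniteDimensional ℝ (GroupLieAlgebra 𝓘(ℝ, E) G) :=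
  inferInstanceAs (FiniteDimensional ℝ E)

instance [LieGroup 𝓘(ℝ, E) ∞ G] : LieGroup 𝓘(ℝ, E) (minSmoothness ℝ 3) G :=
  LieGroup.of_le (n := ∞) (by
    rw [minSmoothness_of_isRCLikeNormedField]
    exact ENat.LEInfty.out)

variable (E) in
/-- The adjoint operator `Ad a`, the differential of `x ↦ a x a⁻¹` at `1`. -/
def Ad (a : G) : GroupLieAlgebra 𝓘(ℝ, E) G →L[ℝ] GroupLieAlgebra 𝓘(ℝ, E) G :=
  mfderiv 𝓘(ℝ, E) 𝓘(ℝ, E) (fun x : G => a * x * a⁻¹) 1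

variable (E) in
/-- The Lie algebra `𝔥` of a closed subgroup `H`: the velocity vectors of the one-parameter
subgroups lying in `H`. (They form a linear subspace as `H` is closed.) -/
def lieAlgebraOf (H : Subgroup G) : Submodule ℝ (GroupLieAlgebra 𝓘(ℝ, E) G) :=
  Submodule.span ℝ {X | ∃ γ : ℝ → G, (∀ s t, γ (s + t) = γ s * γ t) ∧
    ContMDiff 𝓘(ℝ, ℝ) 𝓘(ℝ, E) ∞ γ ∧ (∀ t, γ t ∈ H) ∧
    (mfderiv 𝓘(ℝ, ℝ) 𝓘(ℝ, E) γ 0 (1 : ℝ) : E) = X}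

/-- The isotropy representation of `H` on `𝔤/𝔥` has a finite kernel. -/
def HasFiniteIsotropyKernel (E : Type*) [NormedAddCommGroup E] [NormedSpace ℝ E]
    {G : Type*} [TopologicalSpace G] [ChartedSpace E G] [Group G] (H : Subgroup G) : Prop :=
  {a : G | a ∈ H ∧ ∀ X, Ad E a X - X ∈ lieAlgebraOf E H}.Finite

/-- `𝔤 = 𝔥 ⊕ 𝔪₁ ⊕ ⋯ ⊕ 𝔪_d`, where `𝔪₁, …, 𝔪_d` are pairwise inequivalent irreducible
`H`-submodules of `𝔤`. -/
structure IsIsotropyDecomposition (H : Subgroup G) {d : ℕ}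
    (S : Splitting (lieAlgebraOf E H) d) : Prop where
  invariant : ∀ i, ∀ a ∈ H, ∀ X ∈ S.comp i, Ad E a X ∈ S.comp i
  ne_bot : ∀ i, S.comp i ≠ ⊥
  irreducible : ∀ i, ∀ W ≤ S.comp i, (∀ a ∈ H, ∀ X ∈ W, Ad E a X ∈ W) → W = ⊥ ∨ W = S.comp i
  inequivalent : ∀ i j, i ≠ j → ¬ ∃ f : S.comp i ≃ₗ[ℝ] S.comp j,
    ∀ a ∈ H, ∀ X Y : S.comp i, (Y : GroupLieAlgebra 𝓘(ℝ, E) G) = Ad E a X →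
      (f Y : GroupLieAlgebra 𝓘(ℝ, E) G) = Ad E a (f X)

/-- `g₁` is an `H · Z_G(H⁰)`-invariant Euclidean scalar product on `𝔤/𝔥`, regarded as a form on
`𝔤` with `g₁(𝔥, 𝔤) = 0`; here `H⁰` is the identity component of `H`. -/
structure IsBaseMetric (H : Subgroup G)
    (g₁ : LinearMap.BilinForm ℝ (GroupLieAlgebra 𝓘(ℝ, E) G)) : Prop where
  symm : ∀ X Y, g₁ X Y = g₁ Y X
  kernel : ∀ X ∈ lieAlgebraOf E H, ∀ Y, g₁ X Y = 0
  pos : ∀ X ∉ lieAlgebraOf E H, 0 < g₁ X X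
  invariant : ∀ a ∈ H, ∀ X Y, g₁ (Ad E a X) (Ad E a Y) = g₁ X Y
  invariant_centralizer :
    ∀ a ∈ Subgroup.centralizer (Subtype.val '' connectedComponent (1 : H) : Set G),
      ∀ X Y, g₁ (Ad E a X) (Ad E a Y) = g₁ X Y

end Group

end LocalGeometry

end

/-! Everything reduces to a finite-dimensional model (`Splitting.IsReductiveModel`): a Lie algebra
with an invariant scalar product Q, a Γ-invariant splitting with Γ = Ad(H), and a metric g₁ for
which ad X is skew whenever X commutes with 𝔥. The last property expresses the invariance of g₁
under Z_G(H⁰). Q exists because G is compact, so the Killing form is negative semidefinite and its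
null vectors are central.

In an adapted frame, ℓ_θ is a Laurent polynomial in s with nonnegative coefficients: bracket terms
of weight ε_i+ε_j-ε_k and Killing terms of weight ε_r. The moment map is the barycentre of the
weights (`moment_eq`). Squares of the coefficients of [·,·]_g are multiples of the monomials divided
by ℓ₀. As for moment maps of toric varieties, the limits of these quotients exist along ultrafilters
by compactness and depend only on lim μ(g) (`toric_unique`, `limit_unique`).

From flatness to I: Ricci flatness of the limit removes the bracket terms from the barycentre
(`sum_coeff_limit_of_flat`), so x is a convex combination of weights ε_i. Where x_i > 0, the limit
t_i of 1/a_i is positive. Flatness makes the isotropy representation, extended by the Nomizu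
operators, a representation of 𝔥+𝔪 by skew operators, and torsion-freeness makes the projection to 𝔪
a cocycle for it. A Casimir argument (`cocycle_invariant`) shows that vectors of 𝔪 orthogonal to all
𝔪-components of transvections are parallel. By irreducibility each 𝔪_i consists of such components
or is parallel (`central_or_parallel`). If X+Y is a transvection, X in 𝔪_i and Y in 𝔥, then the
limit Killing form vanishes on it, so t_i X+Y is central in 𝔤. Both alternatives give [𝔥,𝔪_i] = 0
(`lie_𝔥_of_flat`), and then [𝔪_i,𝔪_j] = 0 (`lie_of_flat`), using skewness for g₁ and positivity of
Q. A visible Killing term keeps 𝔪_i away from the centre.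

From I to flatness: the sum of the coordinates in I is at most 1 on Δ, since [𝔪_I,𝔪_I] = 0 excludes
the value 2. It equals 1 at x and is 0 at some vertex ε_r; hence x lies on Γ (`mem_infinity`).
Shrinking the summands of I along s_i = r/u_i, with u adjusted to x, drives μ to x; uniqueness of
limits gives one limit bracket for every approach to x. Its Nomizu operators are compressions to 𝔪
of commuting derivations ad(∑ t_i X_i), so the curvature is zero (`isLocallyEuclidean_flatBracket`).

The passage from G to the model needs elementary Lie theory, developed in a chart at 1: the
differential of Ad, one-parameter subgroups, closed subgroups, and the fact that vectors killed by 𝔥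
are fixed by H⁰. -/

set_option linter.unusedSectionVars false

noncomputable section

namespace LocalGeometry

/-! ### Multiplication of a Lie group in a chart at the identity. -/

section Chart

variable {E : Type*} [NormedAddCommGroup E] [NormedSpace ℝ E]
  {G : Type*} [TopologicalSpace G] [ChartedSpace E G] [Group G]

/-- The chart of `G` at `1`, translated so that it maps `1` to `0`. -/
def toChart (g : G) : E := extChartAt 𝓘(ℝ, E) (1 : G) g - extChartAt 𝓘(ℝ, E) (1 : G) 1

/-- The inverse of `toChart`. -/
def ofChart (x : E) : G :=
  (extChartAt 𝓘(ℝ, E) (1 : G)).symm (x + extChartAt 𝓘(ℝ, E) (1 : G) 1)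

/-- Multiplication of `G` in the chart at `1`. -/
def mulChart (p : E × E) : E := toChart (ofChart p.1 * ofChart p.2 : G)

@[simp] lemma toChart_one : toChart (1 : G) = (0 : E) := by simp [toChart]

@[simp] lemma ofChart_zero : ofChart (0 : E) = (1 : G) := by simp [ofChart]

lemma eventually_toChart_ofChart : ∀ᶠ x in 𝓝 (0 : E), toChart (ofChart x : G) = x := by
  have h : Filter.Tendsto (fun x : E => x + extChartAt 𝓘(ℝ, E) (1 : G) 1) (𝓝 0)
      (𝓝 (extChartAt 𝓘(ℝ, E) (1 : G) 1)) := by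
    have : Continuous (fun x : E => x + extChartAt 𝓘(ℝ, E) (1 : G) 1) := by fun_prop
    simpa using this.tendsto 0
  filter_upwards [h (extChartAt_target_mem_nhds (I := 𝓘(ℝ, E)) (1 : G))] with x hx
  rw [toChart, ofChart, (extChartAt 𝓘(ℝ, E) (1 : G)).right_inv hx]
  exact add_sub_cancel_right _ _

lemma eventually_ofChart_toChart :
    ∀ᶠ g in 𝓝 (1 : G), ofChart (toChart g : E) = g := by
  filter_upwards [extChartAt_source_mem_nhds (I := 𝓘(ℝ, E)) (1 : G)] with x hx
  rw [toChart, ofChart, sub_add_cancel, (extChartAt 𝓘(ℝ, E) (1 : G)).left_inv hx]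

lemma eventually_mulChart_zero_right : ∀ᶠ x : E in 𝓝 0, mulChart (G := G) (x, 0) = x := by
  filter_upwards [eventually_toChart_ofChart (E := E) (G := G)] with x hx
  simpa [mulChart] using hx

lemma eventually_mulChart_zero_left : ∀ᶠ x : E in 𝓝 0, mulChart (G := G) (0, x) = x := by
  filter_upwards [eventually_toChart_ofChart (E := E) (G := G)] with x hx
  simpa [mulChart] using hx

variable [LieGroup 𝓘(ℝ, E) ∞ G]

lemma contMDiffAt_toChart : ContMDiffAt 𝓘(ℝ, E) 𝓘(ℝ, E) ∞ (toChart : G → E) 1 := by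
  have : IsManifold 𝓘(ℝ, E) ∞ G := inferInstance
  have h1 : ContMDiffAt 𝓘(ℝ, E) 𝓘(ℝ, E) ∞ (extChartAt 𝓘(ℝ, E) (1 : G)) 1 :=
    contMDiffAt_extChartAt
  exact h1.sub contMDiffAt_const

lemma contMDiffAt_ofChart : ContMDiffAt 𝓘(ℝ, E) 𝓘(ℝ, E) ∞ (ofChart : E → G) 0 := by
  have h1 : ContMDiffAt 𝓘(ℝ, E) 𝓘(ℝ, E) ∞ (extChartAt 𝓘(ℝ, E) (1 : G)).symm
      ((0 : E) + extChartAt 𝓘(ℝ, E) (1 : G) 1) := by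
    rw [zero_add]
    exact (contMDiffOn_extChartAt_symm (1 : G)).contMDiffAt
      (extChartAt_target_mem_nhds (I := 𝓘(ℝ, E)) (1 : G))
  have h2 : ContMDiffAt 𝓘(ℝ, E) 𝓘(ℝ, E) ∞
      (fun x : E => x + extChartAt 𝓘(ℝ, E) (1 : G) 1) 0 :=
    (contDiff_id.add contDiff_const).contDiffAt.contMDiffAt
  exact ContMDiffAt.comp (0 : E) h1 h2

lemma hasMFDerivAt_toChart :
    HasMFDerivAt 𝓘(ℝ, E) 𝓘(ℝ, E) (toChart : G → E) 1 (ContinuousLinearMap.id ℝ E) := by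
  refine ⟨contMDiffAt_toChart.continuousAt, ?_⟩
  have h : writtenInExtChartAt 𝓘(ℝ, E) 𝓘(ℝ, E) (1 : G) (toChart : G → E) =ᶠ[
      𝓝 (extChartAt 𝓘(ℝ, E) (1 : G) 1)] fun x => x - extChartAt 𝓘(ℝ, E) (1 : G) 1 := by
    filter_upwards [extChartAt_target_mem_nhds (I := 𝓘(ℝ, E)) (1 : G)] with x hx
    simp only [writtenInExtChartAt, Function.comp_apply, toChart,
      (extChartAt 𝓘(ℝ, E) (1 : G)).right_inv hx]
    rfl
  have h2 : HasFDerivAt (fun x : E => x - extChartAt 𝓘(ℝ, E) (1 : G) 1)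
      (ContinuousLinearMap.id ℝ E) (extChartAt 𝓘(ℝ, E) (1 : G) 1) :=
    (hasFDerivAt_id _).sub_const _
  exact (h2.congr_of_eventuallyEq h).hasFDerivWithinAt

lemma hasMFDerivAt_ofChart :
    HasMFDerivAt 𝓘(ℝ, E) 𝓘(ℝ, E) (ofChart : E → G) 0 (ContinuousLinearMap.id ℝ E) := by
  have h1 := (contMDiffAt_ofChart (E := E) (G := G)).mdifferentiableAt (by simp)
  have h1' := h1.hasMFDerivAt
  have h2 := hasMFDerivAt_toChart (E := E) (G := G)
  have h3 : HasMFDerivAt 𝓘(ℝ, E) 𝓘(ℝ, E) (fun x : E => (toChart (ofChart x : G) : E)) 0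
      ((ContinuousLinearMap.id ℝ E).comp (mfderiv 𝓘(ℝ, E) 𝓘(ℝ, E) (ofChart : E → G) 0)) := by
    refine HasMFDerivAt.comp (0 : E) (g := toChart) (f := (ofChart : E → G)) ?_ h1'
    rw [ofChart_zero]; exact h2
  have h4 : HasMFDerivAt 𝓘(ℝ, E) 𝓘(ℝ, E) (fun x : E => (toChart (ofChart x : G) : E)) 0
      (ContinuousLinearMap.id ℝ E) :=
    (hasMFDerivAt_id (I := 𝓘(ℝ, E)) (0 : E)).congr_of_eventuallyEq eventually_toChart_ofChart
  have h5 := hasMFDerivAt_unique h3 h4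
  have h6 : mfderiv 𝓘(ℝ, E) 𝓘(ℝ, E) (ofChart : E → G) 0 = ContinuousLinearMap.id ℝ E :=
    (ContinuousLinearMap.id_comp (mfderiv 𝓘(ℝ, E) 𝓘(ℝ, E) (ofChart : E → G) 0 :
      E →L[ℝ] E)).symm.trans h5
  rw [← h6]
  exact h1'

lemma contMDiffAt_mulChart :
    ContDiffAt ℝ ∞ (mulChart (G := G) : E × E → E) 0 := by
  rw [← contMDiffAt_iff_contDiffAt]
  have h1 : ContMDiffAt 𝓘(ℝ, E × E) 𝓘(ℝ, E) ∞ (fun p : E × E => (ofChart p.1 : G)) 0 :=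
    ContMDiffAt.comp (0 : E × E) (g := (ofChart : E → G)) contMDiffAt_ofChart
      contDiff_fst.contDiffAt.contMDiffAt
  have h2 : ContMDiffAt 𝓘(ℝ, E × E) 𝓘(ℝ, E) ∞ (fun p : E × E => (ofChart p.2 : G)) 0 :=
    ContMDiffAt.comp (0 : E × E) (g := (ofChart : E → G)) contMDiffAt_ofChart
      contDiff_snd.contDiffAt.contMDiffAt
  have h3 := h1.mul h2
  refine ContMDiffAt.comp (0 : E × E) (g := (toChart : G → E)) ?_ h3
  simpa using contMDiffAt_toChart

lemma continuousAt_mul_ofChart :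
    ContinuousAt (fun p : E × E => (ofChart p.1 * ofChart p.2 : G)) 0 := by
  have : IsTopologicalGroup G := topologicalGroup_of_lieGroup 𝓘(ℝ, E) ∞
  have h : ContinuousAt (ofChart : E → G) 0 := contMDiffAt_ofChart.continuousAt
  have h1 : ContinuousAt (fun p : E × E => (ofChart p.1 : G)) 0 :=
    ContinuousAt.comp (x := (0 : E × E)) (g := (ofChart : E → G)) h continuousAt_fst
  have h2 : ContinuousAt (fun p : E × E => (ofChart p.2 : G)) 0 :=
    ContinuousAt.comp (x := (0 : E × E)) (g := (ofChart : E → G)) h continuousAt_snd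
  exact h1.mul h2

lemma eventually_ofChart_mulChart :
    ∀ᶠ p : E × E in 𝓝 0, ofChart (mulChart (G := G) p) = (ofChart p.1 * ofChart p.2 : G) := by
  have h := continuousAt_mul_ofChart (E := E) (G := G)
  have h' : Filter.Tendsto (fun p : E × E => (ofChart p.1 * ofChart p.2 : G)) (𝓝 0) (𝓝 1) := by
    have := h.tendsto
    simpa using this
  exact h'.eventually (eventually_ofChart_toChart (E := E) (G := G))

/-- Both partial differentials are the identity because 1 is a two-sided unit. Strictness is what
later bounds the error by one factor alone. -/
lemma hasStrictFDerivAt_mulChart :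
    HasStrictFDerivAt (mulChart (G := G))
      (ContinuousLinearMap.fst ℝ E E + ContinuousLinearMap.snd ℝ E E) 0 := by
  have h := (contMDiffAt_mulChart (E := E) (G := G)).hasStrictFDerivAt (by simp)
  have h0 := h.hasFDerivAt
  set D := fderiv ℝ (mulChart (G := G) : E × E → E) 0
  have hl : D.comp (ContinuousLinearMap.inl ℝ E E) = ContinuousLinearMap.id ℝ E := by
    have h1 : HasFDerivAt (fun x : E => mulChart (G := G) (x, (0 : E)))
        (D.comp (ContinuousLinearMap.inl ℝ E E)) 0 :=
      HasFDerivAt.comp (0 : E) (g := mulChart (G := G)) (f := fun x : E => (x, (0 : E)))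
        h0 (hasFDerivAt_prodMk_left 0 0)
    exact h1.unique ((hasFDerivAt_id (0 : E)).congr_of_eventuallyEq eventually_mulChart_zero_right)
  have hr : D.comp (ContinuousLinearMap.inr ℝ E E) = ContinuousLinearMap.id ℝ E := by
    have h1 : HasFDerivAt (fun x : E => mulChart (G := G) ((0 : E), x))
        (D.comp (ContinuousLinearMap.inr ℝ E E)) 0 :=
      HasFDerivAt.comp (0 : E) (g := mulChart (G := G)) (f := fun x : E => ((0 : E), x))
        h0 (hasFDerivAt_prodMk_right 0 0)
    exact h1.unique ((hasFDerivAt_id (0 : E)).congr_of_eventuallyEq eventually_mulChart_zero_left)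
  have hD : D = ContinuousLinearMap.fst ℝ E E + ContinuousLinearMap.snd ℝ E E := by
    ext x
    · simpa using congrArg (fun f => f x) hl
    · simpa using congrArg (fun f => f x) hr
  rw [hD] at h
  exact h

variable (G) in
/-- Multiplication in the chart is addition up to a small error. -/
lemma exists_mulChart_near {ε : ℝ} (hε : 0 < ε) :
    ∃ r > 0, ∀ x y : E, ‖x‖ < r → ‖y‖ < r →
      (ofChart x * ofChart y : G) = ofChart (mulChart (G := G) (x, y)) ∧
      toChart (ofChart x : G) = x ∧
      ‖mulChart (G := G) (x, y) - x - y‖ ≤ ε * ‖y‖ := by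
  have h1 := (hasStrictFDerivAt_mulChart (E := E) (G := G)).isLittleO
  have h2 := h1.def hε
  rw [Metric.eventually_nhds_iff] at h2
  obtain ⟨r1, hr1, H1⟩ := h2
  obtain ⟨r2, hr2, H2⟩ := Metric.eventually_nhds_iff.1
    (eventually_ofChart_mulChart (E := E) (G := G))
  obtain ⟨r3, hr3, H3⟩ := Metric.eventually_nhds_iff.1
    (eventually_toChart_ofChart (E := E) (G := G))
  refine ⟨min r1 (min r2 r3), by positivity, fun x y hx hy => ?_⟩
  have hx' := lt_min_iff.1 hx
  have hx'' := lt_min_iff.1 hx'.2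
  have hy' := lt_min_iff.1 hy
  have hy'' := lt_min_iff.1 hy'.2
  have e3 : toChart (ofChart x : G) = x := H3 (by simpa using hx''.2)
  have e2 := @H2 (x, y) (by
    rw [dist_zero_right, Prod.norm_mk]; exact max_lt hx''.1 hy''.1)
  refine ⟨e2.symm, e3, ?_⟩
  -- The two points differ only by y, so the error is at most ε‖y‖, with no contribution of x.
  · have := @H1 ((x, y), (x, 0)) (by
      rw [dist_eq_norm]
      simp only [Prod.fst_sub, Prod.snd_sub, Prod.norm_def, sub_zero]
      exact max_lt (max_lt hx'.1 hy'.1) (max_lt hx'.1 (by simpa using hr1)))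
    simp only [Prod.mk_sub_mk, sub_self, sub_zero] at this
    have e : mulChart (G := G) (x, (0 : E)) = x := by simpa [mulChart] using e3
    rw [e] at this
    simpa [Prod.norm_def] using this

end Chart

/-! ### The adjoint representation and its differential. -/

section Adjoint

variable {E : Type*} [NormedAddCommGroup E] [NormedSpace ℝ E]
  {G : Type*} [TopologicalSpace G] [ChartedSpace E G] [Group G]

/-- `Ad a` as an operator on the model space. -/
def adjointOp (a : G) : E →L[ℝ] E := Ad E a

variable [LieGroup 𝓘(ℝ, E) ∞ G]

variable (E) in
lemma contMDiff_conj (a : G) : ContMDiff 𝓘(ℝ, E) 𝓘(ℝ, E) ∞ (fun x : G => a * x * a⁻¹) :=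
  (contMDiff_const.mul contMDiff_id).mul contMDiff_const

lemma hasMFDerivAt_conj (a : G) :
    HasMFDerivAt 𝓘(ℝ, E) 𝓘(ℝ, E) (fun x : G => a * x * a⁻¹) 1 (Ad E a) :=
  ((contMDiff_conj E a).mdifferentiable (by simp) 1).hasMFDerivAt

lemma hasFDerivAt_conjChart (a : G) :
    HasFDerivAt (fun x : E => (toChart (a * ofChart x * a⁻¹) : E)) (adjointOp a) 0 := by
  refine hasMFDerivAt_iff_hasFDerivAt.1 ?_
  have h1 := hasMFDerivAt_ofChart (E := E) (G := G)
  have h2 : HasMFDerivAt 𝓘(ℝ, E) 𝓘(ℝ, E) (fun x : G => a * x * a⁻¹) (ofChart (0 : E))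
      (adjointOp (E := E) a) := by
    rw [ofChart_zero]; exact hasMFDerivAt_conj a
  have h3 : HasMFDerivAt 𝓘(ℝ, E) 𝓘(ℝ, E) (toChart : G → E) (a * ofChart (0 : E) * a⁻¹)
      (ContinuousLinearMap.id ℝ E) := by
    rw [ofChart_zero, mul_one, mul_inv_cancel]; exact hasMFDerivAt_toChart
  have h4 := HasMFDerivAt.comp (0 : E) h3 (HasMFDerivAt.comp (0 : E) h2 h1)
  exact h4

lemma adjointOp_one : adjointOp (1 : G) = ContinuousLinearMap.id ℝ E := by
  have h := hasFDerivAt_conjChart (E := E) (1 : G)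
  refine h.unique ((hasFDerivAt_id (0 : E)).congr_of_eventuallyEq ?_)
  filter_upwards [eventually_toChart_ofChart (E := E) (G := G)] with x hx
  simpa using hx

lemma adjointOp_mul (a b : G) :
    adjointOp (E := E) (a * b) = (adjointOp a).comp (adjointOp b) := by
  have h1 := hasMFDerivAt_conj (E := E) b
  have h2 : HasMFDerivAt 𝓘(ℝ, E) 𝓘(ℝ, E) (fun x : G => a * x * a⁻¹) (b * 1 * b⁻¹)
      (adjointOp (E := E) a) := by
    rw [mul_one, mul_inv_cancel]; exact hasMFDerivAt_conj a
  have h3 := HasMFDerivAt.comp (1 : G) h2 h1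
  have h4 := hasMFDerivAt_conj (E := E) (a * b)
  have e : ((fun x : G => a * x * a⁻¹) ∘ fun x => b * x * b⁻¹) =
      fun x => a * b * x * (a * b)⁻¹ := by
    ext x; simp [mul_assoc]
  rw [e] at h3
  exact hasMFDerivAt_unique h4 h3

lemma adjointOp_mul_apply (a b : G) (X : E) :
    adjointOp (a * b) X = adjointOp a (adjointOp b X) := by
  rw [adjointOp_mul]; rfl

lemma adjointOp_inv_apply (a : G) (X : E) : adjointOp a⁻¹ (adjointOp a X) = X := by
  rw [← adjointOp_mul_apply, inv_mul_cancel, adjointOp_one]; rfl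

lemma adjointOp_apply_inv (a : G) (X : E) : adjointOp a (adjointOp a⁻¹ X) = X := by
  rw [← adjointOp_mul_apply, mul_inv_cancel, adjointOp_one]; rfl

variable (G) in
/-- The partial differential of the multiplication in the second variable, at `(x, 0)`. -/
def leftTranslationDeriv (x : E) : E →L[ℝ] E :=
  (fderiv ℝ (mulChart (G := G)) (x, 0)).comp (ContinuousLinearMap.inr ℝ E E)

variable (G) in
/-- The partial differential of the multiplication in the first variable, at `(0, x)`. -/
def rightTranslationDeriv (x : E) : E →L[ℝ] E :=
  (fderiv ℝ (mulChart (G := G)) (0, x)).comp (ContinuousLinearMap.inl ℝ E E)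

lemma contDiffAt_leftTranslationDeriv :
    ContDiffAt ℝ ∞ (leftTranslationDeriv (E := E) G) 0 := by
  have h : ContDiffAt ℝ ∞ (fderiv ℝ (mulChart (E := E) (G := G))) ((0 : E), (0 : E)) :=
    (contMDiffAt_mulChart (E := E) (G := G)).fderiv_right (m := ∞) (by simp)
  have h2 : ContDiffAt ℝ ∞ (fun x : E => fderiv ℝ (mulChart (G := G)) (x, (0 : E))) 0 :=
    ContDiffAt.comp (0 : E) (f := fun x : E => (x, (0 : E))) h (by fun_prop)
  exact h2.clm_comp contDiffAt_const

lemma contDiffAt_rightTranslationDeriv :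
    ContDiffAt ℝ ∞ (rightTranslationDeriv (E := E) G) 0 := by
  have h : ContDiffAt ℝ ∞ (fderiv ℝ (mulChart (E := E) (G := G))) ((0 : E), (0 : E)) :=
    (contMDiffAt_mulChart (E := E) (G := G)).fderiv_right (m := ∞) (by simp)
  have h2 : ContDiffAt ℝ ∞ (fun x : E => fderiv ℝ (mulChart (G := G)) ((0 : E), x)) 0 :=
    ContDiffAt.comp (0 : E) (f := fun x : E => ((0 : E), x)) h (by fun_prop)
  exact h2.clm_comp contDiffAt_const

lemma leftTranslationDeriv_zero :
    leftTranslationDeriv G (0 : E) = ContinuousLinearMap.id ℝ E := by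
  have := (hasStrictFDerivAt_mulChart (E := E) (G := G)).hasFDerivAt.fderiv
  ext X
  have e : ((0 : E), (0 : E)) = 0 := rfl
  simp [leftTranslationDeriv, e, this]

lemma rightTranslationDeriv_zero :
    rightTranslationDeriv G (0 : E) = ContinuousLinearMap.id ℝ E := by
  have := (hasStrictFDerivAt_mulChart (E := E) (G := G)).hasFDerivAt.fderiv
  ext X
  have e : ((0 : E), (0 : E)) = 0 := rfl
  simp [rightTranslationDeriv, e, this]

lemma eventually_differentiableAt_mulChart :
    ∀ᶠ p : E × E in 𝓝 0, DifferentiableAt ℝ (mulChart (G := G)) p := by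
  have h := (contMDiffAt_mulChart (E := E) (G := G)).of_le (m := 1) (by exact_mod_cast le_top)
  filter_upwards [h.eventually (by simp)] with p hp
  exact hp.differentiableAt (by simp)

lemma eventually_hasFDerivAt_leftTranslation :
    ∀ᶠ x : E in 𝓝 0, HasFDerivAt (fun y => mulChart (G := G) (x, y))
      (leftTranslationDeriv G x) 0 := by
  have h : Filter.Tendsto (fun x : E => (x, (0 : E))) (𝓝 0) (𝓝 0) :=
    Continuous.tendsto' (by fun_prop) _ _ rfl
  filter_upwards [h.eventually (eventually_differentiableAt_mulChart (G := G))] with x hx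
  exact HasFDerivAt.comp (0 : E) (f := fun y => (x, y)) hx.hasFDerivAt
    (hasFDerivAt_prodMk_right x 0)

lemma eventually_hasFDerivAt_rightTranslation :
    ∀ᶠ x : E in 𝓝 0, HasFDerivAt (fun y => mulChart (G := G) (y, x))
      (rightTranslationDeriv G x) 0 := by
  have h : Filter.Tendsto (fun x : E => ((0 : E), x)) (𝓝 0) (𝓝 0) :=
    Continuous.tendsto' (by fun_prop) _ _ rfl
  filter_upwards [h.eventually (eventually_differentiableAt_mulChart (G := G))] with x hx
  exact HasFDerivAt.comp (0 : E) (f := fun y => (y, x)) hx.hasFDerivAt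
    (hasFDerivAt_prodMk_left 0 x)

/-- Differentiate x y = (x y x⁻¹) x in y at the identity. -/
lemma eventually_leftTranslationDeriv_eq :
    ∀ᶠ x : E in 𝓝 0, leftTranslationDeriv G x =
      (rightTranslationDeriv G x).comp (adjointOp (ofChart x : G)) := by
  filter_upwards [eventually_hasFDerivAt_leftTranslation (E := E) (G := G),
    eventually_hasFDerivAt_rightTranslation (E := E) (G := G)] with x hl hr
  have hc := hasFDerivAt_conjChart (E := E) (ofChart x : G)
  refine hl.unique ?_
  have hr' : HasFDerivAt (fun y => mulChart (G := G) (y, x)) (rightTranslationDeriv G x)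
      (toChart (ofChart x * ofChart (0 : E) * (ofChart x)⁻¹ : G)) := by
    simpa using hr
  have h := HasFDerivAt.comp (0 : E) hr' hc
  refine h.congr_of_eventuallyEq ?_
  have hcont : Filter.Tendsto (fun y : E => (ofChart x * ofChart y * (ofChart x)⁻¹ : G)) (𝓝 0)
      (𝓝 1) := by
    have : IsTopologicalGroup G := topologicalGroup_of_lieGroup 𝓘(ℝ, E) ∞
    have h1 : ContinuousAt (ofChart : E → G) 0 := contMDiffAt_ofChart.continuousAt
    have h2 : ContinuousAt (fun y : E => (ofChart x * ofChart y * (ofChart x)⁻¹ : G)) 0 :=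
      (continuousAt_const.mul h1).mul continuousAt_const
    simpa using h2.tendsto
  filter_upwards [hcont.eventually (eventually_ofChart_toChart (E := E) (G := G))] with y hy
  simp [mulChart, hy]

-- Near 0, Ad is the inverse of the right translation derivative composed with the left one, and
-- both are smooth in x.
variable (G) in
lemma exists_hasFDerivAt_adjointOp [CompleteSpace E] :
    ∃ D : E →L[ℝ] E →L[ℝ] E, HasFDerivAt (fun x : E => adjointOp (ofChart x : G)) D 0 := by
  have hr := contDiffAt_rightTranslationDeriv (E := E) (G := G)
  have hl := contDiffAt_leftTranslationDeriv (E := E) (G := G)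
  have hinv : ContDiffAt ℝ ∞ (fun x : E => (rightTranslationDeriv G x).inverse) 0 := by
    refine ContDiffAt.comp (0 : E) (g := ContinuousLinearMap.inverse) ?_ hr
    rw [rightTranslationDeriv_zero]
    exact contDiffAt_map_inverse (ContinuousLinearEquiv.refl ℝ E)
  have hprod := hinv.clm_comp hl
  have hd := (hprod.differentiableAt (by simp)).hasFDerivAt
  refine ⟨_, hd.congr_of_eventuallyEq ?_⟩
  have hunit : ∀ᶠ x : E in 𝓝 0, (rightTranslationDeriv G x).IsInvertible := by
    have h := hr.continuousAt
    have ho : {f : E →L[ℝ] E | f.IsInvertible} ∈ 𝓝 (rightTranslationDeriv G (0 : E)) := by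
      rw [rightTranslationDeriv_zero]
      exact ContinuousLinearEquiv.nhds (ContinuousLinearEquiv.refl ℝ E)
    exact h ho
  filter_upwards [eventually_leftTranslationDeriv_eq (E := E) (G := G), hunit] with x hx hu
  rw [hx]
  ext Y
  simp only [ContinuousLinearMap.comp_apply]
  symm
  rw [hu.inverse_apply_eq]

lemma hasFDerivAt_leftTranslationDeriv :
    HasFDerivAt (leftTranslationDeriv G)
      (fderiv ℝ (leftTranslationDeriv (E := E) G) 0) 0 :=
  (contDiffAt_leftTranslationDeriv.differentiableAt (by simp)).hasFDerivAt

lemma fderiv_leftTranslationDeriv_apply (X Y : E) :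
    fderiv ℝ (leftTranslationDeriv (E := E) G) 0 X Y =
      fderiv ℝ (fderiv ℝ (mulChart (E := E) (G := G))) 0 (X, 0) (0, Y) := by
  have h : ContDiffAt ℝ ∞ (fderiv ℝ (mulChart (E := E) (G := G))) ((0 : E), (0 : E)) :=
    (contMDiffAt_mulChart (E := E) (G := G)).fderiv_right (m := ∞) (by simp)
  have h1 := (h.differentiableAt (by simp)).hasFDerivAt
  have h2 : HasFDerivAt (fun x : E => fderiv ℝ (mulChart (G := G)) (x, (0 : E))) _ 0 :=
    HasFDerivAt.comp (0 : E) (f := fun x : E => (x, (0 : E))) h1 (hasFDerivAt_prodMk_left 0 0)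
  have h3 := h2.clm_comp (hasFDerivAt_const (ContinuousLinearMap.inr ℝ E E) (0 : E))
  have h4 := HasFDerivAt.fderiv (f := leftTranslationDeriv (E := E) G) h3
  rw [h4]
  simp
  rfl

lemma fderiv_rightTranslationDeriv_apply (X Y : E) :
    fderiv ℝ (rightTranslationDeriv (E := E) G) 0 X Y =
      fderiv ℝ (fderiv ℝ (mulChart (E := E) (G := G))) 0 (0, X) (Y, 0) := by
  have h : ContDiffAt ℝ ∞ (fderiv ℝ (mulChart (E := E) (G := G))) ((0 : E), (0 : E)) :=
    (contMDiffAt_mulChart (E := E) (G := G)).fderiv_right (m := ∞) (by simp)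
  have h1 := (h.differentiableAt (by simp)).hasFDerivAt
  have h2 : HasFDerivAt (fun x : E => fderiv ℝ (mulChart (G := G)) ((0 : E), x)) _ 0 :=
    HasFDerivAt.comp (0 : E) (f := fun x : E => ((0 : E), x)) h1 (hasFDerivAt_prodMk_right 0 0)
  have h3 := h2.clm_comp (hasFDerivAt_const (ContinuousLinearMap.inl ℝ E E) (0 : E))
  have h4 := HasFDerivAt.fderiv (f := rightTranslationDeriv (E := E) G) h3
  rw [h4]
  simp
  rfl

/-- Differentiate L = R ∘ Ad at 0. Symmetry of the second derivative of the multiplication turns the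
derivative of R into that of L with the arguments exchanged. -/
lemma fderiv_adjointOp_ofChart [CompleteSpace E] (X Y : E) :
    fderiv ℝ (fun x : E => adjointOp (ofChart x : G)) 0 X Y =
      fderiv ℝ (leftTranslationDeriv (E := E) G) 0 X Y -
        fderiv ℝ (leftTranslationDeriv (E := E) G) 0 Y X := by
  obtain ⟨D, hD⟩ := exists_hasFDerivAt_adjointOp (E := E) G
  have hr : HasFDerivAt (rightTranslationDeriv G)
      (fderiv ℝ (rightTranslationDeriv (E := E) G) 0) 0 :=
    (contDiffAt_rightTranslationDeriv.differentiableAt (by simp)).hasFDerivAt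
  have h1 := (hr.clm_comp hD).congr_of_eventuallyEq
    (eventually_leftTranslationDeriv_eq (E := E) (G := G))
  have h2 := h1.unique hasFDerivAt_leftTranslationDeriv
  have h3 := congrArg (fun f => f X Y) h2
  simp [rightTranslationDeriv_zero, adjointOp_one] at h3
  rw [hD.fderiv]
  rw [fderiv_rightTranslationDeriv_apply] at h3
  rw [fderiv_leftTranslationDeriv_apply Y X]
  have hs : IsSymmSndFDerivAt ℝ (mulChart (E := E) (G := G)) 0 :=
    (contMDiffAt_mulChart (E := E) (G := G)).isSymmSndFDerivAt (by
      rw [minSmoothness_of_isRCLikeNormedField]; exact ENat.LEInfty.out)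
  rw [← h3, hs.eq (Y, 0) (0, X)]
  abel

variable (G) in
/-- The bracket of the Lie algebra of `G` as an operation on the model space. -/
def groupBracket (X Y : E) : E :=
  @Bracket.bracket (GroupLieAlgebra 𝓘(ℝ, E) G) (GroupLieAlgebra 𝓘(ℝ, E) G) _ X Y

/-- The bracket of the Lie algebra in the chart at `1`. -/
lemma groupBracket_eq_fderiv_leftTranslationDeriv [CompleteSpace E] (X Y : E) :
    groupBracket G X Y = fderiv ℝ (leftTranslationDeriv (E := E) G) 0 X Y -
        fderiv ℝ (leftTranslationDeriv (E := E) G) 0 Y X := by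
  have : IsManifold 𝓘(ℝ, E) ∞ G := inferInstance
  have : IsManifold 𝓘(ℝ, E) 1 G := IsManifold.of_le (n := ∞) (by simp)
  set φ := extChartAt 𝓘(ℝ, E) (1 : G) with hφ
  set o : E := φ 1 with ho
  -- In the chart the left-invariant field with value X at 1 is z ↦ L(z - o)X, found by
  -- differentiating y ↦ g y computed in G and in coordinates.
  have key : ∀ X : E,
      VectorField.mpullbackWithin 𝓘(ℝ, E) 𝓘(ℝ, E) φ.symm
        (mulInvariantVectorField (I := 𝓘(ℝ, E)) (G := G) X)
        (Set.range 𝓘(ℝ, E)) =ᶠ[𝓝 o] fun z : E => leftTranslationDeriv G (z - o) X := by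
    intro X
    have ht : Filter.Tendsto (fun z : E => z - o) (𝓝 o) (𝓝 0) :=
      Continuous.tendsto' (by fun_prop) _ _ (sub_self o)
    have hg : Filter.Tendsto (fun z : E => (ofChart (z - o) : G)) (𝓝 o) (𝓝 1) := by
      have h := (contMDiffAt_ofChart (E := E) (G := G)).continuousAt.tendsto
      rw [ofChart_zero] at h
      exact h.comp ht
    filter_upwards [extChartAt_target_mem_nhds (I := 𝓘(ℝ, E)) (1 : G),
      ht.eventually (eventually_hasFDerivAt_leftTranslation (E := E) (G := G)),
      hg (extChartAt_source_mem_nhds (I := 𝓘(ℝ, E)) (1 : G))] with z hz hl hs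
    have hofz : (ofChart (z - o) : G) = φ.symm z := by
      rw [ofChart, ← hφ, ← ho, sub_add_cancel]
    refine ((isInvertible_mfderivWithin_extChartAt_symm hz).inverse_apply_eq).2 ?_
    have hsymm : HasMFDerivAt 𝓘(ℝ, E) 𝓘(ℝ, E) φ.symm z
        (mfderivWithin 𝓘(ℝ, E) 𝓘(ℝ, E) φ.symm (Set.range 𝓘(ℝ, E)) z) := by
      have h1 : MDifferentiableAt 𝓘(ℝ, E) 𝓘(ℝ, E) φ.symm z :=
        ((contMDiffOn_extChartAt_symm (n := 1) (1 : G)).contMDiffAt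
          ((isOpen_extChartAt_target (1 : G)).mem_nhds hz)).mdifferentiableAt (by simp)
      have h2 := h1.hasMFDerivAt
      have h3 : Set.range 𝓘(ℝ, E) = Set.univ := by simp
      rw [h3, mfderivWithin_univ]
      exact h2
    set g : G := φ.symm z with hgdef
    have hl' : HasMFDerivAt 𝓘(ℝ, E) 𝓘(ℝ, E)
        (fun y : E => mulChart (G := G) (z - o, y) + o) 0 (leftTranslationDeriv (E := E) G (z - o)) :=
      hasMFDerivAt_iff_hasFDerivAt.2 (hl.add_const o)
    have hval : mulChart (G := G) (z - o, (0 : E)) + o = z := by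
      simp only [mulChart, ofChart_zero, mul_one, hofz, toChart, ← hφ, ← ho, sub_add_cancel]
      exact φ.right_inv hz
    have hA : HasMFDerivAt 𝓘(ℝ, E) 𝓘(ℝ, E)
        (fun y : E => φ.symm (mulChart (G := G) (z - o, y) + o)) 0
        ((mfderivWithin 𝓘(ℝ, E) 𝓘(ℝ, E) φ.symm (Set.range 𝓘(ℝ, E)) z : E →L[ℝ] E).comp
          (leftTranslationDeriv (E := E) G (z - o))) := by
      refine HasMFDerivAt.comp (0 : E) (g := φ.symm) ?_ hl'
      rw [hval]; exact hsymm
    have hB0 : HasMFDerivAt 𝓘(ℝ, E) 𝓘(ℝ, E) (fun x : G => g * x) (ofChart (0 : E))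
        (mfderiv 𝓘(ℝ, E) 𝓘(ℝ, E) (fun x : G => g * x) (1 : G) : E →L[ℝ] E) := by
      rw [ofChart_zero]
      exact ((contMDiff_mul_left (I := 𝓘(ℝ, E)) (n := ∞) (a := g)).mdifferentiable
        (by simp) 1).hasMFDerivAt
    have hB := HasMFDerivAt.comp (0 : E) hB0 (hasMFDerivAt_ofChart (E := E) (G := G))
    have hAB : (fun x : G => g * x) ∘ (ofChart : E → G) =ᶠ[𝓝 0]
        fun y : E => φ.symm (mulChart (G := G) (z - o, y) + o) := by
      have hc : Filter.Tendsto (fun y : E => g * ofChart y) (𝓝 0) (𝓝 g) := by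
        have : IsTopologicalGroup G := topologicalGroup_of_lieGroup 𝓘(ℝ, E) ∞
        have h1 : ContinuousAt (ofChart : E → G) 0 := contMDiffAt_ofChart.continuousAt
        have h2 : ContinuousAt (fun y : E => g * ofChart y) 0 := continuousAt_const.mul h1
        simpa using h2.tendsto
      change (ofChart (z - o) : G) ∈ (extChartAt 𝓘(ℝ, E) (1 : G)).source at hs
      rw [hofz] at hs
      filter_upwards [hc ((isOpen_extChartAt_source (I := 𝓘(ℝ, E)) (1 : G)).mem_nhds hs)]
        with y hy
      simp only [Function.comp_apply, mulChart, hofz, toChart, ← hφ, ← ho, sub_add_cancel]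
      exact (φ.left_inv hy).symm
    have hfin := hasMFDerivAt_unique hB (hA.congr_of_eventuallyEq hAB)
    exact congrArg (fun f : E →L[ℝ] E => f X) hfin
  have hid : (mfderiv 𝓘(ℝ, E) 𝓘(ℝ, E) φ (1 : G) : E →L[ℝ] E) = ContinuousLinearMap.id ℝ E := by
    have h := hasMFDerivAt_toChart (E := E) (G := G)
    have h2 : HasMFDerivAt 𝓘(ℝ, E) 𝓘(ℝ, E) (fun g : G => toChart g + o) 1
        (ContinuousLinearMap.id ℝ E) := by
      have := HasMFDerivAt.comp (1 : G) (g := fun x : E => x + o)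
        (g' := ContinuousLinearMap.id ℝ E) (hasMFDerivAt_iff_hasFDerivAt.2
          ((hasFDerivAt_id (toChart (1 : G) : E)).add_const o)) h
      exact this
    have e : (fun g : G => toChart g + o) = φ := by
      ext g; simp [toChart, hφ, ho]
    rw [e] at h2
    exact h2.mfderiv
  have hdef : groupBracket G X Y = _ :=
    VectorField.mlieBracketWithin_apply (I := 𝓘(ℝ, E))
      (V := mulInvariantVectorField (I := 𝓘(ℝ, E)) (G := G) X)
      (W := mulInvariantVectorField (I := 𝓘(ℝ, E)) (G := G) Y) (s := Set.univ) (x₀ := (1 : G))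
  refine hdef.trans ?_
  have hset : (φ.symm ⁻¹' Set.univ ∩ Set.range 𝓘(ℝ, E)) = (Set.univ : Set E) := by simp
  have hgen : ∀ V W : E → E, V =ᶠ[𝓝 o] (fun z => leftTranslationDeriv G (z - o) X) →
      W =ᶠ[𝓝 o] (fun z => leftTranslationDeriv G (z - o) (Y : E)) →
      VectorField.lieBracketWithin ℝ V W (φ.symm ⁻¹' Set.univ ∩ Set.range 𝓘(ℝ, E)) o =
      fderiv ℝ (leftTranslationDeriv (E := E) G) 0 X Y -
        fderiv ℝ (leftTranslationDeriv (E := E) G) 0 Y X := by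
    intro V W hV hW
    rw [hset, VectorField.lieBracketWithin_univ,
      Filter.EventuallyEq.lieBracket_vectorField_eq hV hW, VectorField.lieBracket_eq]
    have hd : ∀ Z : E, HasFDerivAt (fun z : E => leftTranslationDeriv G (z - o) Z)
        ((ContinuousLinearMap.apply ℝ E Z).comp
          (fderiv ℝ (leftTranslationDeriv (E := E) G) 0)) o := by
      intro Z
      have h0 := hasFDerivAt_leftTranslationDeriv (E := E) (G := G)
      rw [← sub_self o] at h0
      have h1 := HasFDerivAt.comp o (f := fun z : E => z - o) h0
        ((hasFDerivAt_id o).sub_const o)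
      have h2 := ((ContinuousLinearMap.apply ℝ E Z).hasFDerivAt).comp o h1
      rw [sub_self] at h2
      exact h2
    have e1 := (hd X).fderiv
    have e2 := (hd Y).fderiv
    simp only [e1, e2, sub_self, leftTranslationDeriv_zero]
    simp
  have hgoal := hgen _ _ (key X) (key Y)
  refine Eq.trans (congrArg _ hgoal) ?_
  have hinv : (mfderiv 𝓘(ℝ, E) 𝓘(ℝ, E) φ (1 : G) : E →L[ℝ] E).inverse =
      ContinuousLinearMap.id ℝ E := by
    rw [hid]; exact ContinuousLinearMap.inverse_id
  exact congrArg (fun f : E →L[ℝ] E => f _) hinv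

/-- The differential of `Ad` at `1` is `ad`. -/
lemma hasFDerivAt_adjointOp_apply [CompleteSpace E] (X Y : E) :
    ∃ D : E →L[ℝ] E, HasFDerivAt (fun x : E => adjointOp (ofChart x : G) Y) D 0 ∧
      D X = groupBracket G X Y := by
  obtain ⟨D, hD⟩ := exists_hasFDerivAt_adjointOp (E := E) G
  refine ⟨(ContinuousLinearMap.apply ℝ E Y).comp D,
    ((ContinuousLinearMap.apply ℝ E Y).hasFDerivAt).comp (0 : E) hD, ?_⟩
  rw [groupBracket_eq_fderiv_leftTranslationDeriv, ← fderiv_adjointOp_ofChart, hD.fderiv]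
  rfl

/-- The derivative of `Ad` along a curve through `1`. -/
lemma hasDerivAt_adjointOp_curve [CompleteSpace E] {c : ℝ → G} {X : E}
    (hc : HasDerivAt (fun t => (toChart (c t) : E)) X 0)
    (hc1 : Filter.Tendsto c (𝓝 0) (𝓝 1)) (h0 : c 0 = 1) (Y : E) :
    HasDerivAt (fun t => adjointOp (c t) Y) (groupBracket G X Y) 0 := by
  obtain ⟨D, hD, hDX⟩ := hasFDerivAt_adjointOp_apply (G := G) X Y
  have hD' : HasFDerivAt (fun x : E => adjointOp (ofChart x : G) Y) D (toChart (c 0)) := by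
    rw [h0, toChart_one]; exact hD
  have h := hD'.comp_hasDerivAt (0 : ℝ) hc
  rw [hDX] at h
  refine h.congr_of_eventuallyEq ?_
  filter_upwards [hc1.eventually (eventually_ofChart_toChart (E := E) (G := G))] with t ht
  simp [ht]

end Adjoint

/-! ### One-parameter subgroups. -/

section OneParameter

variable {E : Type*} [NormedAddCommGroup E] [NormedSpace ℝ E]
  {G : Type*} [TopologicalSpace G] [ChartedSpace E G] [Group G]

/-- The velocity at `0` of a curve through `1`. -/
def velocity (γ : ℝ → G) : E := mfderiv 𝓘(ℝ, ℝ) 𝓘(ℝ, E) γ 0 (1 : ℝ)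

/-- A one-parameter subgroup `γ` with velocity `v`. -/
structure IsOneParameterSubgroup (γ : ℝ → G) (v : E) : Prop where
  map_add : ∀ s t, γ (s + t) = γ s * γ t
  tendsto : Filter.Tendsto γ (𝓝 0) (𝓝 1)
  hasDerivAt : HasDerivAt (fun t => (toChart (γ t) : E)) v 0

namespace IsOneParameterSubgroup

variable {γ γ' : ℝ → G} {v : E}

lemma map_zero (h : IsOneParameterSubgroup γ v) : γ 0 = 1 := by
  have := h.map_add 0 0
  simpa using this

lemma map_nat_mul (h : IsOneParameterSubgroup γ v) (n : ℕ) (t : ℝ) : γ (n * t) = γ t ^ n := by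
  induction n with
  | zero => simp [h.map_zero]
  | succ k ih => rw [pow_succ, ← ih, ← h.map_add]; congr 1; push_cast; ring

lemma comp_mul (h : IsOneParameterSubgroup γ v) (c : ℝ) :
    IsOneParameterSubgroup (fun t => γ (c * t)) (c • v) where
  map_add s t := by rw [mul_add, h.map_add]
  tendsto := h.tendsto.comp (Continuous.tendsto' (by fun_prop) _ _ (by simp))
  hasDerivAt := by
    have h1 : HasDerivAt (fun t : ℝ => c * t) c 0 := by
      simpa using (hasDerivAt_id (0 : ℝ)).const_mul c
    have h2 : HasDerivAt (fun t => (toChart (γ t) : E)) v (c * 0) := by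
      simpa using h.hasDerivAt
    exact h2.scomp (0 : ℝ) h1

variable [LieGroup 𝓘(ℝ, E) ∞ G]

/-- Differentiating γ(t+s) = γ(t)γ(s) at s = 0 shows that γ solves the autonomous equation x' =
L(x)v in the chart. Smoothness and uniqueness both come from this equation. -/
lemma eventually_hasDerivAt (h : IsOneParameterSubgroup γ v) :
    ∀ᶠ t in 𝓝 (0 : ℝ), HasDerivAt (fun t => (toChart (γ t) : E))
      (leftTranslationDeriv G (toChart (γ t)) v) t := by
  have hc : Filter.Tendsto (fun t => (toChart (γ t) : E)) (𝓝 0) (𝓝 0) := by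
    simpa [h.map_zero] using h.hasDerivAt.continuousAt.tendsto
  filter_upwards [h.tendsto.eventually (eventually_ofChart_toChart (E := E) (G := G)),
    hc.eventually (eventually_hasFDerivAt_leftTranslation (E := E) (G := G))] with t ht hl
  have h0 : (toChart (γ 0) : E) = 0 := by rw [h.map_zero, toChart_one]
  have hl' : HasFDerivAt (fun y : E => mulChart (G := G) ((toChart (γ t) : E), y))
      (leftTranslationDeriv G (toChart (γ t))) (toChart (γ 0)) := by rw [h0]; exact hl
  have h1 := hl'.comp_hasDerivAt (0 : ℝ) h.hasDerivAt
  have h2 : HasDerivAt (fun s => (toChart (γ (t + s)) : E))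
      (leftTranslationDeriv G (toChart (γ t)) v) 0 := by
    refine h1.congr_of_eventuallyEq ?_
    filter_upwards [h.tendsto.eventually (eventually_ofChart_toChart (E := E) (G := G))]
      with s hs
    simp [mulChart, ht, hs, h.map_add]
  have h3 : HasDerivAt (fun s => (toChart (γ (t + s)) : E))
      (leftTranslationDeriv G (toChart (γ t)) v) (t - t) := by simpa using h2
  have h4 := HasDerivAt.scomp t (h := fun s => s - t) h3
    ((hasDerivAt_id t).sub_const t)
  simpa [Function.comp_def] using h4

/-- Bootstrapping: a C^k solution has a C^k right-hand side, so it is C^(k+1). -/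
lemma contDiffAt_toChart (h : IsOneParameterSubgroup γ v) (n : ℕ) :
    ContDiffAt ℝ n (fun t => (toChart (γ t) : E)) 0 := by
  have hF : ContDiffAt ℝ n (fun x : E => leftTranslationDeriv G x v) 0 :=
    ((contDiffAt_leftTranslationDeriv (E := E) (G := G)).of_le
      (by exact_mod_cast le_top)).clm_apply contDiffAt_const
  have hFe := hF.eventually (by simp)
  have hc : Filter.Tendsto (fun t => (toChart (γ t) : E)) (𝓝 0) (𝓝 0) := by
    simpa [h.map_zero] using h.hasDerivAt.continuousAt.tendsto
  obtain ⟨r, hr, H⟩ := Metric.eventually_nhds_iff_ball.1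
    (h.eventually_hasDerivAt.and (hc.eventually hFe))
  have ho : IsOpen (Metric.ball (0 : ℝ) r) := Metric.isOpen_ball
  have hk : ∀ k : ℕ, k ≤ n → ContDiffOn ℝ k (fun t => (toChart (γ t) : E))
      (Metric.ball (0 : ℝ) r) := by
    intro k
    induction k with
    | zero =>
      intro _
      refine contDiffOn_zero.2 fun t ht => ?_
      exact (H t ht).1.continuousAt.continuousWithinAt
    | succ k ih =>
      intro hkn
      have hk := ih (by omega)
      have := (contDiffOn_succ_iff_deriv_of_isOpen (𝕜 := ℝ) (n := (k : ℕ∞ω))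
        (f := fun t => (toChart (γ t) : E)) ho).2 ⟨fun t ht =>
          (H t ht).1.differentiableAt.differentiableWithinAt, by simp, ?_⟩
      · exact_mod_cast this
      · have e : ContDiffOn ℝ k (fun t => leftTranslationDeriv G (toChart (γ t) : E) v)
            (Metric.ball (0 : ℝ) r) := by
          intro t ht
          have h1 : ContDiffAt ℝ k (fun x : E => leftTranslationDeriv G x v)
            (toChart (γ t)) := (H t ht).2.of_le (by exact_mod_cast (by omega : k ≤ n))
          exact ContDiffAt.comp_contDiffWithinAt t h1 (hk t ht)
        exact e.congr fun t ht => (H t ht).1.deriv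
  exact (hk n le_rfl).contDiffAt (Metric.ball_mem_nhds _ hr)

lemma contMDiff (h : IsOneParameterSubgroup γ v) : ContMDiff 𝓘(ℝ, ℝ) 𝓘(ℝ, E) ∞ γ := by
  rw [contMDiff_infty]
  intro n
  have hle : (n : ℕ∞ω) ≤ ∞ := by exact_mod_cast le_top
  have : LieGroup 𝓘(ℝ, E) n G := LieGroup.of_le (n := ∞) hle
  have h0 : ContMDiffAt 𝓘(ℝ, ℝ) 𝓘(ℝ, E) n γ 0 := by
    have h1 : ContMDiffAt 𝓘(ℝ, ℝ) 𝓘(ℝ, E) n (fun t => (toChart (γ t) : E)) 0 :=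
      (h.contDiffAt_toChart n).contMDiffAt
    have h2 : ContMDiffAt 𝓘(ℝ, E) 𝓘(ℝ, E) n (ofChart : E → G) (toChart (γ 0)) := by
      rw [h.map_zero, toChart_one]; exact contMDiffAt_ofChart.of_le hle
    have h3 := ContMDiffAt.comp (0 : ℝ) (f := fun t => (toChart (γ t) : E)) h2 h1
    refine h3.congr_of_eventuallyEq ?_
    filter_upwards [h.tendsto.eventually (eventually_ofChart_toChart (E := E) (G := G))]
      with s hs
    simp [hs]
  intro t
  have h1 : ContMDiffAt 𝓘(ℝ, ℝ) 𝓘(ℝ, E) n (fun s => γ (s - t)) t := by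
    have h2 : ContMDiffAt 𝓘(ℝ, ℝ) 𝓘(ℝ, ℝ) n (fun s : ℝ => s - t) t :=
      (contDiff_id.sub contDiff_const).contDiffAt.contMDiffAt
    refine ContMDiffAt.comp t (g := γ) ?_ h2
    rw [sub_self]; exact h0
  have h2 : ContMDiffAt 𝓘(ℝ, ℝ) 𝓘(ℝ, E) n (fun s => γ t * γ (s - t)) t :=
    contMDiffAt_const.mul h1
  refine h2.congr_of_eventuallyEq (Filter.Eventually.of_forall fun s => ?_)
  change γ s = γ t * γ (s - t)
  rw [← h.map_add, add_sub_cancel]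

lemma velocity_eq (h : IsOneParameterSubgroup γ v) :
    velocity γ = v := by
  have h1 : HasMFDerivAt 𝓘(ℝ, ℝ) 𝓘(ℝ, E) γ 0 (mfderiv 𝓘(ℝ, ℝ) 𝓘(ℝ, E) γ 0) :=
    (h.contMDiff.mdifferentiable (by simp) 0).hasMFDerivAt
  have h2 : HasMFDerivAt 𝓘(ℝ, E) 𝓘(ℝ, E) (toChart : G → E) (γ 0)
      (ContinuousLinearMap.id ℝ E) := by
    rw [h.map_zero]; exact hasMFDerivAt_toChart
  have h3 := HasMFDerivAt.comp (0 : ℝ) h2 h1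
  have h4 := hasMFDerivAt_iff_hasFDerivAt.2 h.hasDerivAt.hasFDerivAt
  have h5 := hasMFDerivAt_unique h3 h4
  have h6 := congrArg (fun f : ℝ →L[ℝ] E => f 1) h5
  refine Eq.trans (show _ = _ from rfl) (h6.trans ?_)
  simp

lemma of_contMDiff {γ : ℝ → G} (hadd : ∀ s t, γ (s + t) = γ s * γ t)
    (hs : ContMDiff 𝓘(ℝ, ℝ) 𝓘(ℝ, E) ∞ γ) :
    IsOneParameterSubgroup γ (velocity γ : E) := by
  have h0 : γ 0 = 1 := by simpa using hadd 0 0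
  refine ⟨hadd, by simpa [h0] using hs.continuous.tendsto 0, ?_⟩
  have h1 : HasMFDerivAt 𝓘(ℝ, ℝ) 𝓘(ℝ, E) γ 0 (mfderiv 𝓘(ℝ, ℝ) 𝓘(ℝ, E) γ 0) :=
    (hs.mdifferentiable (by simp) 0).hasMFDerivAt
  have h2 : HasMFDerivAt 𝓘(ℝ, E) 𝓘(ℝ, E) (toChart : G → E) (γ 0)
      (ContinuousLinearMap.id ℝ E) := by
    rw [h0]; exact hasMFDerivAt_toChart
  have h3 := HasMFDerivAt.comp (0 : ℝ) h2 h1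
  let D : ℝ →L[ℝ] E := mfderiv 𝓘(ℝ, ℝ) 𝓘(ℝ, E) γ 0
  have h4 : HasFDerivAt (fun t => (toChart (γ t) : E)) D 0 :=
    hasMFDerivAt_iff_hasFDerivAt.1 h3
  exact h4.hasDerivAt

/-- A one-parameter subgroup is determined by its velocity. -/
lemma unique (h : IsOneParameterSubgroup γ v) (h' : IsOneParameterSubgroup γ' v) : γ = γ' := by
  have hF : ContDiffAt ℝ 1 (fun x : E => leftTranslationDeriv G x v) 0 :=
    ((contDiffAt_leftTranslationDeriv (E := E) (G := G)).of_le
      (by exact_mod_cast le_top)).clm_apply contDiffAt_const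
  obtain ⟨K, s, hs, hK⟩ := hF.exists_lipschitzOnWith
  have hc : Filter.Tendsto (fun t => (toChart (γ t) : E)) (𝓝 0) (𝓝 0) := by
    simpa [h.map_zero] using h.hasDerivAt.continuousAt.tendsto
  have hc' : Filter.Tendsto (fun t => (toChart (γ' t) : E)) (𝓝 0) (𝓝 0) := by
    simpa [h'.map_zero] using h'.hasDerivAt.continuousAt.tendsto
  have he := eventually_ofChart_toChart (E := E) (G := G)
  obtain ⟨r, hr, H⟩ := Metric.eventually_nhds_iff_ball.1
    ((h.eventually_hasDerivAt.and (hc.eventually hs)).and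
      ((h'.eventually_hasDerivAt.and (hc'.eventually hs)).and
        ((h.tendsto.eventually he).and (h'.tendsto.eventually he))))
  have hball : ∀ t ∈ Set.Ioo (-r) r, t ∈ Metric.ball (0 : ℝ) r := by
    intro t ht
    rw [Metric.mem_ball, dist_zero_right, Real.norm_eq_abs]
    exact abs_lt.2 ht
  have heq := ODE_solution_unique_of_mem_Ioo (E := E)
    (v := fun _ x => leftTranslationDeriv G x v) (s := fun _ => s) (K := K)
    (f := fun t => (toChart (γ t) : E)) (g := fun t => (toChart (γ' t) : E))
    (a := -r) (b := r) (t₀ := 0) (fun _ _ => hK) ⟨by linarith, hr⟩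
    (fun t ht => (H t (hball t ht)).1) (fun t ht => (H t (hball t ht)).2.1)
    (by simp [h.map_zero, h'.map_zero])
  have hloc : ∀ t ∈ Set.Ioo (-r) r, γ t = γ' t := by
    intro t ht
    have h1 := (H t (hball t ht)).2.2
    rw [← h1.1, ← h1.2]
    exact congrArg ofChart (heq ht)
  funext t
  -- Local equality spreads to all times through γ(t) = γ(t/n)^n.
  obtain ⟨n, hn⟩ := exists_nat_gt (|t| / r)
  have hn0 : (0 : ℝ) < n := lt_of_le_of_lt (by positivity) hn
  have e : t = n * (t / n) := by field_simp
  rw [e, h.map_nat_mul, h'.map_nat_mul, hloc]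
  rw [Set.mem_Ioo, ← abs_lt, abs_div, abs_of_pos hn0, div_lt_iff₀ hn0]
  rw [div_lt_iff₀ hr] at hn
  linarith

lemma conj (h : IsOneParameterSubgroup γ v) (a : G) :
    IsOneParameterSubgroup (fun t => a * γ t * a⁻¹) (adjointOp a v) where
  map_add s t := by rw [h.map_add]; group
  tendsto := by
    have : IsTopologicalGroup G := topologicalGroup_of_lieGroup 𝓘(ℝ, E) ∞
    have := (h.tendsto.const_mul a).mul_const a⁻¹
    simpa using this
  hasDerivAt := by
    have h1 : HasFDerivAt (fun x : E => (toChart (a * ofChart x * a⁻¹) : E)) (adjointOp a)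
        (toChart (γ 0)) := by
      rw [h.map_zero, toChart_one]; exact hasFDerivAt_conjChart a
    refine (h1.comp_hasDerivAt (0 : ℝ) h.hasDerivAt).congr_of_eventuallyEq ?_
    filter_upwards [h.tendsto.eventually (eventually_ofChart_toChart (E := E) (G := G))]
      with s hs
    simp [hs]

variable [CompleteSpace E]

lemma hasDerivAt_adjointOp_zero (h : IsOneParameterSubgroup γ v) (Y : E) :
    HasDerivAt (fun t => adjointOp (γ t) Y) (groupBracket G v Y) 0 :=
  hasDerivAt_adjointOp_curve h.hasDerivAt h.tendsto h.map_zero Y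

lemma hasDerivAt_adjointOp (h : IsOneParameterSubgroup γ v) (Y : E) (t : ℝ) :
    HasDerivAt (fun t => adjointOp (γ t) Y) (adjointOp (γ t) (groupBracket G v Y)) t := by
  have h1 := ((adjointOp (E := E) (γ t)).hasFDerivAt).comp_hasDerivAt (0 : ℝ)
    (h.hasDerivAt_adjointOp_zero Y)
  have h3 : HasDerivAt ((adjointOp (E := E) (γ t)) ∘ fun t => adjointOp (γ t) Y)
      (adjointOp (γ t) (groupBracket G v Y)) (t - t) := by simpa using h1
  have h4 := HasDerivAt.scomp t (h := fun s => s - t) h3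
    ((hasDerivAt_id t).sub_const t)
  rw [one_smul] at h4
  refine h4.congr_of_eventuallyEq (Filter.Eventually.of_forall fun s => ?_)
  simp only [Function.comp_apply]
  rw [← adjointOp_mul_apply, ← h.map_add, add_sub_cancel]

lemma adjointOp_eq_self (h : IsOneParameterSubgroup γ v) {Y : E} (hY : groupBracket G v Y = 0)
    (t : ℝ) : adjointOp (γ t) Y = Y := by
  have hd := h.hasDerivAt_adjointOp Y
  simp only [hY, _root_.map_zero] at hd
  have := is_const_of_deriv_eq_zero (fun t => (hd t).differentiableAt)
    (fun t => (hd t).deriv) t 0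
  rw [this, h.map_zero, adjointOp_one]; rfl

end IsOneParameterSubgroup

end OneParameter

/-! ### Limits of directions in a closed subgroup. -/

section Limit

variable {E : Type*} [NormedAddCommGroup E] [NormedSpace ℝ E]
  {G : Type*} [TopologicalSpace G] [ChartedSpace E G] [Group G]

lemma eventually_continuousAt_ofChart :
    ∀ᶠ x in 𝓝 (0 : E), ContinuousAt (ofChart : E → G) x := by
  have h : Filter.Tendsto (fun x : E => x + extChartAt 𝓘(ℝ, E) (1 : G) 1) (𝓝 0)
      (𝓝 (extChartAt 𝓘(ℝ, E) (1 : G) 1)) :=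
    Continuous.tendsto' (by fun_prop) _ _ (by simp)
  filter_upwards [h ((isOpen_extChartAt_target (I := 𝓘(ℝ, E)) (1 : G)).mem_nhds
    (mem_extChartAt_target (I := 𝓘(ℝ, E)) (1 : G)))] with x hx
  have h1 : ContinuousAt (extChartAt 𝓘(ℝ, E) (1 : G)).symm
      (x + extChartAt 𝓘(ℝ, E) (1 : G) 1) :=
    (continuousOn_extChartAt_symm (I := 𝓘(ℝ, E)) (1 : G)).continuousAt
      ((isOpen_extChartAt_target (I := 𝓘(ℝ, E)) (1 : G)).mem_nhds hx)
  exact ContinuousAt.comp (f := fun x : E => x + extChartAt 𝓘(ℝ, E) (1 : G) 1) h1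
    (by fun_prop)

variable [LieGroup 𝓘(ℝ, E) ∞ G]

-- Each new factor z costs at most ε‖z‖, however far the previous power has moved, so k factors cost
-- k ε‖z‖. The bound on k(1+ε)‖z‖ keeps all partial products in the domain of the estimate.
variable (G) in
lemma exists_pow_near {ε : ℝ} (hε : 0 < ε) :
    ∃ r > 0, (∀ x : E, ‖x‖ < r → toChart (ofChart x : G) = x ∧
        ContinuousAt (ofChart : E → G) x) ∧
      ∀ (z : E) (k : ℕ), ‖z‖ < r → k * ((1 + ε) * ‖z‖) < r →
        ∃ x : E, (ofChart z : G) ^ k = ofChart x ∧ ‖x - (k : ℝ) • z‖ ≤ k * (ε * ‖z‖) := by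
  obtain ⟨r, hr, H⟩ := exists_mulChart_near G (E := E) hε
  obtain ⟨r', hr', H'⟩ := Metric.eventually_nhds_iff.1
    (eventually_continuousAt_ofChart (E := E) (G := G))
  refine ⟨min r r', lt_min hr hr', fun x hx => ⟨(H x x (hx.trans_le (min_le_left _ _))
    (hx.trans_le (min_le_left _ _))).2.1,
    H' (by simpa using hx.trans_le (min_le_right _ _))⟩, fun z k hz => ?_⟩
  replace hz := hz.trans_le (min_le_left _ _)
  induction k with
  | zero => intro _; exact ⟨0, by simp, by simp⟩
  | succ k ih =>
    intro hk
    have hk1 : (k : ℝ) * ((1 + ε) * ‖z‖) ≤ ((k + 1 : ℕ) : ℝ) * ((1 + ε) * ‖z‖) := by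
      push_cast
      have : 0 ≤ (1 + ε) * ‖z‖ := by positivity
      nlinarith
    obtain ⟨x, hx, hxe⟩ := ih (lt_of_le_of_lt hk1 hk)
    have hxn : ‖x‖ < r := by
      have h1 : ‖x‖ ≤ ‖x - (k : ℝ) • z‖ + ‖(k : ℝ) • z‖ := by
        simpa using norm_add_le (x - (k : ℝ) • z) ((k : ℝ) • z)
      rw [norm_smul, Real.norm_of_nonneg (Nat.cast_nonneg k)] at h1
      have h2 := (lt_of_le_of_lt hk1 hk).trans_le (min_le_left r r')
      nlinarith
    obtain ⟨e1, -, e2⟩ := H x z hxn hz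
    refine ⟨mulChart (G := G) (x, z), by rw [pow_succ, hx, e1], ?_⟩
    have e3 : mulChart (G := G) (x, z) - ((k + 1 : ℕ) : ℝ) • z =
        (mulChart (G := G) (x, z) - x - z) + (x - (k : ℝ) • z) := by
      push_cast
      rw [add_smul, one_smul]
      abel
    rw [e3]
    refine (norm_add_le _ _).trans ?_
    push_cast
    linarith

/-- Differentiating x x⁻¹ = 1 gives -1. This transfers one-sided differentiability of a
one-parameter subgroup at 0 to the other side. -/
lemma hasFDerivAt_invChart :
    HasFDerivAt (fun x : E => (toChart ((ofChart x : G)⁻¹) : E))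
      (-ContinuousLinearMap.id ℝ E) 0 := by
  have h1 : ContMDiffAt 𝓘(ℝ, E) 𝓘(ℝ, E) ∞ (fun x : E => ((ofChart x : G)⁻¹)) 0 :=
    contMDiffAt_ofChart.inv
  have h2 : ContMDiffAt 𝓘(ℝ, E) 𝓘(ℝ, E) ∞ (fun x : E => (toChart ((ofChart x : G)⁻¹) : E)) 0 := by
    refine ContMDiffAt.comp (0 : E) (g := (toChart : G → E)) ?_ h1
    simpa using contMDiffAt_toChart
  have h3 := ((contMDiffAt_iff_contDiffAt.1 h2).differentiableAt (by simp)).hasFDerivAt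
  set N := fderiv ℝ (fun x : E => (toChart ((ofChart x : G)⁻¹) : E)) 0
  have h4 : HasFDerivAt (fun x : E => (x, (toChart ((ofChart x : G)⁻¹) : E)))
      ((ContinuousLinearMap.id ℝ E).prod N) 0 := (hasFDerivAt_id (0 : E)).prodMk h3
  have h5 : HasFDerivAt (mulChart (G := G))
      (ContinuousLinearMap.fst ℝ E E + ContinuousLinearMap.snd ℝ E E)
      ((0 : E), (toChart ((ofChart (0 : E) : G)⁻¹) : E)) := by
    have h := (hasStrictFDerivAt_mulChart (E := E) (G := G)).hasFDerivAt
    have e : ((0 : E), (toChart ((ofChart (0 : E) : G)⁻¹) : E)) = 0 := by simp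
    rw [e]
    exact h
  have h6 := HasFDerivAt.comp (0 : E) (f := fun x : E => (x, (toChart ((ofChart x : G)⁻¹) : E)))
    h5 h4
  have hcont : Filter.Tendsto (fun x : E => (ofChart x : G)⁻¹) (𝓝 0) (𝓝 1) := by
    simpa using h1.continuousAt.tendsto
  have h7 : HasFDerivAt (fun _ : E => (0 : E)) (0 : E →L[ℝ] E) 0 := hasFDerivAt_const _ _
  have h8 := h6.unique (h7.congr_of_eventuallyEq (by
    filter_upwards [hcont.eventually (eventually_ofChart_toChart (E := E) (G := G))] with x hx
    simp [mulChart, hx]))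
  have h9 : N = -ContinuousLinearMap.id ℝ E := by
    ext X
    have := congrArg (fun f : E →L[ℝ] E => f X) h8
    simp only [ContinuousLinearMap.comp_apply, ContinuousLinearMap.prod_apply,
      add_apply, ContinuousLinearMap.coe_fst', ContinuousLinearMap.coe_snd',
      zero_apply, ContinuousLinearMap.id_apply] at this
    simpa using eq_neg_of_add_eq_zero_right this
  rwa [h9] at h3

lemma tendsto_floor_mul {ι : Type*} {l : Filter ι} {δ : ι → ℝ}
    (hδ : Filter.Tendsto δ l (𝓝[>] 0)) (t : ℝ) :
    Filter.Tendsto (fun n => (⌊t / δ n⌋ : ℝ) * δ n) l (𝓝 t) := by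
  rw [tendsto_nhdsWithin_iff] at hδ
  have h1 : Filter.Tendsto (fun n => t - δ n) l (𝓝 t) := by
    simpa using tendsto_const_nhds.sub hδ.1
  refine tendsto_of_tendsto_of_tendsto_of_le_of_le' h1 tendsto_const_nhds ?_ ?_
  · filter_upwards [hδ.2] with n hn
    have hn : 0 < δ n := hn
    have := Int.sub_one_lt_floor (t / δ n)
    have h2 : (t / δ n - 1) * δ n ≤ ⌊t / δ n⌋ * δ n := by gcongr
    rwa [sub_mul, div_mul_cancel₀ _ hn.ne', one_mul] at h2
  · filter_upwards [hδ.2] with n hn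
    have hn : 0 < δ n := hn
    have := Int.floor_le (t / δ n)
    have h2 : ⌊t / δ n⌋ * δ n ≤ t / δ n * δ n := by gcongr
    rwa [div_mul_cancel₀ _ hn.ne'] at h2

/-- Limits of directions of elements of a closed subgroup are velocities of one-parameter
subgroups. -/
theorem exists_oneParameterSubgroup_of_tendsto [CompactSpace G] [T2Space G]
    [FiniteDimensional ℝ E] {H : Subgroup G} (hH : IsClosed (H : Set G))
    {ι : Type*} {l : Filter ι} [l.NeBot] {h : ι → G} {δ : ι → ℝ} {v : E}
    (hδ : Filter.Tendsto δ l (𝓝[>] 0)) (hh : Filter.Tendsto h l (𝓝 1))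
    (hv : Filter.Tendsto (fun n => (δ n)⁻¹ • (toChart (h n) : E)) l (𝓝 v))
    (hm : ∀ᶠ n in l, h n ∈ H) :
    ∃ γ : ℝ → G, IsOneParameterSubgroup γ v ∧ ∀ t, γ t ∈ H := by
  have : IsTopologicalGroup G := topologicalGroup_of_lieGroup 𝓘(ℝ, E) ∞
  set U : Ultrafilter ι := Ultrafilter.of l
  have hU : (U : Filter ι) ≤ l := Ultrafilter.of_le l
  replace hδ := hδ.mono_left hU
  replace hh := hh.mono_left hU
  replace hv := hv.mono_left hU
  replace hm := hm.filter_mono hU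
  have hδpos : ∀ᶠ n in (U : Filter ι), 0 < δ n := (tendsto_nhdsWithin_iff.1 hδ).2
  have hδ0 : Filter.Tendsto δ U (𝓝 0) := (tendsto_nhdsWithin_iff.1 hδ).1
  -- The subgroup is the limit of integer powers of h n. Compactness of G supplies the limit along
  -- an ultrafilter for all t at once.
  set u : ℝ → ι → G := fun t n => h n ^ ⌊t / δ n⌋ with hu
  set γ : ℝ → G := fun t => (U.map (u t)).lim with hγ
  have hlim : ∀ t, Filter.Tendsto (u t) U (𝓝 (γ t)) := fun t =>
    (U.map (u t)).le_nhds_lim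
  have hmem : ∀ t, γ t ∈ H := fun t => by
    refine hH.mem_of_tendsto (hlim t) ?_
    filter_upwards [hm] with n hn using H.zpow_mem hn _
  have hadd : ∀ s t, γ (s + t) = γ s * γ t := by
    intro s t
    have h1 : Filter.Tendsto (fun n => (u s n * u t n)⁻¹ * u (s + t) n) U (𝓝 1) := by
      intro V hV
      have h1V : (1 : G) ∈ V := mem_of_mem_nhds hV
      refine Filter.mem_map.2 ?_
      have hV' : ∀ᶠ n in (U : Filter ι), h n ∈ V := hh hV
      filter_upwards [hV'] with n hn
      have e : (u s n * u t n)⁻¹ * u (s + t) n =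
          h n ^ (⌊(s + t) / δ n⌋ - (⌊s / δ n⌋ + ⌊t / δ n⌋)) := by
        simp only [hu]
        rw [← zpow_add, ← zpow_neg, ← zpow_add]
        congr 1
        ring
      -- Floors are additive up to 0 or 1, so the defect of additivity is 1 or h n, and both tend to
      -- 1.
      have hfl : ⌊(s + t) / δ n⌋ - (⌊s / δ n⌋ + ⌊t / δ n⌋) = 0 ∨
          ⌊(s + t) / δ n⌋ - (⌊s / δ n⌋ + ⌊t / δ n⌋) = 1 := by
        rw [add_div]
        have h1 := Int.le_floor_add (s / δ n) (t / δ n)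
        have h2 := Int.le_floor_add_floor (s / δ n) (t / δ n)
        omega
      change (u s n * u t n)⁻¹ * u (s + t) n ∈ V
      rw [e]
      rcases hfl with hfl | hfl <;> rw [hfl]
      · simpa using h1V
      · simpa using hn
    have h2 := ((hlim s).mul (hlim t)).inv.mul (hlim (s + t))
    have h3 := tendsto_nhds_unique h2 h1
    rwa [inv_mul_eq_one, eq_comm] at h3
  have h0 : γ 0 = 1 := by simpa using hadd 0 0
  have hneg : ∀ t, γ (-t) = (γ t)⁻¹ := fun t => by
    rw [eq_inv_iff_mul_eq_one, ← hadd, neg_add_cancel, h0]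
  -- the local estimate
  have hloc : ∀ ε > 0, ∃ ρ > 0, ∀ t, 0 ≤ t → t < ρ → ∃ x : E, γ t = ofChart x ∧
      toChart (γ t) = x ∧ ‖x - t • v‖ ≤ t * (ε * ‖v‖) := by
    intro ε hε
    obtain ⟨r, hr, H1, H2⟩ := exists_pow_near G (E := E) hε
    -- This forces t(1+ε)‖v‖ < r/2, so the powers end up in the compact ball of radius r/2, well
    -- inside the domain of the estimate.
    refine ⟨r / 2 / ((1 + ε) * (‖v‖ + 1)), by positivity, fun t ht0 ht => ?_⟩
    rw [lt_div_iff₀ (by positivity)] at ht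
    set z : ι → E := fun n => toChart (h n) with hz
    set k : ι → ℕ := fun n => ⌊t / δ n⌋.toNat with hk
    have hzl : Filter.Tendsto z U (𝓝 0) := by
      have h1 := hδ0.smul hv
      rw [zero_smul] at h1
      refine h1.congr' ?_
      filter_upwards [hδpos] with n hn
      rw [smul_smul, mul_inv_cancel₀ hn.ne', one_smul]
    have hkδ : Filter.Tendsto (fun n => (k n : ℝ) * δ n) U (𝓝 t) := by
      refine (tendsto_floor_mul hδ t).congr' ?_
      filter_upwards [hδpos] with n hn
      have : 0 ≤ ⌊t / δ n⌋ := Int.floor_nonneg.2 (by positivity)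
      simp only [hk]
      congr 1
      exact_mod_cast (Int.toNat_of_nonneg this).symm
    have hkz : Filter.Tendsto (fun n => (k n : ℝ) • z n) U (𝓝 (t • v)) := by
      refine (hkδ.smul hv).congr' ?_
      filter_upwards [hδpos] with n hn
      rw [smul_smul, mul_assoc, mul_inv_cancel₀ hn.ne', mul_one]
    have hkzn : Filter.Tendsto (fun n => (k n : ℝ) * ‖z n‖) U (𝓝 (t * ‖v‖)) := by
      have h1 := hkz.norm
      rw [norm_smul, Real.norm_of_nonneg ht0] at h1
      refine h1.congr fun n => ?_
      rw [norm_smul, Real.norm_of_nonneg (Nat.cast_nonneg _)]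
    have hbound : ∀ᶠ n in (U : Filter ι), (k n : ℝ) * ((1 + ε) * ‖z n‖) < r / 2 := by
      have h1 := hkzn.mul_const (1 + ε)
      have h2 : t * ‖v‖ * (1 + ε) < r / 2 := by nlinarith
      filter_upwards [h1.eventually (gt_mem_nhds h2)] with n hn
      linarith
    have hpow : ∀ᶠ n in (U : Filter ι), ∃ x : E, u t n = ofChart x ∧
        ‖x - (k n : ℝ) • z n‖ ≤ k n * (ε * ‖z n‖) ∧ x ∈ Metric.closedBall (0 : E) (r / 2) := by
      filter_upwards [hbound, hzl.eventually (Metric.ball_mem_nhds 0 hr), hδpos,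
        hh.eventually (eventually_ofChart_toChart (E := E) (G := G))] with n hn1 hn2 hn3 hn4
      rw [dist_zero_right] at hn2
      obtain ⟨x, hx1, hx2⟩ := H2 (z n) (k n) hn2 (by linarith)
      refine ⟨x, ?_, hx2, ?_⟩
      · rw [← hx1, hz]
        simp only [hu]
        rw [hn4, hk]
        have : 0 ≤ ⌊t / δ n⌋ := Int.floor_nonneg.2 (by positivity)
        conv_lhs => rw [← Int.toNat_of_nonneg this]
        rw [zpow_natCast]
      · rw [mem_closedBall_zero_iff]
        have h1 : ‖x‖ ≤ ‖x - (k n : ℝ) • z n‖ + ‖(k n : ℝ) • z n‖ := by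
          simpa using norm_add_le (x - (k n : ℝ) • z n) ((k n : ℝ) • z n)
        rw [norm_smul, Real.norm_of_nonneg (Nat.cast_nonneg _)] at h1
        nlinarith
    have hex : ∃ x : ι → E, ∀ᶠ n in (U : Filter ι), u t n = ofChart (x n) ∧
        ‖x n - (k n : ℝ) • z n‖ ≤ k n * (ε * ‖z n‖) ∧
        x n ∈ Metric.closedBall (0 : E) (r / 2) := by
      classical
      refine ⟨fun n => if hn : ∃ x : E, u t n = ofChart x ∧
        ‖x - (k n : ℝ) • z n‖ ≤ k n * (ε * ‖z n‖) ∧ x ∈ Metric.closedBall (0 : E) (r / 2)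
        then hn.choose else 0, ?_⟩
      filter_upwards [hpow] with n hn
      rw [dif_pos hn]
      exact hn.choose_spec
    obtain ⟨x, hx⟩ := hex
    have hK : IsCompact (Metric.closedBall (0 : E) (r / 2)) := isCompact_closedBall _ _
    obtain ⟨y, hyK, hy⟩ := hK.ultrafilter_le_nhds (U.map x) (by
      rw [Filter.le_principal_iff]
      exact hx.mono fun n hn => hn.2.2)
    have hyt : Filter.Tendsto x U (𝓝 y) := hy
    have hyr : ‖y‖ < r := by
      rw [mem_closedBall_zero_iff] at hyK
      linarith
    have hγy : γ t = ofChart y := by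
      refine tendsto_nhds_unique (hlim t) ?_
      refine (((H1 y hyr).2.tendsto).comp hyt).congr' ?_
      filter_upwards [hx] with n hn using hn.1.symm
    refine ⟨y, hγy, by rw [hγy]; exact (H1 y hyr).1, ?_⟩
    have h1 : Filter.Tendsto (fun n => ‖x n - (k n : ℝ) • z n‖) U (𝓝 ‖y - t • v‖) :=
      (hyt.sub hkz).norm
    have h2 : Filter.Tendsto (fun n => (k n : ℝ) * (ε * ‖z n‖)) U (𝓝 (t * (ε * ‖v‖))) := by
      refine ((hkzn.mul_const ε).congr fun n => ?_).trans_eq ?_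
      · ring
      · congr 1; ring
    refine le_of_tendsto_of_tendsto h1 h2 ?_
    filter_upwards [hx] with n hn using hn.2.1
  -- behaviour at `0` from the right and from the left
  have hright : HasDerivWithinAt (fun t => (toChart (γ t) : E)) v (Set.Ici 0) 0 := by
    rw [hasDerivWithinAt_iff_isLittleO, Asymptotics.isLittleO_iff]
    intro c hc
    obtain ⟨ρ, hρ, Hρ⟩ := hloc (c / (‖v‖ + 1)) (by positivity)
    filter_upwards [self_mem_nhdsWithin, nhdsWithin_le_nhds (Metric.ball_mem_nhds 0 hρ)]
      with t ht0 ht1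
    have ht0 : 0 ≤ t := ht0
    rw [Metric.mem_ball, dist_zero_right, Real.norm_of_nonneg ht0] at ht1
    obtain ⟨x, -, hx2, hx3⟩ := Hρ t ht0 ht1
    rw [hx2, h0, toChart_one, sub_zero, sub_zero, Real.norm_of_nonneg ht0]
    refine hx3.trans ?_
    rw [mul_comm]
    gcongr
    rw [div_mul_eq_mul_div, div_le_iff₀ (by positivity)]
    gcongr
    linarith
  have hγr : Filter.Tendsto γ (𝓝[≥] 0) (𝓝 1) := by
    obtain ⟨ρ, hρ, Hρ⟩ := hloc 1 one_pos
    have h1 : Filter.Tendsto (fun t => (toChart (γ t) : E)) (𝓝[≥] 0) (𝓝 0) := by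
      have := hright.continuousWithinAt.tendsto
      rwa [h0, toChart_one] at this
    have h2 : Filter.Tendsto (ofChart : E → G) (𝓝 0) (𝓝 1) := by
      simpa using (contMDiffAt_ofChart (E := E) (G := G)).continuousAt.tendsto
    refine (h2.comp h1).congr' ?_
    filter_upwards [self_mem_nhdsWithin, nhdsWithin_le_nhds (Metric.ball_mem_nhds 0 hρ)]
      with t ht0 ht1
    have ht0 : 0 ≤ t := ht0
    rw [Metric.mem_ball, dist_zero_right, Real.norm_of_nonneg ht0] at ht1
    obtain ⟨x, hx1, hx2, -⟩ := Hρ t ht0 ht1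
    rw [Function.comp_apply, hx2, hx1]
  have hnegt : Filter.Tendsto (fun t : ℝ => -t) (𝓝[≤] 0) (𝓝[≥] 0) := by
    have h1 : Filter.Tendsto (fun t : ℝ => -t) (𝓝 0) (𝓝 0) :=
      Continuous.tendsto' (by fun_prop) _ _ (by simp)
    refine tendsto_nhdsWithin_iff.2 ⟨h1.mono_left nhdsWithin_le_nhds, ?_⟩
    filter_upwards [self_mem_nhdsWithin] with t ht
    exact neg_nonneg.2 (Set.mem_Iic.1 ht)
  have hγl : Filter.Tendsto γ (𝓝[≤] 0) (𝓝 1) := by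
    have := (hγr.comp hnegt).inv
    rw [inv_one] at this
    refine this.congr fun t => ?_
    rw [Function.comp_apply, hneg, inv_inv]
  -- Negative times are reduced to positive ones by γ(-t) = γ(t)⁻¹; the two signs cancel.
  have hleft : HasDerivWithinAt (fun t => (toChart (γ t) : E)) v (Set.Iic 0) 0 := by
    have h1 : HasDerivWithinAt (fun t => (toChart (γ (-t)) : E)) (-v) (Set.Iic 0) 0 := by
      have hr0 : HasDerivWithinAt (fun t => (toChart (γ t) : E)) v (Set.Ici 0) (-0 : ℝ) := by
        simpa using hright
      have := HasDerivWithinAt.scomp (h := fun t : ℝ => -t) (0 : ℝ) hr0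
        (hasDerivAt_neg (0 : ℝ)).hasDerivWithinAt (s := Set.Iic 0)
        (fun t ht => Set.mem_Ici.2 (neg_nonneg.2 (Set.mem_Iic.1 ht)))
      simpa [Function.comp_def] using this
    have h2 : HasFDerivAt (fun x : E => (toChart ((ofChart x : G)⁻¹) : E))
        (-ContinuousLinearMap.id ℝ E) (toChart (γ (-0))) := by
      simpa [h0] using hasFDerivAt_invChart (E := E) (G := G)
    have h3 := h2.comp_hasDerivWithinAt (0 : ℝ) h1
    simp only [neg_apply, ContinuousLinearMap.id_apply, neg_neg] at h3
    refine h3.congr_of_eventuallyEq ?_ (by simp [h0])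
    filter_upwards [(hγr.comp hnegt).eventually
      (eventually_ofChart_toChart (E := E) (G := G))] with t ht
    simp only [Function.comp_apply] at ht ⊢
    rw [ht, hneg, inv_inv]
  refine ⟨γ, ⟨hadd, ?_, ?_⟩, hmem⟩
  · rw [← nhdsLE_sup_nhdsGE]
    exact hγl.sup hγr
  · have := hleft.union hright
    rwa [Set.Iic_union_Ici, hasDerivWithinAt_univ] at this

end Limit

/-! ### The Lie algebra of a closed subgroup and the action of its identity component. -/

section ClosedSubgroup

variable {E : Type*} [NormedAddCommGroup E] [NormedSpace ℝ E]
  {G : Type*} [TopologicalSpace G] [ChartedSpace E G] [Group G]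
  [LieGroup 𝓘(ℝ, E) ∞ G]

variable (E) in
/-- The Lie algebra of a closed subgroup as a subspace of the model space. -/
def velocitySubmodule (H : Subgroup G) : Submodule ℝ E := lieAlgebraOf E H

section Continuity

variable [CompleteSpace E]

lemma continuous_adjointOp_apply (Y : E) : Continuous fun a : G => adjointOp a Y := by
  have : IsTopologicalGroup G := topologicalGroup_of_lieGroup 𝓘(ℝ, E) ∞
  have h1 : ContinuousAt (fun a : G => adjointOp a Y) 1 := by
    obtain ⟨D, hD⟩ := exists_hasFDerivAt_adjointOp (E := E) G
    have h2 : ContinuousAt (fun x : E => adjointOp (ofChart x : G) Y) (toChart (1 : G)) := by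
      rw [toChart_one]
      exact hD.continuousAt.clm_apply continuousAt_const
    have h3 : ContinuousAt (toChart : G → E) 1 := contMDiffAt_toChart.continuousAt
    refine (ContinuousAt.comp (x := (1 : G)) h2 h3).congr ?_
    filter_upwards [eventually_ofChart_toChart (E := E) (G := G)] with a ha
    simp [ha]
  rw [continuous_iff_continuousAt]
  intro a
  have h2 : ContinuousAt (fun b : G => adjointOp (a⁻¹ * b) Y) a := by
    refine ContinuousAt.comp (g := fun b : G => adjointOp b Y) ?_ (by fun_prop)
    simpa using h1
  have h3 := (adjointOp (E := E) a).continuous.continuousAt.comp h2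
  refine h3.congr (Filter.Eventually.of_forall fun b => ?_)
  simp [← adjointOp_mul_apply]

end Continuity

variable [FiniteDimensional ℝ E]

lemma IsOneParameterSubgroup.groupBracket_mem {γ : ℝ → G} {v : E}
    (h : IsOneParameterSubgroup γ v) {W : Submodule ℝ E} {Y : E} (hW : ∀ t, adjointOp (γ t) Y ∈ W) :
    groupBracket G v Y ∈ W := by
  have : CompleteSpace E := FiniteDimensional.complete ℝ E
  have hd := h.hasDerivAt_adjointOp_zero Y
  have hcl : IsClosed (W : Set E) := W.closed_of_finiteDimensional
  rw [hasDerivAt_iff_tendsto_slope] at hd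
  refine hcl.mem_of_tendsto hd (Filter.Eventually.of_forall fun t => ?_)
  simp only [slope, vsub_eq_sub, SetLike.mem_coe]
  exact W.smul_mem _ (W.sub_mem (hW t) (hW 0))

lemma IsOneParameterSubgroup.skew_of_invariant {γ : ℝ → G} {v : E}
    (h : IsOneParameterSubgroup γ v) (g : LinearMap.BilinForm ℝ E)
    (hg : ∀ t X Y, g (adjointOp (γ t) X) (adjointOp (γ t) Y) = g X Y) (X Y : E) :
    g (groupBracket G v X) Y = -g X (groupBracket G v Y) := by
  have : CompleteSpace E := FiniteDimensional.complete ℝ E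
  let g' : E →L[ℝ] E →L[ℝ] ℝ := LinearMap.toContinuousLinearMap
    ((LinearMap.toContinuousLinearMap : (E →ₗ[ℝ] ℝ) ≃ₗ[ℝ] (E →L[ℝ] ℝ)).toLinearMap ∘ₗ g)
  have hg' : ∀ X Y, g' X Y = g X Y := fun X Y => rfl
  have h1 := ((g'.hasFDerivAt).comp_hasDerivAt (0 : ℝ)
    (h.hasDerivAt_adjointOp_zero X)).clm_apply (h.hasDerivAt_adjointOp_zero Y)
  have h2 : HasDerivAt (fun _ : ℝ => g X Y) 0 0 := hasDerivAt_const _ _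
  have h3 := h2.unique (h1.congr_of_eventuallyEq
    (Filter.Eventually.of_forall fun t => by simp [hg', hg]))
  simp only [Function.comp_apply, h.map_zero, adjointOp_one, ContinuousLinearMap.id_apply,
    hg'] at h3
  linarith

variable [CompactSpace G] [T2Space G]

-- The exponential map, obtained from the limit theorem for H = G and the points with coordinates t
-- v.
variable (G) in
lemma exists_oneParameterSubgroup (v : E) : ∃ γ : ℝ → G, IsOneParameterSubgroup γ v := by
  have hδ : Filter.Tendsto (fun t : ℝ => t) (𝓝[>] 0) (𝓝[>] 0) := Filter.tendsto_id
  have h1 : Filter.Tendsto (fun t : ℝ => t • v) (𝓝[>] 0) (𝓝 0) :=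
    (Continuous.tendsto' (f := fun t : ℝ => t • v) (by fun_prop) 0 0 (by simp)).mono_left
      nhdsWithin_le_nhds
  have h2 : Filter.Tendsto (ofChart : E → G) (𝓝 0) (𝓝 1) := by
    simpa using (contMDiffAt_ofChart (E := E) (G := G)).continuousAt.tendsto
  have h3 : Filter.Tendsto (fun t : ℝ => t⁻¹ • (toChart (ofChart (t • v) : G) : E))
      (𝓝[>] 0) (𝓝 v) := by
    refine tendsto_const_nhds.congr' ?_
    filter_upwards [self_mem_nhdsWithin,
      h1.eventually (eventually_toChart_ofChart (E := E) (G := G))] with t ht ht2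
    have ht : (0 : ℝ) < t := ht
    rw [ht2, smul_smul, inv_mul_cancel₀ ht.ne', one_smul]
  obtain ⟨γ, hγ, -⟩ := exists_oneParameterSubgroup_of_tendsto (H := (⊤ : Subgroup G))
    isClosed_univ hδ (h2.comp h1) h3 (Filter.Eventually.of_forall fun _ => Subgroup.mem_top _)
  exact ⟨γ, hγ⟩

lemma adjointOp_groupBracket (a : G) (X Y : E) :
    adjointOp a (groupBracket G X Y) = groupBracket G (adjointOp a X) (adjointOp a Y) := by
  have : CompleteSpace E := FiniteDimensional.complete ℝ E
  obtain ⟨γ, hγ⟩ := exists_oneParameterSubgroup G X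
  have h1 := (hγ.conj a).hasDerivAt_adjointOp_zero (adjointOp a Y)
  have h2 := ((adjointOp (E := E) a).hasFDerivAt).comp_hasDerivAt (0 : ℝ)
    (hγ.hasDerivAt_adjointOp_zero Y)
  refine h2.unique (h1.congr_of_eventuallyEq (Filter.Eventually.of_forall fun t => ?_))
  simp [← adjointOp_mul_apply]

/-- The product curve γγ' has velocity v + v' but need not be a homomorphism; the limit theorem
replaces it by one. -/
lemma IsOneParameterSubgroup.add_of_mem {H : Subgroup G} (hH : IsClosed (H : Set G))
    {γ γ' : ℝ → G} {v v' : E} (h : IsOneParameterSubgroup γ v) (hm : ∀ t, γ t ∈ H)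
    (h' : IsOneParameterSubgroup γ' v') (hm' : ∀ t, γ' t ∈ H) :
    ∃ β : ℝ → G, IsOneParameterSubgroup β (v + v') ∧ ∀ t, β t ∈ H := by
  have : IsTopologicalGroup G := topologicalGroup_of_lieGroup 𝓘(ℝ, E) ∞
  have hd : HasDerivAt (fun t => (toChart (γ t * γ' t) : E)) (v + v') 0 := by
    have h1 : HasFDerivAt (mulChart (G := G))
        (ContinuousLinearMap.fst ℝ E E + ContinuousLinearMap.snd ℝ E E)
        ((toChart (γ 0) : E), (toChart (γ' 0) : E)) := by
      have e : ((toChart (γ 0) : E), (toChart (γ' 0) : E)) = 0 := by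
        simp [h.map_zero, h'.map_zero]
      rw [e]
      exact (hasStrictFDerivAt_mulChart (E := E) (G := G)).hasFDerivAt
    have h2 := h1.comp_hasDerivAt (0 : ℝ) (h.hasDerivAt.prodMk h'.hasDerivAt)
    simp only [add_apply, ContinuousLinearMap.coe_fst', ContinuousLinearMap.coe_snd'] at h2
    refine h2.congr_of_eventuallyEq ?_
    filter_upwards [h.tendsto.eventually (eventually_ofChart_toChart (E := E) (G := G)),
      h'.tendsto.eventually (eventually_ofChart_toChart (E := E) (G := G))] with t ht ht'
    simp [mulChart, ht, ht']
  have hs := hasDerivAt_iff_tendsto_slope.1 hd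
  refine exists_oneParameterSubgroup_of_tendsto hH (l := 𝓝[>] (0 : ℝ)) (δ := fun t => t)
    (h := fun t => γ t * γ' t) Filter.tendsto_id ?_ ?_
    (Filter.Eventually.of_forall fun t => H.mul_mem (hm t) (hm' t))
  · have := h.tendsto.mul h'.tendsto
    rw [mul_one] at this
    exact this.mono_left nhdsWithin_le_nhds
  · refine (hs.mono_left (nhdsWithin_mono _ fun t ht => ?_)).congr fun t => ?_
    · exact (Set.mem_Ioi.1 ht).ne'
    · simp [slope, h.map_zero, h'.map_zero]

/-- The Lie algebra of a closed subgroup consists of the velocities of its one-parameter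
subgroups. -/
lemma exists_of_mem_lieAlgebraOf {H : Subgroup G} (hH : IsClosed (H : Set G))
    {X : E} (hX : X ∈ velocitySubmodule E H) :
    ∃ γ : ℝ → G, IsOneParameterSubgroup γ X ∧ ∀ t, γ t ∈ H := by
  refine Submodule.span_induction (p := fun (X : E) _ => ∃ γ : ℝ → G,
    IsOneParameterSubgroup γ X ∧ ∀ t, γ t ∈ H) ?_ ?_ ?_ ?_ hX
  · rintro X ⟨γ, h1, h2, h3, h4⟩
    have := IsOneParameterSubgroup.of_contMDiff (E := E) h1 h2
    refine ⟨γ, ?_, h3⟩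
    have e : (velocity γ : E) = X := h4
    rwa [e] at this
  · refine ⟨fun _ => 1, ⟨by simp, tendsto_const_nhds, ?_⟩, fun _ => H.one_mem⟩
    exact (hasDerivAt_const (0 : ℝ) (toChart (1 : G) : E))
  · rintro X Y _ _ ⟨γ, h, hm⟩ ⟨γ', h', hm'⟩
    exact h.add_of_mem hH hm h' hm'
  · rintro c X _ ⟨γ, h, hm⟩
    exact ⟨_, h.comp_mul c, fun t => hm _⟩

lemma IsOneParameterSubgroup.mem_lieAlgebraOf {H : Subgroup G} {γ : ℝ → G} {v : E}
    (h : IsOneParameterSubgroup γ v) (hm : ∀ t, γ t ∈ H) :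
    v ∈ velocitySubmodule E H := by
  let v' : GroupLieAlgebra 𝓘(ℝ, E) G := v
  have hv' : v' ∈ lieAlgebraOf E H :=
    Submodule.subset_span ⟨γ, h.map_add, h.contMDiff, hm, h.velocity_eq⟩
  exact hv'

lemma adjointOp_mem_lieAlgebraOf {H : Subgroup G} (hH : IsClosed (H : Set G)) {a : G}
    (ha : a ∈ H) {X : E} (hX : X ∈ velocitySubmodule E H) :
    adjointOp a X ∈ velocitySubmodule E H := by
  obtain ⟨γ, h, hm⟩ := exists_of_mem_lieAlgebraOf hH hX
  exact (h.conj a).mem_lieAlgebraOf fun t => H.mul_mem (H.mul_mem ha (hm t)) (H.inv_mem ha)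

/-- Vectors killed by the Lie algebra of a closed subgroup are fixed by the elements of the
subgroup close to `1`. -/
lemma eventually_adjointOp_eq_self {H : Subgroup G} (hH : IsClosed (H : Set G)) {Z : E}
    (hZ : ∀ Y : E, Y ∈ velocitySubmodule E H → groupBracket G Y Z = 0) :
    ∀ᶠ a in 𝓝 (1 : G), a ∈ H → adjointOp a Z = Z := by
  have : CompleteSpace E := FiniteDimensional.complete ℝ E
  have : IsTopologicalGroup G := topologicalGroup_of_lieGroup 𝓘(ℝ, E) ∞
  by_contra hcon
  rw [Filter.not_eventually] at hcon
  -- Otherwise elements a of H outside the stabilizer N accumulate at 1. Take the representative z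
  -- of a N shortest in the chart. A limit direction v of such z generates a one-parameter subgroup
  -- of H, which lies in N because 𝔥 kills Z. Multiplying z by its element at time -‖z‖ stays in the
  -- coset and shortens z.
  let N : Set G := {a | a ∈ H ∧ adjointOp a Z = Z}
  have hN : IsClosed N := hH.inter (isClosed_eq (continuous_adjointOp_apply Z) continuous_const)
  obtain ⟨r, hr, Hr⟩ := exists_mulChart_near G (E := E) (ε := 1) one_pos
  obtain ⟨r', hr', Hr'⟩ := Metric.eventually_nhds_iff.1
    (eventually_continuousAt_ofChart (E := E) (G := G))
  -- a point of minimal norm in a coset of the stabilizer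
  have hmin : ∀ ρ, 0 < ρ → ∃ z : E, ‖z‖ < ρ ∧ z ≠ 0 ∧ (ofChart z : G) ∈ H ∧
      ∀ (b : G) (w : E), b ∈ N → ofChart w = ofChart z * b → ‖w‖ < ρ → ‖z‖ ≤ ‖w‖ := by
    intro ρ hρ
    set ρ' := min ρ r' / 2 with hρ'
    have hm0 : 0 < min ρ r' := lt_min hρ hr'
    have hρ'0 : 0 < ρ' := by positivity
    have hρ'l : ρ' < min ρ r' := by rw [hρ']; linarith
    have hnear : ∀ᶠ a in 𝓝 (1 : G), ofChart (toChart a : E) = a ∧ ‖(toChart a : E)‖ < ρ' := by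
      have h1 : Filter.Tendsto (toChart : G → E) (𝓝 1) (𝓝 0) := by
        simpa using (contMDiffAt_toChart (E := E) (G := G)).continuousAt.tendsto
      filter_upwards [eventually_ofChart_toChart (E := E) (G := G),
        h1 (Metric.ball_mem_nhds 0 hρ'0)] with a h2 h3
      exact ⟨h2, by simpa using h3⟩
    obtain ⟨a, ha, ha1, ha2⟩ := (hcon.and_eventually hnear).exists
    rw [Classical.not_imp] at ha
    have hclosed : IsClosed {x : E | x ∈ Metric.closedBall (0 : E) ρ' ∧ a⁻¹ * ofChart x ∈ N} := by
      have hcont : ContinuousOn (fun x : E => a⁻¹ * (ofChart x : G))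
          (Metric.closedBall (0 : E) ρ') := by
        intro x hx
        rw [mem_closedBall_zero_iff] at hx
        have : ContinuousAt (ofChart : E → G) x := Hr' (by
          rw [dist_zero_right]
          exact hx.trans_lt (hρ'l.trans_le (min_le_right _ _)))
        exact (continuousAt_const.mul this).continuousWithinAt
      exact hcont.preimage_isClosed_of_isClosed Metric.isClosed_closedBall hN
    have hcomp : IsCompact {x : E | x ∈ Metric.closedBall (0 : E) ρ' ∧ a⁻¹ * ofChart x ∈ N} :=
      (isCompact_closedBall (0 : E) ρ').of_isClosed_subset hclosed fun x hx => hx.1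
    obtain ⟨z, ⟨hz1, hz2⟩, hz3⟩ := hcomp.exists_isMinOn ⟨toChart a, by
        rw [mem_closedBall_zero_iff]; exact ha2.le, by
        rw [ha1, inv_mul_cancel]
        exact ⟨H.one_mem, by rw [adjointOp_one]; rfl⟩⟩ continuous_norm.continuousOn
    rw [mem_closedBall_zero_iff] at hz1
    have hzH : (ofChart z : G) ∈ H := by
      have := H.mul_mem ha.1 hz2.1
      rwa [mul_inv_cancel_left] at this
    refine ⟨z, hz1.trans_lt (hρ'l.trans_le (min_le_left _ _)), ?_, hzH, ?_⟩
    · rintro rfl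
      rw [ofChart_zero, mul_one] at hz2
      apply ha.2
      conv_lhs => rw [← hz2.2]
      exact adjointOp_apply_inv a Z
    · intro b w hb hw hwn
      by_cases hwρ : ‖w‖ ≤ ρ'
      · refine hz3 (a := w) ⟨by rwa [mem_closedBall_zero_iff], ?_⟩
        rw [hw, ← mul_assoc]
        refine ⟨H.mul_mem hz2.1 hb.1, ?_⟩
        rw [adjointOp_mul_apply, hb.2, hz2.2]
      · linarith
  choose! z hz1 hz2 hz3 hz4 using hmin
  have hzl : Filter.Tendsto z (𝓝[>] 0) (𝓝 0) := by
    rw [tendsto_zero_iff_norm_tendsto_zero]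
    refine tendsto_of_tendsto_of_tendsto_of_le_of_le' tendsto_const_nhds
      (tendsto_nhdsWithin_of_tendsto_nhds Filter.tendsto_id)
      (Filter.Eventually.of_forall fun _ => norm_nonneg _) ?_
    filter_upwards [self_mem_nhdsWithin] with ρ hρ using (hz1 ρ hρ).le
  set U : Ultrafilter ℝ := Ultrafilter.of (𝓝[>] (0 : ℝ)) with hUdef
  have hU : (U : Filter ℝ) ≤ 𝓝[>] 0 := Ultrafilter.of_le _
  have hUpos : ∀ᶠ ρ in (U : Filter ℝ), 0 < ρ := hU self_mem_nhdsWithin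
  replace hzl := hzl.mono_left hU
  obtain ⟨v, hv1, hv2⟩ := (isCompact_sphere (0 : E) 1).ultrafilter_le_nhds
    (U.map fun ρ => ‖z ρ‖⁻¹ • z ρ) (by
      rw [Filter.le_principal_iff]
      refine hUpos.mono fun ρ hρ => ?_
      have := norm_pos_iff.2 (hz2 ρ hρ)
      rw [mem_sphere_zero_iff_norm, norm_smul, norm_inv, norm_norm, inv_mul_cancel₀ this.ne'])
  have hvt : Filter.Tendsto (fun ρ => ‖z ρ‖⁻¹ • z ρ) U (𝓝 v) := hv2
  have hδ : Filter.Tendsto (fun ρ => ‖z ρ‖) U (𝓝[>] 0) := by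
    refine tendsto_nhdsWithin_iff.2 ⟨by simpa using hzl.norm, ?_⟩
    filter_upwards [hUpos] with ρ hρ using norm_pos_iff.2 (hz2 ρ hρ)
  have hof : Filter.Tendsto (ofChart : E → G) (𝓝 0) (𝓝 1) := by
    simpa using (contMDiffAt_ofChart (E := E) (G := G)).continuousAt.tendsto
  obtain ⟨γ, hγ, hγH⟩ := exists_oneParameterSubgroup_of_tendsto hH (v := v) hδ (hof.comp hzl)
    (by
      refine hvt.congr' ?_
      filter_upwards [hzl.eventually (eventually_toChart_ofChart (E := E) (G := G))] with ρ hρ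
      simp [hρ]) (by filter_upwards [hUpos] with ρ hρ using hz3 ρ hρ)
  have hγN : ∀ t, γ t ∈ N := fun t =>
    ⟨hγH t, hγ.adjointOp_eq_self (hZ v (hγ.mem_lieAlgebraOf hγH)) t⟩
  -- moving back along `γ` decreases the norm
  obtain ⟨r₁, hr₁, Hr₁⟩ := exists_mulChart_near G (E := E) (ε := 1 / 8) (by norm_num)
  set c : E → ℝ → E := fun x t => toChart (γ t)
  have hcd := hγ.hasDerivAt
  have hnegδ : Filter.Tendsto (fun ρ => -‖z ρ‖) U (𝓝 0) := by
    have := hzl.norm.neg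
    simpa using this
  have hc0 : Filter.Tendsto (fun ρ => (toChart (γ (-‖z ρ‖)) : E)) U (𝓝 0) := by
    have h1 : Filter.Tendsto (fun t => (toChart (γ t) : E)) (𝓝 0) (𝓝 0) := by
      simpa [hγ.map_zero] using hcd.continuousAt.tendsto
    exact h1.comp hnegδ
  have hlit := (hasDerivAt_iff_isLittleO.1 hcd)
  have hlit2 := hnegδ.eventually (hlit.def (c := 1 / 8) (by norm_num))
  have hclose : ∀ᶠ ρ in (U : Filter ℝ), ‖‖z ρ‖⁻¹ • z ρ - v‖ < 1 / 8 := by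
    have h1 : Filter.Tendsto (fun ρ => ‖‖z ρ‖⁻¹ • z ρ - v‖) U (𝓝 0) := by
      simpa using (hvt.sub_const v).norm
    exact h1.eventually (gt_mem_nhds (by norm_num))
  obtain ⟨ρ, hρ, h1, h2, h3, h4, h5⟩ := (hUpos.and (hlit2.and (hclose.and
    ((hzl.eventually (Metric.ball_mem_nhds 0 hr₁)).and
      ((hc0.eventually (Metric.ball_mem_nhds 0 hr₁)).and
        ((hγ.tendsto.comp hnegδ).eventually
          (eventually_ofChart_toChart (E := E) (G := G)))))))).exists
  rw [dist_zero_right] at h3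
  obtain ⟨h4, h5⟩ : dist (toChart (γ (-‖z ρ‖)) : E) 0 < r₁ ∧
    ofChart (toChart (γ (-‖z ρ‖)) : E) = γ (-‖z ρ‖) := ⟨h4, h5⟩
  rw [dist_zero_right] at h4
  have hzp : 0 < ‖z ρ‖ := norm_pos_iff.2 (hz2 ρ hρ)
  have hvn : ‖v‖ = 1 := by simpa using hv1
  set y : E := toChart (γ (-‖z ρ‖)) with hy
  obtain ⟨e1, -, e2⟩ := Hr₁ (z ρ) y h3 h4
  have hyv : ‖y + ‖z ρ‖ • v‖ ≤ 1 / 8 * ‖z ρ‖ := by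
    have := h1
    simp only [hγ.map_zero, toChart_one, sub_zero, neg_smul, sub_neg_eq_add, norm_neg,
      norm_norm] at this
    exact this
  have hzv : ‖z ρ - ‖z ρ‖ • v‖ ≤ 1 / 8 * ‖z ρ‖ := by
    have e : z ρ - ‖z ρ‖ • v = ‖z ρ‖ • (‖z ρ‖⁻¹ • z ρ - v) := by
      rw [smul_sub, smul_smul, mul_inv_cancel₀ hzp.ne', one_smul]
    rw [e, norm_smul, norm_norm]
    nlinarith
  have hyn : ‖y‖ ≤ 9 / 8 * ‖z ρ‖ := by
    have e : y = (y + ‖z ρ‖ • v) - ‖z ρ‖ • v := by abel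
    have h6 : ‖y‖ ≤ ‖y + ‖z ρ‖ • v‖ + ‖‖z ρ‖ • v‖ := by
      conv_lhs => rw [e]
      exact norm_sub_le _ _
    rw [norm_smul, norm_norm, hvn] at h6
    linarith
  -- The three errors add up to at most (9/64 + 1/8 + 1/8)‖z ρ‖.
  have hw : ‖mulChart (G := G) (z ρ, y)‖ < ‖z ρ‖ := by
    have e : mulChart (G := G) (z ρ, y) = (mulChart (G := G) (z ρ, y) - z ρ - y) +
        ((z ρ - ‖z ρ‖ • v) + (y + ‖z ρ‖ • v)) := by abel
    have h6 : ‖mulChart (G := G) (z ρ, y)‖ ≤ ‖mulChart (G := G) (z ρ, y) - z ρ - y‖ +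
        (‖z ρ - ‖z ρ‖ • v‖ + ‖y + ‖z ρ‖ • v‖) := by
      conv_lhs => rw [e]
      exact (norm_add_le _ _).trans (add_le_add_right (norm_add_le _ _) _)
    linarith
  have h7 := hz4 ρ hρ (γ (-‖z ρ‖)) (mulChart (G := G) (z ρ, y)) (hγN _) (by
    rw [← e1, h5]) (hw.trans (hz1 ρ hρ))
  linarith

/-- Vectors killed by the Lie algebra of a closed subgroup are fixed by its identity
component. -/
lemma adjointOp_eq_self_of_mem_connectedComponent {H : Subgroup G} (hH : IsClosed (H : Set G))
    {Z : E}
    (hZ : ∀ Y : E, Y ∈ velocitySubmodule E H → groupBracket G Y Z = 0)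
    {a : G} (ha : a ∈ Subtype.val '' connectedComponent (1 : H)) : adjointOp a Z = Z := by
  have : CompleteSpace E := FiniteDimensional.complete ℝ E
  have : IsTopologicalGroup G := topologicalGroup_of_lieGroup 𝓘(ℝ, E) ∞
  let N : Subgroup H :=
    { carrier := {a | adjointOp (a : G) Z = Z}
      mul_mem' := fun {a b} ha hb => by
        simp only [Set.mem_ofPred_eq, Subgroup.coe_mul] at *
        rw [adjointOp_mul_apply, hb, ha]
      one_mem' := by
        simp only [Set.mem_ofPred_eq, Subgroup.coe_one]
        rw [adjointOp_one]; rfl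
      inv_mem' := fun {a} ha => by
        simp only [Set.mem_ofPred_eq, Subgroup.coe_inv] at *
        conv_lhs => rw [← ha]
        exact adjointOp_inv_apply _ _ }
  have hopen : IsOpen (N : Set H) := by
    refine Subgroup.isOpen_of_mem_nhds N (g := 1) ?_
    have h1 := eventually_adjointOp_eq_self hH hZ
    have h2 : Filter.Tendsto (Subtype.val : H → G) (𝓝 1) (𝓝 1) :=
      continuous_subtype_val.tendsto' _ _ rfl
    exact (h2.eventually h1).mono fun a ha => ha a.2
  have hclopen : IsClopen (N : Set H) := ⟨N.isClosed_of_isOpen hopen, hopen⟩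
  obtain ⟨b, hb, rfl⟩ := ha
  exact hclopen.connectedComponent_subset N.one_mem hb

/-- One-parameter subgroups whose velocity is killed by `𝔥` centralize `H⁰`. -/
lemma IsOneParameterSubgroup.mem_centralizer {H : Subgroup G} (hH : IsClosed (H : Set G))
    {Z : E}
    (hZ : ∀ Y : E, Y ∈ velocitySubmodule E H → groupBracket G Y Z = 0)
    {γ : ℝ → G} (hγ : IsOneParameterSubgroup γ Z) (t : ℝ) :
    γ t ∈ Subgroup.centralizer (Subtype.val '' connectedComponent (1 : H) : Set G) := by
  rw [Subgroup.mem_centralizer_iff]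
  intro a ha
  -- The conjugate subgroup has velocity Ad(a)Z = Z, so it is γ itself.
  have h1 := hγ.conj a
  rw [adjointOp_eq_self_of_mem_connectedComponent hH hZ ha] at h1
  have h2 := congrFun (h1.unique hγ) t
  change a * γ t * a⁻¹ = γ t at h2
  exact mul_inv_eq_iff_eq_mul.1 h2

/-- The one-parameter subgroup of Y acts trivially on 𝔤/𝔥, so it takes values in a finite set. By
continuity it is constant near 0, and its velocity vanishes. -/
lemma eq_zero_of_finite_isotropyKernel {H : Subgroup G} (hH : IsClosed (H : Set G))
    (hker : HasFiniteIsotropyKernel E H) {Y : E}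
    (hY : Y ∈ velocitySubmodule E H)
    (hm : ∀ X : E, ∃ X' : E, X' ∈ velocitySubmodule E H ∧
      groupBracket G Y (X - X') = 0) : Y = 0 := by
  have : CompleteSpace E := FiniteDimensional.complete ℝ E
  obtain ⟨γ, hγ, hγH⟩ := exists_of_mem_lieAlgebraOf hH hY
  set K : Set G := {a : G | a ∈ H ∧ ∀ X, Ad E a X - X ∈ lieAlgebraOf E H} with hK
  have hKf : K.Finite := hker
  have hγK : ∀ t, γ t ∈ K := by
    intro t
    refine ⟨hγH t, fun X => ?_⟩
    suffices h : ∀ X : E, adjointOp (γ t) X - X ∈ velocitySubmodule E H from h X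
    intro X
    obtain ⟨X', hX', hX''⟩ := hm X
    have h1 := hγ.adjointOp_eq_self hX'' t
    have h2 := adjointOp_mem_lieAlgebraOf hH (hγH t) hX'
    rw [map_sub] at h1
    have h3 : adjointOp (γ t) X - X = adjointOp (γ t) X' - X' := by
      rw [sub_eq_sub_iff_add_eq_add] at h1 ⊢
      rw [h1, add_comm]
    rw [h3]
    exact Submodule.sub_mem _ h2 hX'
  have hfin : (K \ {1}).Finite := hKf.sdiff
  have hev : ∀ᶠ t in 𝓝 (0 : ℝ), γ t = 1 := by
    have h1 := hγ.tendsto.eventually (hfin.isClosed.isOpen_compl.mem_nhds (x := (1 : G)) (by simp))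
    filter_upwards [h1] with t ht
    by_contra hne
    exact ht ⟨hγK t, hne⟩
  have hd : HasDerivAt (fun _ : ℝ => (0 : E)) Y 0 :=
    hγ.hasDerivAt.congr_of_eventuallyEq (hev.mono fun t ht => by simp [ht])
  exact hd.unique (hasDerivAt_const _ _)

end ClosedSubgroup

/-! ### An Ad(G)-invariant scalar product by averaging. -/

section InvariantForm

open MeasureTheory

variable {E : Type*} [NormedAddCommGroup E] [NormedSpace ℝ E] [FiniteDimensional ℝ E]

variable (G : Type*) [TopologicalSpace G] [ChartedSpace E G] [Group G]
  [LieGroup 𝓘(ℝ, E) ∞ G] [CompactSpace G] [T2Space G]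

/-- The Lie algebra of a compact Lie group carries a scalar product for which the operators `ad X`
are skew-symmetric. -/
theorem exists_adInvariant_form :
    ∃ Q : LinearMap.BilinForm ℝ E, (∀ X Y, Q X Y = Q Y X) ∧ (∀ X, X ≠ 0 → 0 < Q X X) ∧
      ∀ X Y Z, Q (groupBracket G X Y) Z = -Q Y (groupBracket G X Z) := by
  have : CompleteSpace E := FiniteDimensional.complete ℝ E
  have : IsTopologicalGroup G := topologicalGroup_of_lieGroup 𝓘(ℝ, E) ∞
  let _ : MeasurableSpace G := borel G
  have : BorelSpace G := ⟨rfl⟩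
  let μ : Measure G := Measure.haar
  let e := Module.finBasis ℝ E
  let P : E → E → ℝ := fun X Y => ∑ i, e.repr X i * e.repr Y i
  have hcoord : ∀ X i, Continuous fun a : G => e.repr (adjointOp a⁻¹ X) i := fun X i => by
    have h1 : Continuous fun Y : E => e.repr Y i :=
      (e.coord i).continuous_of_finiteDimensional
    exact h1.comp ((continuous_adjointOp_apply X).comp continuous_inv)
  have hcont : ∀ X Y, Continuous fun a : G => P (adjointOp a⁻¹ X) (adjointOp a⁻¹ Y) :=
    fun X Y => continuous_finsetSum _ fun i _ => (hcoord X i).mul (hcoord Y i)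
  have hint : ∀ X Y, Integrable (fun a : G => P (adjointOp a⁻¹ X) (adjointOp a⁻¹ Y)) μ :=
    fun X Y => (hcont X Y).integrable_of_hasCompactSupport
      (HasCompactSupport.of_compactSpace _)
  let Q : LinearMap.BilinForm ℝ E := LinearMap.mk₂ ℝ
    (fun X Y => ∫ a, P (adjointOp a⁻¹ X) (adjointOp a⁻¹ Y) ∂μ)
    (fun X X' Y => by
      rw [← integral_add (hint _ _) (hint _ _)]
      congr 1; ext a
      simp only [P, map_add, Finsupp.add_apply, add_mul, Finset.sum_add_distrib])
    (fun c X Y => by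
      rw [smul_eq_mul, ← integral_const_mul]
      congr 1; ext a
      simp only [P, map_smul, Finsupp.smul_apply, smul_eq_mul, Finset.mul_sum, mul_assoc])
    (fun X Y Y' => by
      rw [← integral_add (hint _ _) (hint _ _)]
      congr 1; ext a
      simp only [P, map_add, Finsupp.add_apply, mul_add, Finset.sum_add_distrib])
    (fun c X Y => by
      rw [smul_eq_mul, ← integral_const_mul]
      congr 1; ext a
      simp only [P, map_smul, Finsupp.smul_apply, smul_eq_mul, Finset.mul_sum]
      exact Finset.sum_congr rfl fun i _ => by ring)
  have hQ : ∀ X Y, Q X Y = ∫ a, P (adjointOp a⁻¹ X) (adjointOp a⁻¹ Y) ∂μ := fun X Y => rfl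
  -- The average is over Ad(a⁻¹), so the substitution a ↦ c a for the left Haar measure absorbs
  -- Ad(c).
  have hinv : ∀ (c : G) (X Y : E), Q (adjointOp c X) (adjointOp c Y) = Q X Y := by
    intro c X Y
    rw [hQ, hQ, ← integral_mul_left_eq_self
      (fun a => P (adjointOp a⁻¹ (adjointOp c X)) (adjointOp a⁻¹ (adjointOp c Y))) c]
    congr 1; ext a
    simp [← adjointOp_mul_apply]
  refine ⟨Q, fun X Y => ?_, fun X hX => ?_, fun X Y Z => ?_⟩
  · rw [hQ, hQ]
    congr 1; ext a
    exact Finset.sum_congr rfl fun i _ => mul_comm _ _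
  · rw [hQ]
    have hnn : ∀ Y, 0 ≤ P Y Y := fun Y => Finset.sum_nonneg fun i _ => mul_self_nonneg _
    refine (hcont X X).integral_pos_of_hasCompactSupport_nonneg_nonzero
      (HasCompactSupport.of_compactSpace _) (fun a => hnn _) (x := 1) ?_
    rw [inv_one, adjointOp_one]
    intro h0
    have h1 := (Finset.sum_eq_zero_iff_of_nonneg fun i _ => mul_self_nonneg _).1 h0
    apply hX
    apply e.repr.injective
    ext i
    simpa using h1 i (Finset.mem_univ i)
  · obtain ⟨γ, hγ⟩ := exists_oneParameterSubgroup G X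
    exact hγ.skew_of_invariant Q (fun t => hinv (γ t)) Y Z

end InvariantForm

/-! ### Projections, metrics and adapted frames. -/

namespace Splitting

section Basic

variable {V : Type*} [AddCommGroup V] [Module ℝ V] {𝔥 : Submodule ℝ V} {d : ℕ}
  (S : Splitting 𝔥 d)

lemma comp_le_𝔪 (i : Fin d) : S.comp i ≤ S.𝔪 := le_iSup S.comp i

lemma proj_mem (i : Fin d) (X : V) : S.proj i X ∈ S.comp i := by
  rw [proj]; exact Submodule.projection_apply_mem _ X

lemma proj_of_mem {i : Fin d} {X : V} (hX : X ∈ S.comp i) : S.proj i X = X := by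
  rw [proj]; exact (Submodule.projection_eq_self_iff _ X).2 hX

lemma proj_of_mem_ne {i j : Fin d} (hij : j ≠ i) {X : V} (hX : X ∈ S.comp j) :
    S.proj i X = 0 := by
  rw [proj, Submodule.projection_apply_eq_zero_iff]
  exact (le_sup_of_le_right (le_iSup₂_of_le j hij le_rfl) :
    S.comp j ≤ 𝔥 ⊔ ⨆ (j : Fin d) (_ : j ≠ i), S.comp j) hX

lemma proj_of_mem_𝔥 (i : Fin d) {X : V} (hX : X ∈ 𝔥) : S.proj i X = 0 := by
  rw [proj, Submodule.projection_apply_eq_zero_iff]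
  exact (le_sup_left : 𝔥 ≤ 𝔥 ⊔ ⨆ (j : Fin d) (_ : j ≠ i), S.comp j) hX

lemma projH_mem (X : V) : S.projH X ∈ 𝔥 := by
  rw [projH]; exact Submodule.projection_apply_mem _ X

lemma projH_of_mem {X : V} (hX : X ∈ 𝔥) : S.projH X = X := by
  rw [projH]; exact (Submodule.projection_eq_self_iff _ X).2 hX

lemma projH_of_mem_𝔪 {X : V} (hX : X ∈ S.𝔪) : S.projH X = 0 := by
  exact (Submodule.projection_apply_eq_zero_iff (q := S.𝔪) S.isCompl).2 hX

lemma projH_of_mem_comp {i : Fin d} {X : V} (hX : X ∈ S.comp i) : S.projH X = 0 :=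
  S.projH_of_mem_𝔪 (S.comp_le_𝔪 i hX)

/-- Induction over the summands of a splitting. -/
lemma induction {p : V → Prop} (h𝔥 : ∀ X ∈ 𝔥, p X) (hcomp : ∀ i, ∀ X ∈ S.comp i, p X)
    (hadd : ∀ X Y, p X → p Y → p (X + Y)) (X : V) : p X := by
  have hX : X ∈ 𝔥 ⊔ S.𝔪 := by rw [𝔪, S.isCompl.sup_eq_top]; trivial
  obtain ⟨Y, hY, Z, hZ, rfl⟩ := Submodule.mem_sup.1 hX
  refine hadd _ _ (h𝔥 Y hY) ?_
  exact Submodule.iSup_induction S.comp (motive := p) hZ hcomp (h𝔥 0 (zero_mem _)) hadd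

/-- Induction over the summands of `𝔪`. -/
lemma induction_𝔪 {p : V → Prop} (h0 : p 0) (hcomp : ∀ i, ∀ X ∈ S.comp i, p X)
    (hadd : ∀ X Y, p X → p Y → p (X + Y)) {X : V} (hX : X ∈ S.𝔪) : p X :=
  Submodule.iSup_induction S.comp (motive := p) hX hcomp h0 hadd

lemma sum_proj_of_mem_comp {i : Fin d} {X : V} (hX : X ∈ S.comp i) : ∑ j, S.proj j X = X := by
  rw [Finset.sum_eq_single i, S.proj_of_mem hX]
  · intro j _ hj; exact S.proj_of_mem_ne hj.symm hX
  · simp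

lemma projH_add_sum_proj (X : V) : S.projH X + ∑ i, S.proj i X = X := by
  induction X using S.induction with
  | h𝔥 X hX => rw [S.projH_of_mem hX, Finset.sum_eq_zero fun i _ => S.proj_of_mem_𝔥 i hX, add_zero]
  | hcomp i X hX => rw [S.projH_of_mem_comp hX, S.sum_proj_of_mem_comp hX, zero_add]
  | hadd X Y hX hY =>
    simp only [map_add, Finset.sum_add_distrib]
    conv_rhs => rw [← hX, ← hY]
    abel

lemma sum_proj_of_mem {X : V} (hX : X ∈ S.𝔪) : ∑ j, S.proj j X = X := by
  have := S.projH_add_sum_proj X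
  rwa [S.projH_of_mem_𝔪 hX, zero_add] at this

lemma projH_add_projM (X : V) : S.projH X + S.projM X = X :=
  Submodule.projection_add_projection_eq_self S.isCompl X

lemma coe_projM (X : V) : (S.projM X : V) = ∑ i, S.proj i X := by
  have h1 := S.projH_add_projM X
  have h2 := S.projH_add_sum_proj X
  exact add_left_cancel (h1.trans h2.symm)

lemma projM_of_mem {X : V} (hX : X ∈ S.𝔪) : S.projM X = ⟨X, hX⟩ := by
  ext; rw [coe_projM, S.sum_proj_of_mem hX]

@[simp] lemma projM_coe (X : S.𝔪) : S.projM X = X := S.projM_of_mem X.2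

lemma projM_of_mem_𝔥 {X : V} (hX : X ∈ 𝔥) : S.projM X = 0 := by
  ext
  rw [coe_projM, Finset.sum_eq_zero fun i _ => S.proj_of_mem_𝔥 i hX, ZeroMemClass.coe_zero]

lemma mem_𝔥_of_proj_eq_zero {X : V} (hX : ∀ i, S.proj i X = 0) : X ∈ 𝔥 := by
  have := S.projH_add_sum_proj X
  rw [Finset.sum_eq_zero fun i _ => hX i, add_zero] at this
  rw [← this]; exact S.projH_mem X

lemma T_apply (a : Fin d → ℝ) (X : V) : S.T a X = S.projH X + ∑ i, a i • S.proj i X := by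
  simp [T, LinearMap.sum_apply]

lemma T_of_mem_𝔥 (a : Fin d → ℝ) {X : V} (hX : X ∈ 𝔥) : S.T a X = X := by
  rw [T_apply, S.projH_of_mem hX, Finset.sum_eq_zero, add_zero]
  intro i _; rw [S.proj_of_mem_𝔥 i hX, smul_zero]

lemma T_of_mem_comp (a : Fin d → ℝ) {i : Fin d} {X : V} (hX : X ∈ S.comp i) :
    S.T a X = a i • X := by
  rw [T_apply, S.projH_of_mem_comp hX, zero_add, Finset.sum_eq_single i, S.proj_of_mem hX]
  · intro j _ hj; rw [S.proj_of_mem_ne hj.symm hX, smul_zero]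
  · simp

lemma T_T_inv {a : Fin d → ℝ} (ha : ∀ i, a i ≠ 0) (X : V) : S.T a (S.T a⁻¹ X) = X := by
  induction X using S.induction with
  | h𝔥 X hX => rw [S.T_of_mem_𝔥 _ hX, S.T_of_mem_𝔥 _ hX]
  | hcomp i X hX =>
    rw [S.T_of_mem_comp _ hX, map_smul, S.T_of_mem_comp _ hX, smul_smul, Pi.inv_apply,
      inv_mul_cancel₀ (ha i), one_smul]
  | hadd X Y hX hY => simp only [map_add, hX, hY]

lemma T_inv_T {a : Fin d → ℝ} (ha : ∀ i, a i ≠ 0) (X : V) : S.T a⁻¹ (S.T a X) = X := by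
  have := S.T_T_inv (a := a⁻¹) (fun i => inv_ne_zero (ha i)) X
  rwa [inv_inv] at this

end Basic

/-- A symmetric bilinear form with kernel `𝔥`, positive on `𝔪`. -/
structure IsMetric {V : Type*} [AddCommGroup V] [Module ℝ V] {𝔥 : Submodule ℝ V} {d : ℕ}
    (S : Splitting 𝔥 d) (q : LinearMap.BilinForm ℝ V) : Prop where
  symm : ∀ X Y, q X Y = q Y X
  kernel : ∀ X ∈ 𝔥, ∀ Y, q X Y = 0
  pos : ∀ X ∈ S.𝔪, X ≠ 0 → 0 < q X X

/-- An orthonormal basis of `𝔪` for the metric `q`, adapted to the decomposition of `𝔪`. -/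
structure Frame {V : Type*} [AddCommGroup V] [Module ℝ V] {𝔥 : Submodule ℝ V} {d : ℕ}
    (S : Splitting 𝔥 d) (q : LinearMap.BilinForm ℝ V) (ι : Type*) [Fintype ι] where
  vec : ι → V
  idx : ι → Fin d
  mem : ∀ α, vec α ∈ S.comp (idx α)
  norm : ∀ α, q (vec α) (vec α) = 1
  orth : ∀ α β, α ≠ β → q (vec α) (vec β) = 0
  expand : ∀ i, ∀ X ∈ S.comp i, X = ∑ α, q (vec α) X • vec α

section Metric

variable {V : Type*} [AddCommGroup V] [Module ℝ V] {𝔥 : Submodule ℝ V} {d : ℕ}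
  {S : Splitting 𝔥 d} {q : LinearMap.BilinForm ℝ V}

namespace IsMetric

lemma kernel_right (hq : S.IsMetric q) (X : V) {Y : V} (hY : Y ∈ 𝔥) : q X Y = 0 := by
  rw [hq.symm, hq.kernel Y hY]

lemma projM_left (hq : S.IsMetric q) (X Y : V) : q (S.projM X) Y = q X Y := by
  conv_rhs => rw [← S.projH_add_projM X, map_add, LinearMap.add_apply, hq.kernel _ (S.projH_mem X),
    zero_add]

lemma projM_right (hq : S.IsMetric q) (X Y : V) : q X (S.projM Y) = q X Y := by
  rw [hq.symm, hq.projM_left, hq.symm]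

lemma eq_of_forall (hq : S.IsMetric q) {X Y : S.𝔪} (h : ∀ Z : S.𝔪, q X Z = q Y Z) : X = Y := by
  by_contra hne
  have h0 : ((X - Y : S.𝔪) : V) ≠ 0 := by simpa [sub_eq_zero] using hne
  have := hq.pos _ (X - Y).2 h0
  have h1 := h (X - Y)
  rw [Submodule.coe_sub, map_sub q, LinearMap.sub_apply, ← Submodule.coe_sub, h1, sub_self] at this
  exact lt_irrefl _ this

lemma nonneg (hq : S.IsMetric q) (X : V) : 0 ≤ q X X := by
  rw [← hq.projM_left, ← hq.projM_right]
  by_cases h : (S.projM X : V) = 0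
  · simp [h]
  · exact (hq.pos _ (S.projM X).2 h).le

lemma eq_zero (hq : S.IsMetric q) {X : V} (hX : X ∈ S.𝔪) (h : q X X = 0) : X = 0 := by
  by_contra hne
  exact (hq.pos X hX hne).ne' h

variable [FiniteDimensional ℝ V]

/-- This selects the nondegenerate branch in the definition of `sharp`, so its default value 0 plays
no role for metrics. -/
lemma nondegenerate (hq : S.IsMetric q) : (q.restrict S.𝔪).Nondegenerate := by
  have hsymm : LinearMap.IsRefl (q.restrict S.𝔪) := fun X Y h => by
    rw [LinearMap.BilinForm.restrict_apply, LinearMap.domRestrict_apply] at h ⊢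
    rw [hq.symm]; exact h
  refine (LinearMap.IsRefl.nondegenerate_iff_separatingLeft hsymm).2 ?_
  intro X hX
  refine hq.eq_of_forall fun Z => ?_
  have := hX Z
  simpa using this

lemma sharp_apply (hq : S.IsMetric q) (φ : Module.Dual ℝ S.𝔪) (Z : S.𝔪) :
    q (S.sharp q φ) Z = φ Z := by
  rw [sharp, dif_pos hq.nondegenerate]
  exact LinearMap.BilinForm.apply_toDual_symm_apply (hB := hq.nondegenerate) φ Z

lemma nomizu_apply (hq : S.IsMetric q) (b : V →ₗ[ℝ] V →ₗ[ℝ] V) (X Y Z : S.𝔪) :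
    q (S.nomizu b q X Y) Z = (1 / 2 : ℝ) * (q (b X Y) Z - q (b Y Z) X + q (b Z X) Y) :=
  hq.sharp_apply _ Z

lemma ricciOp_apply (hq : S.IsMetric q) (b : V →ₗ[ℝ] V →ₗ[ℝ] V) (Y Z : S.𝔪) :
    q (S.ricciOp b q Y) Z = S.ricci b q Y Z :=
  hq.sharp_apply _ Z

end IsMetric

namespace Frame

variable {ι : Type*} [Fintype ι] (F : S.Frame q ι)

lemma mem_𝔪 (α : ι) : F.vec α ∈ S.𝔪 := S.comp_le_𝔪 _ (F.mem α)

/-- The vectors of a frame as elements of `𝔪`. -/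
def vecM (α : ι) : S.𝔪 := ⟨F.vec α, F.mem_𝔪 α⟩

@[simp] lemma coe_vecM (α : ι) : (F.vecM α : V) = F.vec α := rfl

lemma apply_vec [DecidableEq ι] (α β : ι) : q (F.vec α) (F.vec β) = if α = β then 1 else 0 := by
  split_ifs with h
  · rw [h, F.norm]
  · exact F.orth α β h

lemma expand_𝔪 {X : V} (hX : X ∈ S.𝔪) : X = ∑ α, q (F.vec α) X • F.vec α := by
  refine S.induction_𝔪 (p := fun X => X = ∑ α, q (F.vec α) X • F.vec α) (by simp) F.expand
    (fun X Y hX hY => ?_) hX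
  conv_lhs => rw [hX, hY]
  simp only [map_add, add_smul, Finset.sum_add_distrib]

lemma expandM (X : S.𝔪) : X = ∑ α, q (F.vec α) X • F.vecM α := by
  ext
  rw [Submodule.coe_sum]
  exact F.expand_𝔪 X.2

lemma linearIndependent : LinearIndependent ℝ F.vecM := by
  classical
  rw [Fintype.linearIndependent_iff]
  intro g hg α
  have h1 := congrArg (fun X : S.𝔪 => q (F.vec α) X) hg
  simp only [Submodule.coe_sum, Submodule.coe_smul, map_sum, map_smul, coe_vecM, F.apply_vec,
    smul_eq_mul, mul_ite, mul_one, mul_zero, Finset.sum_ite_eq, Finset.mem_univ, if_true,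
    ZeroMemClass.coe_zero, map_zero] at h1
  exact h1

/-- The basis of `𝔪` given by a frame. -/
def basis : Module.Basis ι ℝ S.𝔪 :=
  Module.Basis.mk F.linearIndependent (by
    intro X _
    rw [F.expandM X]
    exact Submodule.sum_mem _ fun α _ => Submodule.smul_mem _ _
      (Submodule.subset_span ⟨α, rfl⟩))

@[simp] lemma basis_apply (α : ι) : F.basis α = F.vecM α := by simp [basis]

lemma basis_repr (X : S.𝔪) (α : ι) : F.basis.repr X α = q (F.vec α) X := by
  classical
  conv_rhs => rw [← F.basis.sum_repr X]
  simp only [Submodule.coe_sum, Submodule.coe_smul, map_sum, map_smul, basis_apply, coe_vecM,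
    F.apply_vec, smul_eq_mul, mul_ite, mul_one, mul_zero, Finset.sum_ite_eq, Finset.mem_univ,
    if_true]

lemma trace_eq (f : Module.End ℝ S.𝔪) :
    LinearMap.trace ℝ S.𝔪 f = ∑ α, q (F.vec α) (f (F.vecM α)) := by
  classical
  rw [LinearMap.trace_eq_matrix_trace ℝ F.basis, Matrix.trace]
  refine Finset.sum_congr rfl fun α _ => ?_
  rw [Matrix.diag_apply, LinearMap.toMatrix_apply, basis_repr, basis_apply]

lemma trace_projM_comp [FiniteDimensional ℝ V] (hq : S.IsMetric q) (f : Module.End ℝ V) :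
    LinearMap.trace ℝ V (S.𝔪.subtype ∘ₗ S.projM ∘ₗ f) = ∑ α, q (F.vec α) (f (F.vec α)) := by
  refine (LinearMap.trace_comp_comm' (S.projM ∘ₗ f) S.𝔪.subtype).trans ?_
  rw [F.trace_eq]
  refine Finset.sum_congr rfl fun α _ => ?_
  simp [hq.projM_right]

end Frame

end Metric

end Splitting

/-! ### Ricci curvature in a frame. -/

namespace Splitting

section Ricci

variable {V : Type*} [AddCommGroup V] [Module ℝ V] [FiniteDimensional ℝ V]
  {𝔥 : Submodule ℝ V} {d : ℕ}
  {S : Splitting 𝔥 d} {q : LinearMap.BilinForm ℝ V} {ι : Type*} [Fintype ι] (F : S.Frame q ι)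
  (b : V →ₗ[ℝ] V →ₗ[ℝ] V)

lemma riemann_apply (X Y Z : S.𝔪) :
    S.riemann b q X Y Z = S.nomizu b q X (S.nomizu b q Y Z) - S.nomizu b q Y (S.nomizu b q X Z)
      - S.nomizu b q (S.projM (b X Y)) Z - S.projM (b (S.projH (b X Y)) Z) := rfl

lemma ricci_apply (Y Z : S.𝔪) :
    S.ricci b q Y Z = LinearMap.trace ℝ S.𝔪 (((S.riemann b q).flip Y).flip Z) := rfl

/-- Write ad Y in blocks for 𝔥 + 𝔪. The block 𝔥 → 𝔥 vanishes because [Y,𝔥] lies in 𝔪, and the two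
mixed products have the same trace by cyclicity, whence the factor 2. -/
lemma trace_comp_ad_self (hb : ∀ X Y, b X Y = -b Y X) (hbm : ∀ Y ∈ 𝔥, ∀ X ∈ S.𝔪, b Y X ∈ S.𝔪)
    (hq : S.IsMetric q) {Y : V} (hY : Y ∈ S.𝔪) :
    LinearMap.trace ℝ V (b Y ∘ₗ b Y) =
      2 * ∑ α, q (b Y (S.projH (b Y (F.vec α)))) (F.vec α) +
        ∑ α, ∑ β, q (b Y (F.vec α)) (F.vec β) * q (b Y (F.vec β)) (F.vec α) := by
  set Pm : Module.End ℝ V := S.𝔪.subtype ∘ₗ S.projM with hPm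
  have hsum : ∀ X : V, X = S.projH X + Pm X := fun X => (S.projH_add_projM X).symm
  have hdec : ∀ f : Module.End ℝ V, f = S.projH ∘ₗ f + Pm ∘ₗ f := fun f => by
    ext X; exact hsum _
  have h0 : ∀ X : V, S.projH (b Y (S.projH X)) = 0 := fun X => by
    refine S.projH_of_mem_𝔪 ?_
    rw [hb]
    exact neg_mem (hbm _ (S.projH_mem X) _ hY)
  have h1 : S.projH ∘ₗ b Y ∘ₗ b Y = (S.projH ∘ₗ b Y) ∘ₗ (Pm ∘ₗ b Y) := by
    ext X
    have := congrArg (fun Z => S.projH (b Y Z)) (hsum (b Y X))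
    simpa only [map_add, h0, zero_add, LinearMap.comp_apply] using this
  have hP : ∀ f : Module.End ℝ V, LinearMap.trace ℝ V (Pm ∘ₗ f) =
      ∑ α, q (F.vec α) (f (F.vec α)) := fun f => F.trace_projM_comp hq f
  have h2 : LinearMap.trace ℝ V (S.projH ∘ₗ b Y ∘ₗ b Y) =
      ∑ α, q (b Y (S.projH (b Y (F.vec α)))) (F.vec α) := by
    rw [h1, LinearMap.trace_comp_comm', LinearMap.comp_assoc, hP]
    exact Finset.sum_congr rfl fun α _ => hq.symm _ _
  have h3 : ∀ α, q (F.vec α) (b Y (b Y (F.vec α))) =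
      q (b Y (S.projH (b Y (F.vec α)))) (F.vec α) +
        ∑ β, q (b Y (F.vec α)) (F.vec β) * q (b Y (F.vec β)) (F.vec α) := fun α => by
    have h4 : (Pm (b Y (F.vec α))) = ∑ β, q (F.vec β) (b Y (F.vec α)) • F.vec β := by
      have := F.expand_𝔪 (S.projM (b Y (F.vec α))).2
      simp only [hq.projM_right] at this
      exact this
    conv_lhs => rw [hsum (b Y (F.vec α)), map_add, map_add, hq.symm, h4]
    congr 1
    rw [map_sum, map_sum]
    refine Finset.sum_congr rfl fun β _ => ?_
    rw [map_smul, map_smul, smul_eq_mul, hq.symm, hq.symm (F.vec α)]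
  conv_lhs => rw [hdec (b Y ∘ₗ b Y), map_add, h2, hP]
  simp only [LinearMap.comp_apply, h3, Finset.sum_add_distrib]
  ring

/-- The formula for the Ricci curvature of a unimodular homogeneous geometry. -/
lemma ricci_self (hb : ∀ X Y, b X Y = -b Y X) (hbm : ∀ Y ∈ 𝔥, ∀ X ∈ S.𝔪, b Y X ∈ S.𝔪)
    (htr : ∀ W ∈ S.𝔪, ∑ α, q (b W (F.vec α)) (F.vec α) = 0)
    (hq : S.IsMetric q) (Y : S.𝔪) :
    S.ricci b q Y Y = -(1 / 2) * LinearMap.trace ℝ V (b Y ∘ₗ b Y)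
      - (1 / 2) * ∑ α, ∑ β, q (b Y (F.vec α)) (F.vec β) ^ 2
      + (1 / 4) * ∑ α, ∑ β, q (b (F.vec α) (F.vec β)) Y ^ 2 := by
  set A : ι → ι → ℝ := fun α β => q (b Y (F.vec α)) (F.vec β) with hA
  set K : ι → ι → ℝ := fun α β => q (b (F.vec α) (F.vec β)) Y with hK
  set D : ℝ := ∑ α, q (b Y (S.projH (b Y (F.vec α)))) (F.vec α) with hD
  have hK' : ∀ α β, K β α = -K α β := fun α β => by
    simp only [hK]; rw [hb, map_neg, LinearMap.neg_apply]
  have hN : ∀ α β, q (S.nomizu b q Y (F.vecM α)) (F.vecM β) = 1 / 2 * (A α β - K α β - A β α) :=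
    fun α β => by
      rw [hq.nomizu_apply]
      simp only [Frame.coe_vecM, hA, hK]
      rw [hb (F.vec β) Y, map_neg, LinearMap.neg_apply]; ring
  have hC : ∀ α β, q (S.nomizu b q (F.vecM α) Y) (F.vecM β) = -(1 / 2) * (A α β + A β α + K α β) :=
    fun α β => by
      rw [hq.nomizu_apply]
      simp only [Frame.coe_vecM, hA, hK]
      rw [hb (F.vec α) Y, hb (F.vec β) (F.vec α), map_neg, map_neg, LinearMap.neg_apply,
        LinearMap.neg_apply]; ring
  have hexp : ∀ (f : S.𝔪 →ₗ[ℝ] S.𝔪) (X Z : S.𝔪), q (f X) Z =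
      ∑ β, q X (F.vecM β) * q (f (F.vecM β)) Z := fun f X Z => by
    conv_lhs => rw [F.expandM X]
    simp only [map_sum, map_smul, Submodule.coe_sum, Submodule.coe_smul, LinearMap.sum_apply,
      LinearMap.smul_apply, smul_eq_mul]
    exact Finset.sum_congr rfl fun β _ => by rw [hq.symm (F.vec β)]; rfl
  have hterm : ∀ α, q (F.vec α) ((S.riemann b q).flip Y |>.flip Y (F.vecM α)) =
      -q (b (S.nomizu b q Y Y) (F.vec α)) (F.vec α)
      - (∑ β, (-(1 / 2) * (A α β + A β α + K α β)) * (1 / 2 * (A β α - K β α - A α β)))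
      - (∑ β, (-A α β) * (-(1 / 2) * (A β α + A α β + K β α)))
      - q (b Y (S.projH (b Y (F.vec α)))) (F.vec α) := fun α => by
    rw [LinearMap.flip_apply, LinearMap.flip_apply, riemann_apply]
    simp only [Submodule.coe_sub, map_sub]
    have e1 : q (F.vec α) (S.nomizu b q (F.vecM α) (S.nomizu b q Y Y)) =
        -q (b (S.nomizu b q Y Y) (F.vec α)) (F.vec α) := by
      rw [hq.symm]
      refine (hq.nomizu_apply b _ _ (F.vecM α)).trans ?_
      simp only [Frame.coe_vecM]
      have h0 : b (F.vec α) (F.vec α) = 0 := by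
        have := hb (F.vec α) (F.vec α)
        have h2 : (2 : ℝ) • b (F.vec α) (F.vec α) = 0 := by
          rw [two_smul]; nth_rw 1 [this]; exact neg_add_cancel _
        exact (smul_eq_zero.1 h2).resolve_left two_ne_zero
      rw [h0, hb (F.vec α), map_zero, LinearMap.zero_apply, map_neg, LinearMap.neg_apply]
      ring
    have e2 : q (F.vec α) (S.nomizu b q Y (S.nomizu b q (F.vecM α) Y)) =
        ∑ β, (-(1 / 2) * (A α β + A β α + K α β)) * (1 / 2 * (A β α - K β α - A α β)) := by
      rw [hq.symm]
      refine (hexp (S.nomizu b q Y) _ (F.vecM α)).trans ?_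
      exact Finset.sum_congr rfl fun β _ => by rw [hC, hN]
    have e3 : q (F.vec α) (S.nomizu b q (S.projM (b (F.vecM α) Y)) Y) =
        ∑ β, (-A α β) * (-(1 / 2) * (A β α + A α β + K β α)) := by
      rw [hq.symm]
      refine (hexp ((S.nomizu b q).flip Y) _ (F.vecM α)).trans ?_
      refine Finset.sum_congr rfl fun β _ => ?_
      rw [LinearMap.flip_apply, hC, hq.projM_left, Frame.coe_vecM, hb (F.vec α), map_neg,
        LinearMap.neg_apply]
      rfl
    have e4 : q (F.vec α) (S.projM (b (S.projH (b (F.vecM α) Y)) Y)) =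
        q (b Y (S.projH (b Y (F.vec α)))) (F.vec α) := by
      rw [hq.projM_right, hq.symm, hb _ (Y : V), Frame.coe_vecM, hb (F.vec α), map_neg, map_neg,
        map_neg, LinearMap.neg_apply, map_neg, LinearMap.neg_apply, neg_neg]
    rw [e1, e2, e3, e4]
  rw [ricci_apply, F.trace_eq, trace_comp_ad_self F b hb hbm hq Y.2]
  -- Unimodularity removes the trace of ad of Λ(Y)Y.
  simp only [hterm, Finset.sum_sub_distrib, Finset.sum_neg_distrib, htr _ (Subtype.prop _)]
  -- K is antisymmetric, so exchanging α and β cancels the mixed terms A·K.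
  have s1 : ∑ α, ∑ β, (-(1 / 2) * (A α β + A β α + K α β)) * (1 / 2 * (A β α - K β α - A α β)) +
      ∑ α, ∑ β, (-A α β) * (-(1 / 2) * (A β α + A α β + K β α)) =
      1 / 2 * ∑ α, ∑ β, A α β * A β α + 1 / 2 * ∑ α, ∑ β, A α β ^ 2 
        - 1 / 4 * ∑ α, ∑ β, K α β ^ 2 := by
    have t1 : ∑ α, ∑ β, A β α ^ 2 = ∑ α, ∑ β, A α β ^ 2 := Finset.sum_comm
    have t2 : ∑ α, ∑ β, A β α * K α β = -∑ α, ∑ β, A α β * K α β := by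
      rw [Finset.sum_comm, ← Finset.sum_neg_distrib]
      refine Finset.sum_congr rfl fun α _ => ?_
      rw [← Finset.sum_neg_distrib]
      exact Finset.sum_congr rfl fun β _ => by rw [hK']; ring
    have t3 : ∀ α β, (-(1 / 2) * (A α β + A β α + K α β)) * (1 / 2 * (A β α - K β α - A α β)) +
        (-A α β) * (-(1 / 2) * (A β α + A α β + K β α)) =
        1 / 2 * (A α β * A β α) + 3 / 4 * A α β ^ 2 - 1 / 4 * A β α ^ 2 - 1 / 4 * K α β ^ 2
          - 1 / 2 * (A β α * K α β) - 1 / 2 * (A α β * K α β) := fun α β => by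
      rw [hK']; ring
    simp only [← Finset.sum_add_distrib, t3]
    simp only [Finset.sum_add_distrib, Finset.sum_sub_distrib, ← Finset.mul_sum, t1, t2]
    ring
  simp only [hA, hK] at s1 ⊢
  linarith

end Ricci

end Splitting

/-! ### Orthonormal bases and rescaled frames. -/

section Orthonormal

variable {V : Type*} [AddCommGroup V] [Module ℝ V] [FiniteDimensional ℝ V]

/-- A positive definite form has an orthonormal basis. -/
lemma exists_orthonormal_basis {q : LinearMap.BilinForm ℝ V} (hsymm : ∀ X Y, q X Y = q Y X)
    (hpos : ∀ X, X ≠ 0 → 0 < q X X) :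
    ∃ v : Module.Basis (Fin (Module.finrank ℝ V)) ℝ V,
      ∀ i j, q (v i) (v j) = if i = j then 1 else 0 := by
  obtain ⟨v, hv⟩ := LinearMap.BilinForm.exists_orthogonal_basis (B := q) ⟨hsymm⟩
  have h0 : ∀ i, 0 < q (v i) (v i) := fun i => hpos _ (v.ne_zero i)
  refine ⟨v.isUnitSMul (w := fun i => (√(q (v i) (v i)))⁻¹)
    fun i => (inv_ne_zero (Real.sqrt_pos.2 (h0 i)).ne').isUnit, fun i j => ?_⟩
  simp only [Module.Basis.isUnitSMul_apply, map_smul, LinearMap.smul_apply, smul_eq_mul]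
  split_ifs with h
  · subst h
    have h1 := Real.mul_self_sqrt (h0 i).le
    have h2 := (Real.sqrt_pos.2 (h0 i)).ne'
    rw [← mul_assoc, ← mul_inv, h1, inv_mul_cancel₀ (h0 i).ne']
  · rw [show q (v i) (v j) = 0 from hv h]; simp

lemma orthonormal_basis_repr {ι : Type*} [Fintype ι] [DecidableEq ι]
    {q : LinearMap.BilinForm ℝ V} {v : Module.Basis ι ℝ V}
    (hv : ∀ i j, q (v i) (v j) = if i = j then 1 else 0) (X : V) (i : ι) :
    v.repr X i = q (v i) X := by
  conv_rhs => rw [← v.sum_repr X]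
  simp only [map_sum, map_smul, hv, smul_eq_mul, mul_ite, mul_one, mul_zero, Finset.sum_ite_eq,
    Finset.mem_univ, if_true]

lemma trace_eq_sum_orthonormal {ι : Type*} [Fintype ι] [DecidableEq ι]
    {q : LinearMap.BilinForm ℝ V} {v : Module.Basis ι ℝ V}
    (hv : ∀ i j, q (v i) (v j) = if i = j then 1 else 0) (f : Module.End ℝ V) :
    LinearMap.trace ℝ V f = ∑ i, q (v i) (f (v i)) := by
  rw [LinearMap.trace_eq_matrix_trace ℝ v, Matrix.trace]
  exact Finset.sum_congr rfl fun i _ => by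
    rw [Matrix.diag_apply, LinearMap.toMatrix_apply, orthonormal_basis_repr hv]

/-- A skew operator with nonnegative trace of its square vanishes. -/
lemma trace_sq_of_skew {q : LinearMap.BilinForm ℝ V} (hsymm : ∀ X Y, q X Y = q Y X)
    (hpos : ∀ X, X ≠ 0 → 0 < q X X) {f : Module.End ℝ V} (hf : ∀ X Y, q (f X) Y = -q X (f Y)) :
    LinearMap.trace ℝ V (f ∘ₗ f) ≤ 0 ∧ (LinearMap.trace ℝ V (f ∘ₗ f) = 0 → f = 0) := by
  obtain ⟨v, hv⟩ := exists_orthonormal_basis hsymm hpos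
  have hnn : ∀ X, 0 ≤ q X X := fun X => by
    by_cases h : X = 0
    · simp [h]
    · exact (hpos X h).le
  have h1 : LinearMap.trace ℝ V (f ∘ₗ f) = -∑ i, q (f (v i)) (f (v i)) := by
    rw [trace_eq_sum_orthonormal hv, ← Finset.sum_neg_distrib]
    exact Finset.sum_congr rfl fun i _ => by rw [hf, neg_neg, LinearMap.comp_apply]
  refine ⟨by rw [h1]; exact neg_nonpos.2 (Finset.sum_nonneg fun i _ => hnn _), fun h => ?_⟩
  rw [h1, neg_eq_zero, Finset.sum_eq_zero_iff_of_nonneg fun i _ => hnn _] at h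
  refine v.ext fun i => ?_
  by_contra hne
  exact (hpos _ hne).ne' (h i (Finset.mem_univ i))

end Orthonormal

namespace Splitting

section FrameExists

variable {V : Type*} [AddCommGroup V] [Module ℝ V] [FiniteDimensional ℝ V]
  {𝔥 : Submodule ℝ V} {d : ℕ} {S : Splitting 𝔥 d} {q : LinearMap.BilinForm ℝ V}

lemma exists_frame (hq : S.IsMetric q)
    (horth : ∀ i j, i ≠ j → ∀ X ∈ S.comp i, ∀ Y ∈ S.comp j, q X Y = 0) :
    Nonempty (S.Frame q (Σ i, Fin (Module.finrank ℝ (S.comp i)))) := by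
  classical
  have hbasis : ∀ i, ∃ v : Module.Basis (Fin (Module.finrank ℝ (S.comp i))) ℝ (S.comp i),
      ∀ k l, q.restrict (S.comp i) (v k) (v l) = if k = l then 1 else 0 := fun i =>
    exists_orthonormal_basis (fun X Y => hq.symm _ _)
      (fun X hX => hq.pos _ (S.comp_le_𝔪 i X.2) (by simpa using hX))
  choose v hv using hbasis
  have hv' : ∀ i k l, q (v i k) (v i l) = if k = l then 1 else 0 := hv
  refine ⟨⟨fun α => v α.1 α.2, fun α => α.1, fun α => (v α.1 α.2).2, fun α => by simp [hv'],
    fun α β hαβ => ?_, fun i X hX => ?_⟩⟩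
  · obtain ⟨i, k⟩ := α
    obtain ⟨j, l⟩ := β
    by_cases hij : i = j
    · subst hij
      rw [hv', if_neg]
      rintro rfl; exact hαβ rfl
    · exact horth i j hij _ (v i k).2 _ (v j l).2
  · rw [Fintype.sum_sigma, Finset.sum_eq_single i]
    · have h1 := congrArg (S.comp i).subtype ((v i).sum_repr ⟨X, hX⟩)
      simp only [map_sum, map_smul, orthonormal_basis_repr (hv i)] at h1
      exact h1.symm
    · intro j _ hj
      refine Finset.sum_eq_zero fun k _ => ?_
      rw [horth j i hj _ (v j k).2 _ hX, zero_smul]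
    · simp

variable {g₁ : LinearMap.BilinForm ℝ V}

lemma metric_apply (s : Fin d → ℝ) (X Y : V) :
    S.metric g₁ s X Y = ∑ i, s i * g₁ (S.proj i X) (S.proj i Y) := by
  simp [metric, LinearMap.sum_apply]

lemma apply_proj_right (hq : S.IsMetric g₁)
    (horth : ∀ i j, i ≠ j → ∀ X ∈ S.comp i, ∀ Y ∈ S.comp j, g₁ X Y = 0)
    {i : Fin d} {X : V} (hX : X ∈ S.comp i) (Y : V) : g₁ X (S.proj i Y) = g₁ X Y := by
  conv_rhs => rw [← S.projH_add_sum_proj Y, map_add, hq.kernel_right X (S.projH_mem Y), zero_add,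
    map_sum]
  rw [Finset.sum_eq_single i]
  · intro j _ hj; exact horth i j hj.symm X hX _ (S.proj_mem j Y)
  · simp

lemma metric_apply_of_mem (hq : S.IsMetric g₁)
    (horth : ∀ i j, i ≠ j → ∀ X ∈ S.comp i, ∀ Y ∈ S.comp j, g₁ X Y = 0)
    (s : Fin d → ℝ) {i : Fin d} {X : V} (hX : X ∈ S.comp i) (Y : V) :
    S.metric g₁ s X Y = s i * g₁ X Y := by
  rw [metric_apply, Finset.sum_eq_single i]
  · rw [S.proj_of_mem hX, apply_proj_right hq horth hX]
  · intro j _ hj; rw [S.proj_of_mem_ne hj.symm hX]; simp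
  · simp

lemma isMetric_metric (hq : S.IsMetric g₁) {s : Fin d → ℝ} (hs : ∀ i, 0 < s i) :
    S.IsMetric (S.metric g₁ s) where
  symm X Y := by
    rw [metric_apply, metric_apply]
    exact Finset.sum_congr rfl fun i _ => by rw [hq.symm]
  kernel X hX Y := by
    rw [metric_apply]
    exact Finset.sum_eq_zero fun i _ => by rw [S.proj_of_mem_𝔥 i hX]; simp
  pos X hX hne := by
    rw [metric_apply]
    have hnn : ∀ i, 0 ≤ s i * g₁ (S.proj i X) (S.proj i X) := fun i =>
      mul_nonneg (hs i).le (hq.nonneg _)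
    refine lt_of_le_of_ne (Finset.sum_nonneg fun i _ => hnn i) fun h => hne ?_
    have h1 := (Finset.sum_eq_zero_iff_of_nonneg fun i _ => hnn i).1 h.symm
    rw [← S.sum_proj_of_mem hX]
    refine Finset.sum_eq_zero fun i hi => ?_
    refine hq.eq_zero (S.comp_le_𝔪 i (S.proj_mem i X)) ?_
    exact (mul_eq_zero.1 (h1 i hi)).resolve_left (hs i).ne'

lemma metric_one (hq : S.IsMetric g₁)
    (horth : ∀ i j, i ≠ j → ∀ X ∈ S.comp i, ∀ Y ∈ S.comp j, g₁ X Y = 0) :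
    S.metric g₁ (fun _ => 1) = g₁ := by
  ext X Y
  induction X using S.induction with
  | h𝔥 X hX =>
    rw [hq.kernel X hX, (isMetric_metric hq (s := fun _ => 1) fun _ => one_pos).kernel X hX]
  | hcomp i X hX => rw [metric_apply_of_mem hq horth _ hX, one_mul]
  | hadd X X' h h' => simp only [map_add, LinearMap.add_apply, h, h']

/-- Rescaling a frame for the metric with parameters `s`. -/
def Frame.scale {ι : Type*} [Fintype ι] (F : S.Frame g₁ ι) (hq : S.IsMetric g₁)
    (horth : ∀ i j, i ≠ j → ∀ X ∈ S.comp i, ∀ Y ∈ S.comp j, g₁ X Y = 0)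
    {s : Fin d → ℝ} (hs : ∀ i, 0 < s i) : S.Frame (S.metric g₁ s) ι where
  vec α := (√(s (F.idx α)))⁻¹ • F.vec α
  idx := F.idx
  mem α := Submodule.smul_mem _ _ (F.mem α)
  norm α := by
    rw [map_smul, map_smul, LinearMap.smul_apply, metric_apply_of_mem hq horth s (F.mem α),
      F.norm, smul_eq_mul, smul_eq_mul, mul_one, ← mul_assoc, ← mul_inv,
      Real.mul_self_sqrt (hs _).le, inv_mul_cancel₀ (hs _).ne']
  orth α β h := by
    rw [map_smul, map_smul, LinearMap.smul_apply, metric_apply_of_mem hq horth s (F.mem α),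
      F.orth α β h]
    simp
  expand i X hX := by
    conv_lhs => rw [F.expand i X hX]
    refine Finset.sum_congr rfl fun α _ => ?_
    rw [map_smul, LinearMap.smul_apply, metric_apply_of_mem hq horth s (F.mem α), smul_smul]
    congr 1
    have h := Real.mul_self_sqrt (hs (F.idx α)).le
    have h' := (Real.sqrt_pos.2 (hs (F.idx α))).ne'
    rw [smul_eq_mul]
    field_simp
    rw [sq, h]

end FrameExists

/-! ### The algebraic model and Schur's lemma. -/

/-- The algebraic data of a compact homogeneous space `G/H` with a multiplicity-free isotropy
representation: `Q` is an `Ad(G)`-invariant scalar product on `𝔤` and `Γ = Ad(H)`. -/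
structure IsReductiveModel {𝔤 : Type*} [LieRing 𝔤] [LieAlgebra ℝ 𝔤] {𝔥 : Submodule ℝ 𝔤} {d : ℕ}
    (S : Splitting 𝔥 d) (g₁ Q : LinearMap.BilinForm ℝ 𝔤) (Γ : Set (𝔤 →ₗ[ℝ] 𝔤)) : Prop where
  metric : S.IsMetric g₁
  Q_symm : ∀ X Y, Q X Y = Q Y X
  Q_pos : ∀ X, X ≠ 0 → 0 < Q X X
  Q_skew : ∀ X Y Z : 𝔤, Q ⁅X, Y⁆ Z = -Q Y ⁅X, Z⁆
  lie_𝔥 : ∀ X ∈ 𝔥, ∀ Y ∈ 𝔥, ⁅X, Y⁆ ∈ 𝔥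
  lie_comp : ∀ i, ∀ X ∈ 𝔥, ∀ Y ∈ S.comp i, ⁅X, Y⁆ ∈ S.comp i
  skew_𝔥 : ∀ X ∈ 𝔥, ∀ Y Z, g₁ ⁅X, Y⁆ Z = -g₁ Y ⁅X, Z⁆
  skew_commutant : ∀ X : 𝔤, (∀ W ∈ 𝔥, ⁅W, X⁆ = 0) → ∀ Y Z, g₁ ⁅X, Y⁆ Z = -g₁ Y ⁅X, Z⁆
  effective : ∀ X ∈ 𝔥, (∀ Y ∈ S.𝔪, ⁅X, Y⁆ = 0) → X = 0
  map_lie : ∀ A ∈ Γ, ∀ X Y, A ⁅X, Y⁆ = ⁅A X, A Y⁆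
  map_𝔥 : ∀ A ∈ Γ, ∀ X ∈ 𝔥, A X ∈ 𝔥
  map_comp : ∀ i, ∀ A ∈ Γ, ∀ X ∈ S.comp i, A X ∈ S.comp i
  map_metric : ∀ A ∈ Γ, ∀ X Y, g₁ (A X) (A Y) = g₁ X Y
  inv : ∀ A ∈ Γ, ∃ A' ∈ Γ, ∀ X, A (A' X) = X
  ne_bot : ∀ i, S.comp i ≠ ⊥
  irreducible : ∀ i, ∀ W ≤ S.comp i, (∀ A ∈ Γ, ∀ X ∈ W, A X ∈ W) → W = ⊥ ∨ W = S.comp i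
  inequivalent : ∀ i j, i ≠ j → ¬ ∃ f : S.comp i ≃ₗ[ℝ] S.comp j,
    ∀ A ∈ Γ, ∀ X Y : S.comp i, (Y : 𝔤) = A X → (f Y : 𝔤) = A (f X)

namespace IsReductiveModel

variable {𝔤 : Type*} [LieRing 𝔤] [LieAlgebra ℝ 𝔤] [FiniteDimensional ℝ 𝔤]
  {𝔥 : Submodule ℝ 𝔤} {d : ℕ} {S : Splitting 𝔥 d} {g₁ Q : LinearMap.BilinForm ℝ 𝔤}
  {Γ : Set (𝔤 →ₗ[ℝ] 𝔤)}

section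

variable (M : S.IsReductiveModel g₁ Q Γ)

include M

/-- Since ad X is skew for Q, the trace of its square is minus its squared norm. The equality case
below identifies Killing-null vectors with central ones. -/
lemma killingForm_nonpos (X : 𝔤) : killingForm ℝ 𝔤 X X ≤ 0 := by
  rw [killingForm_apply_apply]
  exact (trace_sq_of_skew M.Q_symm M.Q_pos fun Y Z => M.Q_skew X Y Z).1

lemma lie_eq_zero_of_killingForm_eq_zero {X : 𝔤} (h : killingForm ℝ 𝔤 X X = 0) (Y : 𝔤) :
    ⁅X, Y⁆ = 0 := by
  rw [killingForm_apply_apply] at h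
  have := (trace_sq_of_skew M.Q_symm M.Q_pos (f := LieAlgebra.ad ℝ 𝔤 X)
    fun Y Z => M.Q_skew X Y Z).2 h
  have h2 := LinearMap.congr_fun this Y
  simpa using h2

lemma trace_ad (X : 𝔤) : LinearMap.trace ℝ 𝔤 (LieAlgebra.ad ℝ 𝔤 X) = 0 := by
  obtain ⟨v, hv⟩ := exists_orthonormal_basis M.Q_symm M.Q_pos
  rw [trace_eq_sum_orthonormal hv]
  refine Finset.sum_eq_zero fun i _ => ?_
  have := M.Q_skew X (v i) (v i)
  rw [M.Q_symm] at this
  rw [LieAlgebra.ad_apply]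
  linarith

lemma map_𝔪 {A : 𝔤 →ₗ[ℝ] 𝔤} (hA : A ∈ Γ) {X : 𝔤} (hX : X ∈ S.𝔪) : A X ∈ S.𝔪 :=
  S.induction_𝔪 (p := fun X => A X ∈ S.𝔪) (by simp)
    (fun i X hX => S.comp_le_𝔪 i (M.map_comp i A hA X hX))
    (fun X Y hX hY => by simp only [map_add]; exact add_mem hX hY) hX

lemma lie_𝔪 {X Y : 𝔤} (hX : X ∈ 𝔥) (hY : Y ∈ S.𝔪) : ⁅X, Y⁆ ∈ S.𝔪 :=
  S.induction_𝔪 (p := fun Y => ⁅X, Y⁆ ∈ S.𝔪) (by simp)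
    (fun i Y hY => S.comp_le_𝔪 i (M.lie_comp i X hX Y hY))
    (fun Y Z hY hZ => by simp only [lie_add]; exact add_mem hY hZ) hY

lemma map_proj {A : 𝔤 →ₗ[ℝ] 𝔤} (hA : A ∈ Γ) (i : Fin d) (X : 𝔤) :
    A (S.proj i X) = S.proj i (A X) := by
  induction X using S.induction with
  | h𝔥 X hX => rw [S.proj_of_mem_𝔥 i hX, S.proj_of_mem_𝔥 i (M.map_𝔥 A hA X hX), map_zero]
  | hcomp j X hX =>
    by_cases hij : j = i
    · subst hij; rw [S.proj_of_mem hX, S.proj_of_mem (M.map_comp j A hA X hX)]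
    · rw [S.proj_of_mem_ne hij hX, S.proj_of_mem_ne hij (M.map_comp j A hA X hX), map_zero]
  | hadd X Y h h' => simp only [map_add, h, h']

/-- Schur's lemma. -/
lemma eq_zero_of_equivariant {i j : Fin d} (hij : i ≠ j) (f : 𝔤 →ₗ[ℝ] 𝔤)
    (hf : ∀ X ∈ S.comp i, f X ∈ S.comp j) (hfΓ : ∀ A ∈ Γ, ∀ X ∈ S.comp i, f (A X) = A (f X))
    {X : 𝔤} (hX : X ∈ S.comp i) : f X = 0 := by
  rcases M.irreducible i (S.comp i ⊓ LinearMap.ker f) inf_le_left (fun A hA X hX => by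
    obtain ⟨h1, h2⟩ := Submodule.mem_inf.1 hX
    refine Submodule.mem_inf.2 ⟨M.map_comp i A hA X h1, ?_⟩
    rw [LinearMap.mem_ker, hfΓ A hA X h1, LinearMap.mem_ker.1 h2, map_zero]) with h | h
  · exfalso
    have hrange := M.irreducible j ((S.comp i).map f)
      (by rintro _ ⟨Y, hY, rfl⟩; exact hf Y hY)
      (by
        rintro A hA _ ⟨Y, hY, rfl⟩
        exact ⟨A Y, M.map_comp i A hA Y hY, hfΓ A hA Y hY⟩)
    have hinj : ∀ Y ∈ S.comp i, f Y = 0 → Y = 0 := fun Y hY h0 => by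
      have : Y ∈ S.comp i ⊓ LinearMap.ker f := ⟨hY, h0⟩
      rw [h] at this
      exact (Submodule.mem_bot ℝ).1 this
    rcases hrange with h1 | h1
    · refine M.ne_bot i ((Submodule.eq_bot_iff _).2 fun Y hY => hinj Y hY ?_)
      have : f Y ∈ (S.comp i).map f := ⟨Y, hY, rfl⟩
      rw [h1] at this
      exact (Submodule.mem_bot ℝ).1 this
    · refine M.inequivalent i j hij ⟨LinearEquiv.ofBijective (f.restrict hf) ⟨?_, ?_⟩, ?_⟩
      · refine (injective_iff_map_eq_zero _).2 fun Y hY => ?_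
        have : f Y = 0 := by simpa using congrArg Subtype.val hY
        exact Subtype.ext (hinj Y Y.2 this)
      · intro Z
        have hZ : (Z : 𝔤) ∈ (S.comp i).map f := by rw [h1]; exact Z.2
        obtain ⟨Y, hY, hYZ⟩ := hZ
        exact ⟨⟨Y, hY⟩, Subtype.ext hYZ⟩
      · intro A hA X Y hXY
        change f (Y : 𝔤) = A (f X)
        rw [hXY, hfΓ A hA X X.2]
  · rw [← h] at hX
    exact hX.2

lemma isRefl_metric : LinearMap.BilinForm.IsRefl g₁ := fun X Y h => by
  rw [M.metric.symm]; exact h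

lemma isCompl_orthogonal {U : Submodule ℝ 𝔤} (hU : U ≤ S.𝔪) : IsCompl U (g₁.orthogonal U) := by
  refine LinearMap.BilinForm.isCompl_orthogonal_of_restrict_nondegenerate M.isRefl_metric ?_
  have hrefl : LinearMap.IsRefl (g₁.restrict U) := fun X Y h => M.isRefl_metric _ _ h
  refine (LinearMap.IsRefl.nondegenerate_iff_separatingLeft hrefl).2 fun X hX => ?_
  exact Subtype.ext (M.metric.eq_zero (hU X.2) (hX X))

/-- An invariant subspace of `𝔪` contains or is orthogonal to each summand. -/
lemma le_or_orthogonal {U : Submodule ℝ 𝔤} (hU : U ≤ S.𝔪)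
    (hUΓ : ∀ A ∈ Γ, ∀ X ∈ U, A X ∈ U) (i : Fin d) :
    S.comp i ≤ U ∨ ∀ X ∈ S.comp i, ∀ Y ∈ U, g₁ Y X = 0 := by
  have hc := M.isCompl_orthogonal hU
  set p := U.projection _ hc with hp
  have hpU : ∀ X, p X ∈ U := fun X => Submodule.projection_apply_mem hc X
  have hpo : ∀ X, ∀ Y ∈ U, g₁ Y (X - p X) = 0 := fun X => by
    have h1 : p (X - p X) = 0 := by
      rw [map_sub, (Submodule.projection_eq_self_iff hc (p X)).2 (hpU X), sub_self]
    exact LinearMap.BilinForm.mem_orthogonal_iff.1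
      ((Submodule.projection_apply_eq_zero_iff hc).1 h1)
  have hpA : ∀ A ∈ Γ, ∀ X, p (A X) = A (p X) := fun A hA X => by
    have h1 : p (A (p X)) = A (p X) :=
      (Submodule.projection_eq_self_iff hc _).2 (hUΓ A hA _ (hpU X))
    have h2 : p (A (X - p X)) = 0 := by
      refine (Submodule.projection_apply_eq_zero_iff hc).2
        (LinearMap.BilinForm.mem_orthogonal_iff.2 fun Y hY => ?_)
      obtain ⟨A', hA', hAA'⟩ := M.inv A hA
      change g₁ Y _ = 0
      rw [← hAA' Y, M.map_metric A hA]
      exact hpo X _ (hUΓ A' hA' Y hY)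
    rw [map_sub, map_sub, h1] at h2
    exact sub_eq_zero.1 h2
  -- The 𝔪ⱼ-component of p on 𝔪ᵢ is equivariant, hence zero for j ≠ i by Schur's lemma.
  -- Irreducibility of 𝔪ᵢ then leaves p = 0 on 𝔪ᵢ or p(𝔪ᵢ) = 𝔪ᵢ.
  have hpi : ∀ X ∈ S.comp i, p X ∈ S.comp i := fun X hX => by
    rw [← S.sum_proj_of_mem (hU (hpU X))]
    rw [Finset.sum_eq_single i]
    · exact S.proj_mem _ _
    · intro j _ hj
      refine M.eq_zero_of_equivariant hj.symm (S.proj j ∘ₗ p) (fun X _ => S.proj_mem _ _) ?_ hX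
      intro A hA X _
      rw [LinearMap.comp_apply, hpA A hA, ← M.map_proj hA, LinearMap.comp_apply]
    · simp
  rcases M.irreducible i ((S.comp i).map p)
    (by rintro _ ⟨X, hX, rfl⟩; exact hpi X hX)
    (by
      rintro A hA _ ⟨X, hX, rfl⟩
      exact ⟨A X, M.map_comp i A hA X hX, hpA A hA X⟩) with h | h
  · right
    intro X hX Y hY
    have h1 : p X ∈ (S.comp i).map p := ⟨X, hX, rfl⟩
    rw [h] at h1
    have h2 := hpo X Y hY
    rwa [(Submodule.mem_bot ℝ).1 h1, sub_zero] at h2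
  · left
    rw [← h]
    rintro _ ⟨X, _, rfl⟩
    exact hpU X

/-- Apply the dichotomy to U = 𝔪ᵢ; independence of the summands excludes that 𝔪ⱼ lies in 𝔪ᵢ. -/
lemma orthogonal (i j : Fin d) (hij : i ≠ j) (X : 𝔤) (hX : X ∈ S.comp i) (Y : 𝔤)
    (hY : Y ∈ S.comp j) : g₁ X Y = 0 := by
  rcases M.le_or_orthogonal (S.comp_le_𝔪 i) (M.map_comp i) j with h | h
  · exfalso
    refine M.ne_bot j ((Submodule.eq_bot_iff _).2 fun Z hZ => ?_)
    rw [← S.proj_of_mem hZ, S.proj_of_mem_ne hij (h hZ)]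
  · exact h Y hY X hX

lemma exists_frame : Nonempty (S.Frame g₁ (Σ i, Fin (Module.finrank ℝ (S.comp i)))) :=
  Splitting.exists_frame M.metric M.orthogonal

end

end IsReductiveModel

end Splitting

/-! ### The Laurent polynomial ℓ_θ and the moment map as a barycentre. -/

namespace Splitting

/-- As [W,𝔥] lies in 𝔪, the 𝔥-block of ad W contributes nothing, and the trace over V is the trace
over 𝔪. -/
lemma Frame.sum_ad_eq_zero {V : Type*} [AddCommGroup V] [Module ℝ V] [FiniteDimensional ℝ V]
    {𝔥 : Submodule ℝ V} {d : ℕ} {S : Splitting 𝔥 d} {q : LinearMap.BilinForm ℝ V}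
    {ι : Type*} [Fintype ι] (F : S.Frame q ι) (hq : S.IsMetric q)
    {b : V →ₗ[ℝ] V →ₗ[ℝ] V} (hb : ∀ X Y, b X Y = -b Y X)
    (hbm : ∀ Y ∈ 𝔥, ∀ X ∈ S.𝔪, b Y X ∈ S.𝔪) {W : V} (hW : W ∈ S.𝔪)
    (htr : LinearMap.trace ℝ V (b W) = 0) : ∑ α, q (b W (F.vec α)) (F.vec α) = 0 := by
  have h0 : S.projH ∘ₗ b W ∘ₗ S.projH = 0 := by
    ext X
    refine S.projH_of_mem_𝔪 ?_
    rw [LinearMap.comp_apply, hb]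
    exact neg_mem (hbm _ (S.projH_mem X) _ hW)
  have h1 : b W = (S.projH ∘ₗ S.projH) ∘ₗ b W + S.𝔪.subtype ∘ₗ S.projM ∘ₗ b W := by
    ext X
    have := (S.projH_add_projM (b W X)).symm
    simp only [LinearMap.add_apply, LinearMap.comp_apply]
    rwa [S.projH_of_mem (S.projH_mem _)]
  rw [h1, map_add, F.trace_projM_comp hq, LinearMap.comp_assoc, LinearMap.trace_comp_comm',
    LinearMap.comp_assoc, h0, map_zero, zero_add] at htr
  rw [← htr]
  exact Finset.sum_congr rfl fun α _ => hq.symm _ _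

section

variable {𝔤 : Type*} [LieRing 𝔤] [LieAlgebra ℝ 𝔤] [FiniteDimensional ℝ 𝔤]
  {𝔥 : Submodule ℝ 𝔤} {d : ℕ} {S : Splitting 𝔥 d} {g₁ Q : LinearMap.BilinForm ℝ 𝔤}
  {Γ : Set (𝔤 →ₗ[ℝ] 𝔤)}

@[simp] lemma lieBracket_apply (X Y : 𝔤) : lieBracket 𝔤 X Y = ⁅X, Y⁆ := rfl

namespace Frame

variable {ι : Type*} [Fintype ι] (F : S.Frame g₁ ι)

/-- The structure constants of the bracket in a frame. -/
def structConst (α β γ : ι) : ℝ := g₁ ⁅F.vec α, F.vec β⁆ (F.vec γ)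

lemma structConst_swap (α β γ : ι) : F.structConst β α γ = -F.structConst α β γ := by
  rw [structConst, ← lie_skew, map_neg, LinearMap.neg_apply, structConst]

/-- The coefficients of the Laurent polynomial `ℓ_θ`. -/
def coeff (θ : ℝ) : (ι × ι × ι) ⊕ ι → ℝ
  | .inl (α, β, γ) => (1 + θ) / 4 * F.structConst α β γ ^ 2
  | .inr α => (1 - θ) / 2 * -killingForm ℝ 𝔤 (F.vec α) (F.vec α)

/-- The exponents (up to sign) of the Laurent polynomial `ℓ_θ`. -/
def wt : (ι × ι × ι) ⊕ ι → Fin d → ℝ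
  | .inl (α, β, γ) => weight (F.idx α) + weight (F.idx β) - weight (F.idx γ)
  | .inr α => weight (F.idx α)

/-- The monomials of the Laurent polynomial `ℓ_θ`. -/
def monom (s : Fin d → ℝ) : (ι × ι × ι) ⊕ ι → ℝ
  | .inl (α, β, γ) => s (F.idx γ) / (s (F.idx α) * s (F.idx β))
  | .inr α => 1 / s (F.idx α)

/-- The value of a linear function on the exponents. -/
lemma sum_wt_mul (τ : (ι × ι × ι) ⊕ ι) (φ : Fin d → ℝ) : ∑ i, F.wt τ i * φ i =
    match τ with
    | .inl (α, β, γ) => φ (F.idx α) + φ (F.idx β) - φ (F.idx γ)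
    | .inr α => φ (F.idx α) := by
  rcases τ with ⟨α, β, γ⟩ | α <;>
  simp [wt, weight, add_mul, sub_mul, Finset.sum_add_distrib, Finset.sum_sub_distrib,
    Pi.single_apply]

/-- All monomials are homogeneous of degree -1 in s. Division by ℓ_θ therefore amounts to a common
rescaling of s, which `limit_unique` exploits. -/
lemma sum_wt (τ : (ι × ι × ι) ⊕ ι) : ∑ i, F.wt τ i = 1 := by
  have := F.sum_wt_mul τ fun _ => 1
  rcases τ with ⟨α, β, γ⟩ | α <;> simpa using this

lemma monom_pos {s : Fin d → ℝ} (hs : ∀ i, 0 < s i) (τ : (ι × ι × ι) ⊕ ι) : 0 < F.monom s τ := by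
  rcases τ with ⟨α, β, γ⟩ | α
  · exact div_pos (hs _) (mul_pos (hs _) (hs _))
  · exact one_div_pos.2 (hs _)

lemma log_monom {s : Fin d → ℝ} (hs : ∀ i, 0 < s i) (τ : (ι × ι × ι) ⊕ ι) :
    Real.log (F.monom s τ) = -∑ i, F.wt τ i * Real.log (s i) := by
  rw [F.sum_wt_mul]
  rcases τ with ⟨α, β, γ⟩ | α
  · simp only [monom]
    rw [Real.log_div (hs _).ne' (mul_pos (hs _) (hs _)).ne', Real.log_mul (hs _).ne' (hs _).ne']
    ring
  · simp only [monom]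
    rw [one_div, Real.log_inv]

end Frame

section

variable (M : S.IsReductiveModel g₁ Q Γ) {ι : Type*} [Fintype ι] (F : S.Frame g₁ ι)

include M

lemma Frame.coeff_nonneg {θ : ℝ} (hθ : |θ| < 1) (τ : (ι × ι × ι) ⊕ ι) : 0 ≤ F.coeff θ τ := by
  have h := abs_lt.1 hθ
  rcases τ with ⟨α, β, γ⟩ | α
  · exact mul_nonneg (by linarith) (sq_nonneg _)
  · exact mul_nonneg (by linarith) (neg_nonneg.2 (M.killingForm_nonpos _))

/-- The operator `-(1 + θ) Ric - B_g` in a frame. -/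
lemma apply_momentOp (θ : ℝ) {s : Fin d → ℝ} (hs : ∀ i, 0 < s i) (α : ι) :
    S.metric g₁ s ((F.scale M.metric M.orthogonal hs).vec α)
      (S.momentOp θ (S.metric g₁ s) ((F.scale M.metric M.orthogonal hs).vecM α)) =
    (1 - θ) / 2 * (-killingForm ℝ 𝔤 (F.vec α) (F.vec α)) * (1 / s (F.idx α)) +
      (1 + θ) / 2 * ∑ β, ∑ γ, F.structConst α β γ ^ 2 *
        (s (F.idx γ) / (s (F.idx α) * s (F.idx β))) -
      (1 + θ) / 4 * ∑ β, ∑ γ, F.structConst β γ α ^ 2 *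
        (s (F.idx α) / (s (F.idx β) * s (F.idx γ))) := by
  have hq := isMetric_metric M.metric hs
  set F' := F.scale M.metric M.orthogonal hs with hF'
  have hvec : ∀ α, F'.vec α = (√(s (F.idx α)))⁻¹ • F.vec α := fun α => rfl
  have hsq : ∀ α, (√(s (F.idx α)))⁻¹ ^ 2 = 1 / s (F.idx α) := fun α => by
    rw [inv_pow, Real.sq_sqrt (hs _).le, one_div]
  have hB : killingForm ℝ 𝔤 (F'.vec α) (F'.vec α) =
      killingForm ℝ 𝔤 (F.vec α) (F.vec α) * (1 / s (F.idx α)) := by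
    rw [hvec, map_smul, map_smul, LinearMap.smul_apply, smul_eq_mul, smul_eq_mul, ← hsq]; ring
  have hc : ∀ α β γ, S.metric g₁ s ⁅F'.vec α, F'.vec β⁆ (F'.vec γ) ^ 2 =
      F.structConst α β γ ^ 2 * (s (F.idx γ) / (s (F.idx α) * s (F.idx β))) := fun α β γ => by
    rw [hvec, hvec, hvec, smul_lie, lie_smul, map_smul, map_smul, map_smul, LinearMap.smul_apply,
      LinearMap.smul_apply, hq.symm, metric_apply_of_mem M.metric M.orthogonal s (F.mem γ),
      M.metric.symm]
    simp only [smul_eq_mul, mul_pow, hsq, Frame.structConst]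
    have := (hs (F.idx γ)).ne'
    field_simp
  have hb : ∀ X Y : 𝔤, lieBracket 𝔤 X Y = -lieBracket 𝔤 Y X := fun X Y => by
    rw [lieBracket_apply, lieBracket_apply, lie_skew]
  have hbm : ∀ Y ∈ 𝔥, ∀ X ∈ S.𝔪, lieBracket 𝔤 Y X ∈ S.𝔪 := fun Y hY X hX => M.lie_𝔪 hY hX
  have hric := ricci_self F' (lieBracket 𝔤) hb hbm
    (fun W hW => F'.sum_ad_eq_zero hq hb hbm hW (M.trace_ad W)) hq (F'.vecM α)
  have hkill : LinearMap.trace ℝ 𝔤 (lieBracket 𝔤 (F'.vecM α) ∘ₗ lieBracket 𝔤 (F'.vecM α)) =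
      killingForm ℝ 𝔤 (F'.vec α) (F'.vec α) := by
    rw [killingForm_apply_apply]; rfl
  rw [hkill, hB] at hric
  simp only [lieBracket_apply, Frame.coe_vecM, hc] at hric
  have hop : S.metric g₁ s (F'.vec α) (S.momentOp θ (S.metric g₁ s) (F'.vecM α)) =
      -(1 + θ) * S.ricci (lieBracket 𝔤) (S.metric g₁ s) (F'.vecM α) (F'.vecM α) -
        killingForm ℝ 𝔤 (F'.vec α) (F'.vec α) := by
    rw [hq.symm]
    have h1 := hq.ricciOp_apply (lieBracket 𝔤) (F'.vecM α) (F'.vecM α)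
    have h2 : S.metric g₁ s (S.killingOp (S.metric g₁ s) (F'.vecM α)) (F'.vecM α) =
        killingForm ℝ 𝔤 (F'.vec α) (F'.vec α) := hq.sharp_apply _ _
    rw [← h1, ← h2]
    simp only [momentOp, LinearMap.sub_apply, LinearMap.smul_apply, Submodule.coe_sub,
      Submodule.coe_smul, map_sub, map_smul, smul_eq_mul, Frame.coe_vecM]
  rw [hop, hric, hB]
  ring

/-- Pairing the diagonal of the moment operator with φ. Each bracket monomial enters through its two
inputs, together with factor (1+θ)/2, and negatively through its output, which assembles the weight
ε_i+ε_j-ε_k. -/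
lemma sum_apply_momentOp (θ : ℝ) {s : Fin d → ℝ} (hs : ∀ i, 0 < s i) (φ : Fin d → ℝ) :
    ∑ α, φ (F.idx α) * S.metric g₁ s ((F.scale M.metric M.orthogonal hs).vec α)
      (S.momentOp θ (S.metric g₁ s) ((F.scale M.metric M.orthogonal hs).vecM α)) =
    ∑ τ, F.coeff θ τ * F.monom s τ * ∑ i, F.wt τ i * φ i := by
  simp only [apply_momentOp M F θ hs, F.sum_wt_mul, Fintype.sum_sum_type, Fintype.sum_prod_type,
    Frame.coeff, Frame.monom, mul_add, mul_sub, Finset.sum_add_distrib, Finset.sum_sub_distrib,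
    Finset.mul_sum]
  have e1 : ∑ α, ∑ β, ∑ γ, (1 + θ) / 4 * F.structConst α β γ ^ 2 *
      (s (F.idx γ) / (s (F.idx α) * s (F.idx β))) * φ (F.idx β) =
      ∑ α, ∑ β, ∑ γ, (1 + θ) / 4 * F.structConst α β γ ^ 2 *
      (s (F.idx γ) / (s (F.idx α) * s (F.idx β))) * φ (F.idx α) := by
    rw [Finset.sum_comm]
    refine Finset.sum_congr rfl fun α _ => Finset.sum_congr rfl fun β _ =>
      Finset.sum_congr rfl fun γ _ => ?_
    rw [F.structConst_swap α β γ, mul_comm (s (F.idx β))]; ring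
  have e2 : ∑ α, ∑ β, ∑ γ, (1 + θ) / 4 * F.structConst α β γ ^ 2 *
      (s (F.idx γ) / (s (F.idx α) * s (F.idx β))) * φ (F.idx γ) =
      ∑ α, ∑ β, ∑ γ, φ (F.idx α) * ((1 + θ) / 4 * (F.structConst β γ α ^ 2 *
        (s (F.idx α) / (s (F.idx β) * s (F.idx γ))))) := by
    rw [show (∑ α, ∑ β, ∑ γ, φ (F.idx α) * ((1 + θ) / 4 * (F.structConst β γ α ^ 2 *
        (s (F.idx α) / (s (F.idx β) * s (F.idx γ)))))) =
        ∑ β, ∑ α, ∑ γ, φ (F.idx α) * ((1 + θ) / 4 * (F.structConst β γ α ^ 2 *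
        (s (F.idx α) / (s (F.idx β) * s (F.idx γ))))) from Finset.sum_comm]
    refine Finset.sum_congr rfl fun α _ => ?_
    rw [Finset.sum_comm]
    refine Finset.sum_congr rfl fun β _ => Finset.sum_congr rfl fun γ _ => ?_
    ring
  rw [e1, e2]
  have e3 : ∑ α, ∑ β, ∑ γ, φ (F.idx α) * ((1 + θ) / 2 * (F.structConst α β γ ^ 2 *
      (s (F.idx γ) / (s (F.idx α) * s (F.idx β))))) =
      2 * ∑ α, ∑ β, ∑ γ, (1 + θ) / 4 * F.structConst α β γ ^ 2 *
      (s (F.idx γ) / (s (F.idx α) * s (F.idx β))) * φ (F.idx α) := by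
    simp only [Finset.mul_sum]
    refine Finset.sum_congr rfl fun α _ => Finset.sum_congr rfl fun β _ =>
      Finset.sum_congr rfl fun γ _ => ?_
    ring
  have e4 : ∑ α, φ (F.idx α) * ((1 - θ) / 2 * (-killingForm ℝ 𝔤 (F.vec α) (F.vec α)) *
      (1 / s (F.idx α))) = ∑ α, (1 - θ) / 2 * (-killingForm ℝ 𝔤 (F.vec α) (F.vec α)) *
      (1 / s (F.idx α)) * φ (F.idx α) := Finset.sum_congr rfl fun α _ => mul_comm _ _
  rw [e3, e4]
  ring

/-- `ℓ_θ` is a Laurent polynomial in the parameters of the metric. -/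
lemma ell_eq (θ : ℝ) {s : Fin d → ℝ} (hs : ∀ i, 0 < s i) :
    S.ell θ (S.metric g₁ s) = ∑ τ, F.coeff θ τ * F.monom s τ := by
  rw [ell, (F.scale M.metric M.orthogonal hs).trace_eq]
  have := sum_apply_momentOp M F θ hs fun _ => 1
  simpa only [one_mul, mul_one, F.sum_wt] using this

/-- The moment map is the barycentre of the exponents of `ℓ_θ`. -/
lemma moment_eq (θ : ℝ) {s : Fin d → ℝ} (hs : ∀ i, 0 < s i) (l : Fin d) :
    S.moment θ (S.metric g₁ s) l =
      (∑ τ, F.coeff θ τ * F.monom s τ * F.wt τ l) / ∑ τ, F.coeff θ τ * F.monom s τ := by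
  have hq := isMetric_metric M.metric hs
  rw [moment, ell_eq M F θ hs, (F.scale M.metric M.orthogonal hs).trace_eq]
  congr 1
  have := sum_apply_momentOp M F θ hs fun i => if i = l then 1 else 0
  simp only [mul_ite, mul_one, mul_zero, Finset.sum_ite_eq', Finset.mem_univ, if_true] at this
  rw [← this]
  refine Finset.sum_congr rfl fun α _ => ?_
  simp only [LinearMap.comp_apply, Submodule.subtype_apply]
  rw [hq.projM_right]
  have hmem := (F.scale M.metric M.orthogonal hs).mem α
  split_ifs with h
  · subst h
    rw [metric_apply_of_mem M.metric M.orthogonal s hmem,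
      metric_apply_of_mem M.metric M.orthogonal s hmem]
    rw [one_mul]
    congr 1
    exact apply_proj_right M.metric M.orthogonal hmem _
  · rw [zero_mul, metric_apply_of_mem M.metric M.orthogonal s hmem,
      M.orthogonal _ _ h _ hmem _ (S.proj_mem l _), mul_zero]

end

end

end Splitting

/-! ### Existence and uniqueness of the limits of monomials. -/

/-- Positive points of a toric variety with the same image under the moment map coincide; the
points are the limits of `p` along `l` and `l'`. -/
lemma toric_unique {X T : Type*} [Fintype T] {d : ℕ} {l l' : Filter X} [l.NeBot] [l'.NeBot]
    {p : X → T → ℝ} {φ : X → Fin d → ℝ} {w : T → Fin d → ℝ} {C P P' : T → ℝ}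
    (hC : ∀ τ, 0 ≤ C τ)
    (hl : ∀ᶠ x in l, ∀ τ, 0 < p x τ ∧ Real.log (p x τ) = ∑ i, w τ i * φ x i)
    (hl' : ∀ᶠ x in l', ∀ τ, 0 < p x τ ∧ Real.log (p x τ) = ∑ i, w τ i * φ x i)
    (hP : ∀ τ, C τ ≠ 0 → Filter.Tendsto (fun x => p x τ) l (𝓝 (P τ)))
    (hP' : ∀ τ, C τ ≠ 0 → Filter.Tendsto (fun x => p x τ) l' (𝓝 (P' τ)))
    (hw : ∀ i, ∑ τ, C τ * P τ * w τ i = ∑ τ, C τ * P' τ * w τ i) {τ : T} (hτ : C τ ≠ 0) :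
    P τ = P' τ := by
  -- The limits may be 0, so logarithms are taken of the approximating values, which are eventually
  -- ordered like their limits.
  have hev : ∀ σ, ∀ᶠ z : X × X in l ×ˢ l', 0 < p z.1 σ ∧ 0 < p z.2 σ → C σ ≠ 0 → P σ ≠ P' σ →
      0 < (P σ - P' σ) * (Real.log (p z.1 σ) - Real.log (p z.2 σ)) := by
    intro σ
    by_cases hσ : C σ ≠ 0
    · have h1 := (hP σ hσ).comp (Filter.tendsto_fst (f := l) (g := l'))
      have h2 := (hP' σ hσ).comp (Filter.tendsto_snd (f := l) (g := l'))
      rcases lt_trichotomy (P σ) (P' σ) with h | h | h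
      · filter_upwards [h1.eventually_lt h2 h] with z hz hpos _ _
        exact mul_pos_of_neg_of_neg (sub_neg.2 h) (sub_neg.2 (Real.log_lt_log hpos.1 hz))
      · exact Filter.Eventually.of_forall fun z _ _ hne => absurd h hne
      · filter_upwards [h2.eventually_lt h1 h] with z hz hpos _ _
        exact mul_pos (sub_pos.2 h) (sub_pos.2 (Real.log_lt_log hpos.2 hz))
    · exact Filter.Eventually.of_forall fun z _ h => absurd h hσ
  have hev2 := (Filter.eventually_all.2 hev).and
    ((Filter.tendsto_fst.eventually hl).and (Filter.tendsto_snd.eventually hl'))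
  obtain ⟨z, hz, hz1, hz2⟩ := hev2.exists
  by_contra hne
  -- The logarithms are linear in the exponents, so the sum pairs the difference of the barycentres,
  -- which is 0, with a vector. All terms are nonnegative, hence all vanish.
  have hsum : ∑ σ, C σ * ((P σ - P' σ) * (Real.log (p z.1 σ) - Real.log (p z.2 σ))) = 0 := by
    have e : ∀ σ, C σ * ((P σ - P' σ) * (Real.log (p z.1 σ) - Real.log (p z.2 σ))) =
        ∑ i, (C σ * P σ * w σ i - C σ * P' σ * w σ i) * (φ z.1 i - φ z.2 i) := fun σ => by
      rw [(hz1 σ).2, (hz2 σ).2, ← Finset.sum_sub_distrib, Finset.mul_sum, Finset.mul_sum]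
      exact Finset.sum_congr rfl fun i _ => by ring
    simp only [e]
    rw [Finset.sum_comm]
    refine Finset.sum_eq_zero fun i _ => ?_
    rw [← Finset.sum_mul, Finset.sum_sub_distrib, hw, sub_self, zero_mul]
  have hnn : ∀ σ, 0 ≤ C σ * ((P σ - P' σ) * (Real.log (p z.1 σ) - Real.log (p z.2 σ))) := by
    intro σ
    by_cases hσ : C σ = 0
    · rw [hσ, zero_mul]
    · by_cases h : P σ = P' σ
      · rw [h, sub_self, zero_mul, mul_zero]
      · exact mul_nonneg (hC σ) (hz σ ⟨(hz1 σ).1, (hz2 σ).1⟩ hσ h).le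
  have := (Finset.sum_eq_zero_iff_of_nonneg fun σ _ => hnn σ).1 hsum τ (Finset.mem_univ τ)
  exact (mul_pos (lt_of_le_of_ne (hC τ) hτ.symm)
    (hz τ ⟨(hz1 τ).1, (hz2 τ).1⟩ hτ hne)).ne' this

namespace Splitting

variable {𝔤 : Type*} [LieRing 𝔤] [LieAlgebra ℝ 𝔤] [FiniteDimensional ℝ 𝔤]
  {𝔥 : Submodule ℝ 𝔤} {d : ℕ} {S : Splitting 𝔥 d} {g₁ Q : LinearMap.BilinForm ℝ 𝔤}
  {Γ : Set (𝔤 →ₗ[ℝ] 𝔤)}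
  (M : S.IsReductiveModel g₁ Q Γ) {ι : Type*} [Fintype ι] (F : S.Frame g₁ ι)

/-- The factor by which the coefficients of `ℓ_θ` and `ℓ₀` differ. -/
def Frame.factor (θ : ℝ) : (ι × ι × ι) ⊕ ι → ℝ
  | .inl _ => 1 + θ
  | .inr _ => 1 - θ

lemma Frame.coeff_eq (θ : ℝ) (τ : (ι × ι × ι) ⊕ ι) :
    F.coeff θ τ = Frame.factor θ τ * F.coeff 0 τ := by
  rcases τ with ⟨α, β, γ⟩ | α <;> simp only [coeff, factor] <;> ring

lemma Frame.factor_pos {θ : ℝ} (hθ : |θ| < 1) (τ : (ι × ι × ι) ⊕ ι) : 0 < Frame.factor θ τ := by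
  have := abs_lt.1 hθ
  rcases τ with ⟨α, β, γ⟩ | α <;> simp only [factor] <;> linarith

lemma Frame.coeff_ne_zero_iff {θ : ℝ} (hθ : |θ| < 1) (τ : (ι × ι × ι) ⊕ ι) :
    F.coeff θ τ ≠ 0 ↔ F.coeff 0 τ ≠ 0 := by
  rw [F.coeff_eq, mul_ne_zero_iff]
  exact ⟨fun h => h.2, fun h => ⟨(Frame.factor_pos hθ τ).ne', h⟩⟩

include M

lemma ell_pos {θ : ℝ} (hθ : |θ| < 1) (hF : ∃ τ, F.coeff 0 τ ≠ 0) {s : Fin d → ℝ}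
    (hs : ∀ i, 0 < s i) : 0 < S.ell θ (S.metric g₁ s) := by
  rw [ell_eq M F θ hs]
  obtain ⟨τ, hτ⟩ := hF
  refine Finset.sum_pos' (fun τ _ => mul_nonneg (F.coeff_nonneg M hθ τ) (F.monom_pos hs τ).le)
    ⟨τ, Finset.mem_univ τ, mul_pos ?_ (F.monom_pos hs τ)⟩
  exact lt_of_le_of_ne (F.coeff_nonneg M hθ τ) ((F.coeff_ne_zero_iff hθ τ).2 hτ).symm

lemma sum_coeff_mul_div_ell {θ : ℝ} (hθ : |θ| < 1) (hF : ∃ τ, F.coeff 0 τ ≠ 0) {s : Fin d → ℝ}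
    (hs : ∀ i, 0 < s i) : ∑ τ, F.coeff θ τ * (F.monom s τ / S.ell θ (S.metric g₁ s)) = 1 := by
  simp only [← mul_div_assoc]
  rw [← Finset.sum_div, ← ell_eq M F θ hs, div_self (ell_pos M F hθ hF hs).ne']

/-- The terms of ℓ_θ divided by ℓ_θ are nonnegative with sum 1, so each relevant quotient stays in a
compact interval. Where the coefficient is zero nothing is claimed and P is 0. -/
lemma exists_tendsto_monom_div_ell {θ : ℝ} (hθ : |θ| < 1) (hF : ∃ τ, F.coeff 0 τ ≠ 0)
    (𝒰 : Ultrafilter (Fin d → ℝ)) (h𝒰 : ∀ᶠ s in (𝒰 : Filter (Fin d → ℝ)), ∀ i, 0 < s i) :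
    ∃ P : (ι × ι × ι) ⊕ ι → ℝ, (∀ τ, 0 ≤ P τ) ∧ ∀ τ, F.coeff 0 τ ≠ 0 →
      Filter.Tendsto (fun s => F.monom s τ / S.ell θ (S.metric g₁ s)) 𝒰 (𝓝 (P τ)) := by
  have key : ∀ τ, ∃ P : ℝ, 0 ≤ P ∧ (F.coeff 0 τ ≠ 0 →
      Filter.Tendsto (fun s => F.monom s τ / S.ell θ (S.metric g₁ s)) 𝒰 (𝓝 P)) := by
    intro τ
    by_cases hτ : F.coeff 0 τ = 0
    · exact ⟨0, le_rfl, fun h => absurd hτ h⟩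
    have hpos : 0 < F.coeff θ τ :=
      lt_of_le_of_ne (F.coeff_nonneg M hθ τ) ((F.coeff_ne_zero_iff hθ τ).2 hτ).symm
    have hmem : ∀ᶠ s in (𝒰 : Filter (Fin d → ℝ)),
        F.monom s τ / S.ell θ (S.metric g₁ s) ∈ Set.Icc 0 (1 / F.coeff θ τ) := by
      filter_upwards [h𝒰] with s hs
      have hnn : ∀ σ, 0 ≤ F.coeff θ σ * (F.monom s σ / S.ell θ (S.metric g₁ s)) := fun σ =>
        mul_nonneg (F.coeff_nonneg M hθ σ)
          (div_pos (F.monom_pos hs σ) (ell_pos M F hθ hF hs)).le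
      refine ⟨(div_pos (F.monom_pos hs τ) (ell_pos M F hθ hF hs)).le, ?_⟩
      rw [le_div_iff₀ hpos, mul_comm, ← sum_coeff_mul_div_ell M F hθ hF hs]
      exact Finset.single_le_sum (fun σ _ => hnn σ) (Finset.mem_univ τ)
    obtain ⟨P, hP, hlim⟩ := isCompact_Icc.ultrafilter_le_nhds
      (𝒰.map fun s => F.monom s τ / S.ell θ (S.metric g₁ s)) (by
        rw [Ultrafilter.coe_map, Filter.le_principal_iff]; exact hmem)
    exact ⟨P, hP.1, fun _ => hlim⟩
  choose P hP using key
  exact ⟨P, fun τ => (hP τ).1, fun τ => (hP τ).2⟩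

section Limits

variable {θ : ℝ} {l : Filter (Fin d → ℝ)} {P : (ι × ι × ι) ⊕ ι → ℝ}

lemma tendsto_sum_monom_div_ell {c : (ι × ι × ι) ⊕ ι → ℝ} (hc : ∀ τ, F.coeff 0 τ = 0 → c τ = 0)
    (hP : ∀ τ, F.coeff 0 τ ≠ 0 →
      Filter.Tendsto (fun s => F.monom s τ / S.ell θ (S.metric g₁ s)) l (𝓝 (P τ))) :
    Filter.Tendsto (fun s => ∑ τ, c τ * (F.monom s τ / S.ell θ (S.metric g₁ s))) l
      (𝓝 (∑ τ, c τ * P τ)) := by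
  refine tendsto_finsetSum _ fun τ _ => ?_
  by_cases hτ : F.coeff 0 τ = 0
  · simp only [hc τ hτ, zero_mul]; exact tendsto_const_nhds
  · exact (hP τ hτ).const_mul _

lemma sum_coeff_limit_eq_one [l.NeBot] (hθ : |θ| < 1) (hF : ∃ τ, F.coeff 0 τ ≠ 0)
    (hl : ∀ᶠ s in l, ∀ i, 0 < s i)
    (hP : ∀ τ, F.coeff 0 τ ≠ 0 →
      Filter.Tendsto (fun s => F.monom s τ / S.ell θ (S.metric g₁ s)) l (𝓝 (P τ))) :
    ∑ τ, F.coeff θ τ * P τ = 1 := by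
  refine tendsto_nhds_unique (tendsto_sum_monom_div_ell M F
    (fun τ hτ => by rw [F.coeff_eq, hτ, mul_zero]) hP) ?_
  refine tendsto_const_nhds.congr' ?_
  filter_upwards [hl] with s hs
  exact (sum_coeff_mul_div_ell M F hθ hF hs).symm

lemma tendsto_ell_div_ell (θ' : ℝ) (hl : ∀ᶠ s in l, ∀ i, 0 < s i)
    (hP : ∀ τ, F.coeff 0 τ ≠ 0 →
      Filter.Tendsto (fun s => F.monom s τ / S.ell θ (S.metric g₁ s)) l (𝓝 (P τ))) :
    Filter.Tendsto (fun s => S.ell θ' (S.metric g₁ s) / S.ell θ (S.metric g₁ s)) l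
      (𝓝 (∑ τ, F.coeff θ' τ * P τ)) := by
  refine (tendsto_sum_monom_div_ell M F (c := F.coeff θ')
    (fun τ hτ => by rw [F.coeff_eq, hτ, mul_zero]) hP).congr' ?_
  filter_upwards [hl] with s hs
  rw [ell_eq M F θ' hs, Finset.sum_div]
  exact Finset.sum_congr rfl fun τ _ => (mul_div_assoc _ _ _).symm

lemma tendsto_moment (hl : ∀ᶠ s in l, ∀ i, 0 < s i)
    (hP : ∀ τ, F.coeff 0 τ ≠ 0 →
      Filter.Tendsto (fun s => F.monom s τ / S.ell θ (S.metric g₁ s)) l (𝓝 (P τ))) (i : Fin d) :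
    Filter.Tendsto (fun s => S.moment θ (S.metric g₁ s) i) l
      (𝓝 (∑ τ, F.coeff θ τ * P τ * F.wt τ i)) := by
  have := tendsto_sum_monom_div_ell M F (c := fun τ => F.coeff θ τ * F.wt τ i)
    (fun τ hτ => by rw [F.coeff_eq, hτ, mul_zero, zero_mul]) hP
  refine (this.congr' ?_).trans_eq ?_
  · filter_upwards [hl] with s hs
    rw [moment_eq M F θ hs, ← ell_eq M F θ hs, Finset.sum_div]
    exact Finset.sum_congr rfl fun τ _ => by ring
  · congr 1
    exact Finset.sum_congr rfl fun τ _ => by ring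

/-- The limits of the monomials are determined by the limit of the moment map. -/
lemma limit_unique [l.NeBot] {l' : Filter (Fin d → ℝ)} [l'.NeBot] {P' : (ι × ι × ι) ⊕ ι → ℝ}
    (hθ : |θ| < 1) (hF : ∃ τ, F.coeff 0 τ ≠ 0)
    (hl : ∀ᶠ s in l, ∀ i, 0 < s i) (hl' : ∀ᶠ s in l', ∀ i, 0 < s i)
    (hP : ∀ τ, F.coeff 0 τ ≠ 0 →
      Filter.Tendsto (fun s => F.monom s τ / S.ell θ (S.metric g₁ s)) l (𝓝 (P τ)))
    (hP' : ∀ τ, F.coeff 0 τ ≠ 0 →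
      Filter.Tendsto (fun s => F.monom s τ / S.ell θ (S.metric g₁ s)) l' (𝓝 (P' τ)))
    (hw : ∀ i, ∑ τ, F.coeff θ τ * P τ * F.wt τ i = ∑ τ, F.coeff θ τ * P' τ * F.wt τ i)
    {τ : (ι × ι × ι) ⊕ ι} (hτ : F.coeff 0 τ ≠ 0) : P τ = P' τ := by
  -- Because every exponent has coordinate sum 1, log ℓ_θ can be subtracted from each coordinate,
  -- and the logarithm stays linear in the exponent.
  have key : ∀ s : Fin d → ℝ, (∀ i, 0 < s i) → ∀ τ,
      0 < F.monom s τ / S.ell θ (S.metric g₁ s) ∧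
      Real.log (F.monom s τ / S.ell θ (S.metric g₁ s)) =
        ∑ i, F.wt τ i * (-Real.log (s i) - Real.log (S.ell θ (S.metric g₁ s))) := fun s hs τ => by
    have hpos := ell_pos M F hθ hF hs
    refine ⟨div_pos (F.monom_pos hs τ) hpos, ?_⟩
    rw [Real.log_div (F.monom_pos hs τ).ne' hpos.ne', F.log_monom hs]
    simp only [mul_sub, mul_neg, Finset.sum_sub_distrib, Finset.sum_neg_distrib, ← Finset.sum_mul,
      F.sum_wt, one_mul]
  exact toric_unique (F.coeff_nonneg M hθ) (hl.mono key) (hl'.mono key)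
    (fun τ h => hP τ ((F.coeff_ne_zero_iff hθ τ).1 h))
    (fun τ h => hP' τ ((F.coeff_ne_zero_iff hθ τ).1 h)) hw ((F.coeff_ne_zero_iff hθ τ).2 hτ)

end Limits

end Splitting

/-! ### Limits of operators; the rescaled brackets. -/

section JointLimit

variable {V : Type*} [AddCommGroup V] [Module ℝ V] [FiniteDimensional ℝ V]
  [TopologicalSpace V] [IsTopologicalAddGroup V] [ContinuousSMul ℝ V] [T2Space V]
  {X : Type*} {l : Filter X}

lemma tendsto_linearMap_apply {W : Type*} [AddCommGroup W] [Module ℝ W] [TopologicalSpace W]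
    [IsTopologicalAddGroup W] [ContinuousSMul ℝ W] {f : X → V →ₗ[ℝ] W} {g : V →ₗ[ℝ] W}
    (hf : ∀ Y, Filter.Tendsto (fun s => f s Y) l (𝓝 (g Y))) {y : X → V} {Y : V}
    (hy : Filter.Tendsto y l (𝓝 Y)) : Filter.Tendsto (fun s => f s (y s)) l (𝓝 (g Y)) := by
  set v := Module.finBasis ℝ V
  have e : ∀ (h : V →ₗ[ℝ] W) (Z : V), h Z = ∑ i, v.coord i Z • h (v i) := fun h Z => by
    conv_lhs => rw [← v.sum_repr Z]
    simp only [map_sum, map_smul, Module.Basis.coord_apply]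
  rw [e g Y]
  simp only [fun s => e (f s) (y s)]
  refine tendsto_finsetSum _ fun i _ => ?_
  exact (((v.coord i).continuous_of_finiteDimensional.tendsto Y).comp hy).smul (hf _)

lemma tendsto_trace {f : X → Module.End ℝ V} {g : Module.End ℝ V}
    (hf : ∀ Y, Filter.Tendsto (fun s => f s Y) l (𝓝 (g Y))) :
    Filter.Tendsto (fun s => LinearMap.trace ℝ V (f s)) l (𝓝 (LinearMap.trace ℝ V g)) := by
  set v := Module.finBasis ℝ V
  have e : ∀ h : Module.End ℝ V, LinearMap.trace ℝ V h = ∑ i, v.coord i (h (v i)) := fun h => by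
    rw [LinearMap.trace_eq_matrix_trace ℝ v, Matrix.trace]
    exact Finset.sum_congr rfl fun i _ => by
      rw [Matrix.diag_apply, LinearMap.toMatrix_apply, Module.Basis.coord_apply]
  simp only [e]
  refine tendsto_finsetSum _ fun i _ => ?_
  exact ((v.coord i).continuous_of_finiteDimensional.tendsto _).comp (hf _)

end JointLimit

namespace Splitting

variable {𝔤 : Type*} [LieRing 𝔤] [LieAlgebra ℝ 𝔤] [FiniteDimensional ℝ 𝔤]
  {𝔥 : Submodule ℝ 𝔤} {d : ℕ} {S : Splitting 𝔥 d} {g₁ Q : LinearMap.BilinForm ℝ 𝔤}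
  {Γ : Set (𝔤 →ₗ[ℝ] 𝔤)}
  (M : S.IsReductiveModel g₁ Q Γ) {ι : Type*} [Fintype ι] (F : S.Frame g₁ ι)

lemma interiorBracket_apply (s : Fin d → ℝ) (X Y : 𝔤) : S.interiorBracket g₁ s X Y =
    S.T (S.scaling g₁ s) ⁅S.T (S.scaling g₁ s)⁻¹ X, S.T (S.scaling g₁ s)⁻¹ Y⁆ := rfl

lemma interiorBracket_swap (s : Fin d → ℝ) (X Y : 𝔤) :
    S.interiorBracket g₁ s X Y = -S.interiorBracket g₁ s Y X := by
  rw [interiorBracket_apply, interiorBracket_apply, ← lie_skew, map_neg]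

lemma interiorBracket_comp (s : Fin d → ℝ) {i j : Fin d} {X Y : 𝔤} (hX : X ∈ S.comp i)
    (hY : Y ∈ S.comp j) : S.interiorBracket g₁ s X Y =
      ((S.scaling g₁ s i)⁻¹ * (S.scaling g₁ s j)⁻¹) • S.projH ⁅X, Y⁆ +
        ∑ k, (S.scaling g₁ s k / (S.scaling g₁ s i * S.scaling g₁ s j)) • S.proj k ⁅X, Y⁆ := by
  rw [interiorBracket_apply, S.T_of_mem_comp _ hX, S.T_of_mem_comp _ hY, smul_lie, lie_smul,
    smul_smul, map_smul, T_apply, smul_add, Finset.smul_sum]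
  simp only [Pi.inv_apply, smul_smul]
  congr 1
  refine Finset.sum_congr rfl fun k _ => ?_
  congr 1
  rw [div_eq_mul_inv, mul_inv, mul_comm]

include M

lemma interiorBracket_of_mem_𝔥 {s : Fin d → ℝ} (hs : ∀ i, S.scaling g₁ s i ≠ 0) {X : 𝔤}
    (hX : X ∈ 𝔥) (Y : 𝔤) : S.interiorBracket g₁ s X Y = ⁅X, Y⁆ := by
  rw [interiorBracket_apply, S.T_of_mem_𝔥 _ hX]
  induction Y using S.induction with
  | h𝔥 Y hY => rw [S.T_of_mem_𝔥 _ hY, S.T_of_mem_𝔥 _ (M.lie_𝔥 X hX Y hY)]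
  | hcomp i Y hY =>
    rw [S.T_of_mem_comp _ hY, lie_smul, map_smul, S.T_of_mem_comp _ (M.lie_comp i X hX Y hY),
      smul_smul, Pi.inv_apply, inv_mul_cancel₀ (hs i), one_smul]
  | hadd Y Z h h' => simp only [map_add, lie_add, h, h']

lemma apply_interiorBracket (s : Fin d → ℝ) (α β γ : ι) :
    g₁ (S.interiorBracket g₁ s (F.vec α) (F.vec β)) (F.vec γ) =
      S.scaling g₁ s (F.idx γ) / (S.scaling g₁ s (F.idx α) * S.scaling g₁ s (F.idx β)) *
        F.structConst α β γ := by
  rw [interiorBracket_comp s (F.mem α) (F.mem β), map_add, LinearMap.add_apply, map_smul,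
    LinearMap.smul_apply, M.metric.kernel _ (S.projH_mem _), smul_zero, zero_add, map_sum,
    LinearMap.sum_apply, Finset.sum_eq_single (F.idx γ)]
  · rw [map_smul, LinearMap.smul_apply, smul_eq_mul, M.metric.symm,
      apply_proj_right M.metric M.orthogonal (F.mem γ), M.metric.symm]
    rfl
  · intro k _ hk
    rw [map_smul, LinearMap.smul_apply, M.orthogonal k _ hk _ (S.proj_mem k _) _ (F.mem γ),
      smul_zero]
  · simp

lemma ell_zero_pos (hF : ∃ τ, F.coeff 0 τ ≠ 0) : 0 < S.ell 0 g₁ := by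
  have := ell_pos M F (θ := 0) (by simp) hF (s := fun _ => 1) fun _ => one_pos
  rwa [metric_one M.metric M.orthogonal] at this

lemma scaling_pos (hF : ∃ τ, F.coeff 0 τ ≠ 0) {s : Fin d → ℝ} (hs : ∀ i, 0 < s i) (i : Fin d) :
    0 < S.scaling g₁ s i :=
  Real.sqrt_pos.2 (div_pos (mul_pos (ell_pos M F (by simp) hF hs) (hs i)) (ell_zero_pos M F hF))

lemma scaling_sq (hF : ∃ τ, F.coeff 0 τ ≠ 0) {s : Fin d → ℝ} (hs : ∀ i, 0 < s i) (i : Fin d) :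
    S.scaling g₁ s i ^ 2 = S.ell 0 (S.metric g₁ s) * s i / S.ell 0 g₁ :=
  Real.sq_sqrt (div_pos (mul_pos (ell_pos M F (by simp) hF hs) (hs i)) (ell_zero_pos M F hF)).le

/-- The normalization ℓ₀(g) s = ℓ₀(g₁) a² is chosen so that squared bracket coefficients become
constant multiples of monomials over ℓ₀. This links the convergence of brackets to that of
monomials. -/
lemma scaling_ratio_sq (hF : ∃ τ, F.coeff 0 τ ≠ 0) {s : Fin d → ℝ} (hs : ∀ i, 0 < s i)
    (α β γ : ι) :
    (S.scaling g₁ s (F.idx γ) / (S.scaling g₁ s (F.idx α) * S.scaling g₁ s (F.idx β))) ^ 2 =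
      S.ell 0 g₁ * (F.monom s (.inl (α, β, γ)) / S.ell 0 (S.metric g₁ s)) := by
  rw [div_pow, mul_pow, scaling_sq M F hF hs, scaling_sq M F hF hs, scaling_sq M F hF hs]
  have h1 := (ell_pos M F (θ := 0) (by simp) hF hs).ne'
  have h2 := (ell_zero_pos M F hF).ne'
  have h3 := fun i => (hs i).ne'
  have h4 := h3 (F.idx α)
  have h5 := h3 (F.idx β)
  simp only [Frame.monom]
  field_simp

lemma scaling_inv_sq (hF : ∃ τ, F.coeff 0 τ ≠ 0) {s : Fin d → ℝ} (hs : ∀ i, 0 < s i) (α : ι) :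
    ((S.scaling g₁ s (F.idx α))⁻¹) ^ 2 =
      S.ell 0 g₁ * (F.monom s (.inr α) / S.ell 0 (S.metric g₁ s)) := by
  rw [inv_pow, scaling_sq M F hF hs]
  have h1 := (ell_pos M F (θ := 0) (by simp) hF hs).ne'
  have h2 := (ell_zero_pos M F hF).ne'
  have h3 := (hs (F.idx α)).ne'
  simp only [Frame.monom]
  field_simp

/-- The rescaled ad X is conjugate to ad(T_a⁻¹X) when a has no zero entry, so traces can be computed
in 𝔤. -/
lemma interiorBracket_eq_conj (s : Fin d → ℝ) (X : 𝔤) : S.interiorBracket g₁ s X =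
    S.T (S.scaling g₁ s) ∘ₗ LieAlgebra.ad ℝ 𝔤 (S.T (S.scaling g₁ s)⁻¹ X) ∘ₗ
      S.T (S.scaling g₁ s)⁻¹ := rfl

lemma trace_interiorBracket {s : Fin d → ℝ} (hs : ∀ i, S.scaling g₁ s i ≠ 0) (X : 𝔤) :
    LinearMap.trace ℝ 𝔤 (S.interiorBracket g₁ s X) = 0 := by
  have h : S.T (S.scaling g₁ s)⁻¹ ∘ₗ S.T (S.scaling g₁ s) = LinearMap.id := by
    ext Y; exact S.T_inv_T hs Y
  rw [interiorBracket_eq_conj M, LinearMap.trace_comp_comm', LinearMap.comp_assoc, h,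
    LinearMap.comp_id, M.trace_ad]

lemma trace_interiorBracket_sq {s : Fin d → ℝ} (hs : ∀ i, S.scaling g₁ s i ≠ 0) (X : 𝔤) :
    LinearMap.trace ℝ 𝔤 (S.interiorBracket g₁ s X ∘ₗ S.interiorBracket g₁ s X) =
      killingForm ℝ 𝔤 (S.T (S.scaling g₁ s)⁻¹ X) (S.T (S.scaling g₁ s)⁻¹ X) := by
  have h : S.T (S.scaling g₁ s)⁻¹ ∘ₗ S.T (S.scaling g₁ s) = LinearMap.id := by
    ext Y; exact S.T_inv_T hs Y
  have h2 : S.interiorBracket g₁ s X ∘ₗ S.interiorBracket g₁ s X = S.T (S.scaling g₁ s) ∘ₗ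
      ((LieAlgebra.ad ℝ 𝔤 (S.T (S.scaling g₁ s)⁻¹ X) ∘ₗ
        LieAlgebra.ad ℝ 𝔤 (S.T (S.scaling g₁ s)⁻¹ X)) ∘ₗ S.T (S.scaling g₁ s)⁻¹) := by
    ext Y
    simp only [interiorBracket_eq_conj M, LinearMap.comp_apply, S.T_inv_T hs]
  rw [h2, LinearMap.trace_comp_comm', LinearMap.comp_assoc, h, LinearMap.comp_id,
    killingForm_apply_apply]

end Splitting

/-! ### Cocycles with values in an orthogonal representation. -/

section Cocycle

variable {V W : Type*} [AddCommGroup V] [Module ℝ V] [FiniteDimensional ℝ V]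
  [AddCommGroup W] [Module ℝ W] [FiniteDimensional ℝ W]

/-- Let `v` be a surjective cocycle with values in an orthogonal representation `r`. A vector
orthogonal to the image of the kernel of `r` is invariant. -/
lemma cocycle_invariant {q : LinearMap.BilinForm ℝ W} (hsymm : ∀ X Y, q X Y = q Y X)
    (hpos : ∀ X, X ≠ 0 → 0 < q X X) (b : V →ₗ[ℝ] V →ₗ[ℝ] V) (r : V →ₗ[ℝ] Module.End ℝ W)
    (v : V →ₗ[ℝ] W) (hv : Function.Surjective v)
    (hr : ∀ P P' Y, r (b P P') Y = r P (r P' Y) - r P' (r P Y))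
    (hskew : ∀ P Y Z, q (r P Y) Z = -q Y (r P Z))
    (hcoc : ∀ P P', r P (v P') - r P' (v P) = v (b P P'))
    {w : W} (hw : ∀ A, r A = 0 → q w (v A) = 0) (P : V) : r P w = 0 := by
  -- Minus the trace form of r: invariant and positive semidefinite, with null vectors exactly the
  -- kernel of r because the operators r P are skew.
  set κ : LinearMap.BilinForm ℝ V :=
    -(((LinearMap.mul ℝ (Module.End ℝ W)).compr₂ (LinearMap.trace ℝ W)).compl₁₂ r r) with hκ
  have hκa : ∀ P P', κ P P' = -LinearMap.trace ℝ W (r P * r P') := fun P P' => rfl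
  have hκsymm : ∀ P P', κ P P' = κ P' P := fun P P' => by
    rw [hκa, hκa, LinearMap.trace_mul_comm]
  have hκnn : ∀ P, 0 ≤ κ P P := fun P => by
    rw [hκa]; exact neg_nonneg.2 (trace_sq_of_skew hsymm hpos (hskew P)).1
  have hκ0 : ∀ P, κ P P = 0 → r P = 0 := fun P h => by
    rw [hκa, neg_eq_zero] at h; exact (trace_sq_of_skew hsymm hpos (hskew P)).2 h
  have hrm : ∀ P P', r (b P P') = r P * r P' - r P' * r P := fun P P' => by
    ext Y; exact hr P P' Y
  have hκinv : ∀ P P₁ P₂, κ (b P P₁) P₂ = -κ P₁ (b P P₂) := fun P P₁ P₂ => by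
    rw [hκa, hκa, hrm, hrm, sub_mul, mul_sub, map_sub, map_sub, ← mul_assoc, ← mul_assoc,
      LinearMap.trace_mul_comm ℝ (r P₁ * r P₂) (r P), mul_assoc (r P) (r P₁), 
      mul_assoc (r P₁) (r P)]
    ring
  obtain ⟨e, he⟩ := LinearMap.BilinForm.exists_orthogonal_basis (B := κ) ⟨hκsymm⟩
  -- The convention 0⁻¹ = 0 drops the basis vectors in the kernel of r. The sum of ck i times r(e
  -- i)² is thus the Casimir operator C of the image of r.
  set ck : Fin (Module.finrank ℝ V) → ℝ := fun i => (κ (e i) (e i))⁻¹ with hc₀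
  have hcnn : ∀ i, 0 ≤ ck i := fun i => inv_nonneg.2 (hκnn _)
  -- linear maps vanishing on the kernel of `r`
  have hexp : ∀ {X : Type _} [AddCommGroup X] [Module ℝ X] (f : V →ₗ[ℝ] X),
      (∀ A, r A = 0 → f A = 0) → ∀ P, f P = ∑ i, (ck i * κ (e i) P) • f (e i) := by
    intro X _ _ f hf P
    have hcoef : ∀ i, κ (e i) P = e.repr P i * κ (e i) (e i) := fun i => by
      conv_lhs => rw [← e.sum_repr P]
      rw [map_sum, Finset.sum_eq_single i]
      · rw [map_smul, smul_eq_mul]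
      · intro j _ hj
        rw [map_smul, show κ (e i) (e j) = 0 from he hj.symm, smul_zero]
      · simp
    conv_lhs => rw [← e.sum_repr P]
    rw [map_sum]
    refine Finset.sum_congr rfl fun i _ => ?_
    rw [map_smul, hcoef]
    by_cases h : κ (e i) (e i) = 0
    · rw [hf _ (hκ0 _ h), smul_zero, smul_zero]
    · congr 1
      simp only [hc₀]
      field_simp
  have hinv : ∀ Y, ∑ i, ck i • r (e i) (r (e i) Y) = 0 → ∀ P, r P Y = 0 := by
    intro Y hY
    have hqnn : ∀ Z, 0 ≤ q Z Z := fun Z => by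
      by_cases h : Z = 0
      · simp [h]
      · exact (hpos Z h).le
    have h1 : ∑ i, ck i * q (r (e i) Y) (r (e i) Y) = 0 := by
      have := congrArg (fun Z => q Z Y) hY
      simp only [map_sum, map_smul, LinearMap.sum_apply, LinearMap.smul_apply, smul_eq_mul,
        hskew _ (r (e _) Y), mul_neg, Finset.sum_neg_distrib, map_zero, LinearMap.zero_apply,
        neg_eq_zero] at this
      exact this
    rw [Finset.sum_eq_zero_iff_of_nonneg fun i _ => mul_nonneg (hcnn i) (hqnn _)] at h1
    have h2 : ∀ i, r (e i) Y = 0 := fun i => by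
      by_cases h : κ (e i) (e i) = 0
      · rw [hκ0 _ h, LinearMap.zero_apply]
      · by_contra hne
        exact (hpos _ hne).ne' ((mul_eq_zero.1 (h1 i (Finset.mem_univ i))).resolve_left
          (inv_ne_zero h))
    intro P
    exact LinearMap.congr_fun (e.ext h2 : r.flip Y = 0) P
  -- the orthogonal projection
  set U : Submodule ℝ W := (LinearMap.ker r).map v with hU
  have hrefl : LinearMap.BilinForm.IsRefl q := fun X Y h => by rw [hsymm]; exact h
  have hc : IsCompl U (q.orthogonal U) := by
    refine LinearMap.BilinForm.isCompl_orthogonal_of_restrict_nondegenerate hrefl ?_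
    have hrefl' : LinearMap.IsRefl (q.restrict U) := fun X Y h => hrefl _ _ h
    refine (LinearMap.IsRefl.nondegenerate_iff_separatingLeft hrefl').2 fun X hX => ?_
    by_contra hne
    exact (hpos X (by simpa using hne)).ne' (hX X)
  have hmem : ∀ Y, Y ∈ q.orthogonal U ↔ ∀ Z ∈ U, q Z Y = 0 := fun Y =>
    LinearMap.BilinForm.mem_orthogonal_iff
  have hrU : ∀ P, ∀ Y ∈ U, r P Y ∈ U := by
    rintro P _ ⟨A, hA, rfl⟩
    have hA' : r A = 0 := hA
    refine ⟨b P A, ?_, ?_⟩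
    · change r (b P A) = 0
      rw [hrm, hA']; simp
    · rw [← hcoc, hA', LinearMap.zero_apply, sub_zero]
  have hrU' : ∀ P, ∀ Y ∈ q.orthogonal U, r P Y ∈ q.orthogonal U := by
    intro P Y hY
    rw [hmem] at hY ⊢
    intro Z hZ
    have := hskew P Z Y
    rw [hY _ (hrU P Z hZ)] at this
    linarith
  set π := (q.orthogonal U).projection U hc.symm with hπ
  have hπmem : ∀ Y, π Y ∈ q.orthogonal U := fun Y => Submodule.projection_apply_mem hc.symm Y
  have hπself : ∀ Y ∈ q.orthogonal U, π Y = Y := fun Y hY =>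
    (Submodule.projection_eq_self_iff hc.symm Y).2 hY
  have hπ0 : ∀ Y ∈ U, π Y = 0 := fun Y hY =>
    (Submodule.projection_apply_eq_zero_iff hc.symm).2 hY
  have hπr : ∀ P Y, π (r P Y) = r P (π Y) := fun P Y => by
    have h1 : Y - π Y ∈ U := by
      refine (Submodule.projection_apply_eq_zero_iff hc.symm).1 ?_
      rw [map_sub]
      exact sub_eq_zero.2 (hπself _ (hπmem Y)).symm
    have h2 := hπ0 _ (hrU P _ h1)
    rw [map_sub, map_sub, hπself _ (hrU' P _ (hπmem Y))] at h2
    exact sub_eq_zero.1 h2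
  -- Projecting away the image U of the kernel gives a cocycle that vanishes on the kernel, hence
  -- can be expanded in the κ-orthogonal basis.
  set f : V →ₗ[ℝ] W := π ∘ₗ v with hf
  have hf0 : ∀ A, r A = 0 → f A = 0 := fun A hA => hπ0 _ ⟨A, hA, rfl⟩
  have hfc : ∀ P P', r P (f P') - r P' (f P) = f (b P P') := fun P P' => by
    simp only [hf, LinearMap.comp_apply]
    rw [← hcoc, map_sub, hπr, hπr]
  have hfs : ∀ Y ∈ q.orthogonal U, ∃ P, f P = Y := fun Y hY => by
    obtain ⟨P, rfl⟩ := hv Y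
    exact ⟨P, hπself _ hY⟩
  set u : W := ∑ i, ck i • r (e i) (f (e i)) with hu
  have humem : u ∈ q.orthogonal U := Submodule.sum_mem _ fun i _ =>
    Submodule.smul_mem _ _ (hrU' _ _ (hπmem _))
  -- That is, r(P)u = C f(P): commuting r(P) past r(e i) produces corrections that cancel because ad
  -- P is skew for κ.
  have key : ∀ P, r P u = ∑ i, ck i • r (e i) (r (e i) (f P)) := by
    intro P
    set m : Fin (Module.finrank ℝ V) → Fin (Module.finrank ℝ V) → ℝ :=
      fun j i => κ (e j) (b P (e i)) with hm
    have hanti : ∀ i j, m i j = -m j i := fun i j => by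
      simp only [hm]
      rw [hκsymm (e i), hκinv]
    have hterm : ∀ i, r P (r (e i) (f (e i))) = r (e i) (r (e i) (f P)) +
        (∑ j, (ck j * m j i) • r (e i) (f (e j)) + ∑ j, (ck j * m j i) • r (e j) (f (e i))) := by
      intro i
      have h1 := hr P (e i) (f (e i))
      have h2 := hfc P (e i)
      have h3 : r (e i) (f (b P (e i))) = ∑ j, (ck j * m j i) • r (e i) (f (e j)) := by
        rw [hexp f hf0 (b P (e i)), map_sum]
        exact Finset.sum_congr rfl fun j _ => by rw [map_smul]
      have h4 : r (b P (e i)) (f (e i)) = ∑ j, (ck j * m j i) • r (e j) (f (e i)) := by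
        rw [hexp r (fun _ h => h) (b P (e i)), LinearMap.sum_apply]
        exact Finset.sum_congr rfl fun j _ => by rw [LinearMap.smul_apply]
      rw [← h3, ← h4, h1, ← h2, map_sub]
      abel
    have hz : ∑ i, ck i • ∑ j, (ck j * m j i) • r (e i) (f (e j)) +
        ∑ i, ck i • ∑ j, (ck j * m j i) • r (e j) (f (e i)) = 0 := by
      simp only [Finset.smul_sum, smul_smul]
      rw [Finset.sum_comm, ← Finset.sum_add_distrib]
      refine Finset.sum_eq_zero fun i _ => ?_
      rw [← Finset.sum_add_distrib]
      refine Finset.sum_eq_zero fun j _ => ?_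
      rw [← add_smul, hanti i j]
      convert zero_smul ℝ _ using 2
      ring
    simp only [hu, map_sum, map_smul, hterm, smul_add, Finset.sum_add_distrib]
    rw [hz, add_zero]
  have hCsymm : ∀ Y Z, q (∑ i, ck i • r (e i) (r (e i) Y)) Z =
      q Y (∑ i, ck i • r (e i) (r (e i) Z)) := fun Y Z => by
    simp only [map_sum, map_smul, LinearMap.sum_apply, LinearMap.smul_apply, hskew _ (r (e _) Y),
      hskew _ Y, neg_neg]
  -- Write Cu = f(P'). Then q(Cu,Cu) = q(C f(P'),u) = q(r(P')u,u) = 0 by skewness, and Cu = 0 forces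
  -- invariance of u. Then C f = 0 as well, which settles w = f(P').
  have hu0 : ∀ P, r P u = 0 := by
    refine hinv u ?_
    obtain ⟨P', hP'⟩ := hfs (∑ i, ck i • r (e i) (r (e i) u)) (Submodule.sum_mem _ fun i _ =>
      Submodule.smul_mem _ _ (hrU' _ _ (hrU' _ _ humem)))
    by_contra hne
    refine (hpos _ hne).ne' ?_
    nth_rw 1 [← hP']
    rw [← hCsymm, ← key]
    have := hskew P' u u
    rw [hsymm u] at this
    linarith
  have hwm : w ∈ q.orthogonal U := (hmem w).2 (by
    rintro _ ⟨A, hA, rfl⟩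
    rw [hsymm]; exact hw A hA)
  obtain ⟨P', hP'⟩ := hfs w hwm
  refine hinv w ?_ P
  rw [← hP', ← key, hu0]

end Cocycle

/-! ### Flat homogeneous geometries. -/

namespace Splitting

variable {V : Type*} [AddCommGroup V] [Module ℝ V] [FiniteDimensional ℝ V]
  {𝔥 : Submodule ℝ V} {d : ℕ}

/-- The bracket `b` on `V = 𝔥 + 𝔪` and the metric `q` define a homogeneous geometry with
stability subalgebra `𝔥`. -/
structure IsGeometry (S : Splitting 𝔥 d) (b : V →ₗ[ℝ] V →ₗ[ℝ] V)
    (q : LinearMap.BilinForm ℝ V) : Prop where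
  metric : S.IsMetric q
  swap : ∀ X Y, b X Y = -b Y X
  mem_𝔥 : ∀ X ∈ 𝔥, ∀ Y ∈ 𝔥, b X Y ∈ 𝔥
  mem_𝔪 : ∀ X ∈ 𝔥, ∀ Y ∈ S.𝔪, b X Y ∈ S.𝔪
  skew : ∀ X ∈ 𝔥, ∀ Y Z, q (b X Y) Z = -q Y (b X Z)
  jacobi : ∀ X ∈ 𝔥, ∀ Y Z, b X (b Y Z) = b (b X Y) Z + b Y (b X Z)

/-- The isotropy representation of `𝔥` extended by the Nomizu operators to `𝔥 + 𝔪`. -/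
def isoRep (S : Splitting 𝔥 d) (b : V →ₗ[ℝ] V →ₗ[ℝ] V) (q : LinearMap.BilinForm ℝ V) :
    V →ₗ[ℝ] Module.End ℝ S.𝔪 :=
  S.nomizu b q ∘ₗ S.projM + (b.compl₁₂ S.projH S.𝔪.subtype).compr₂ S.projM

variable {S : Splitting 𝔥 d} {b : V →ₗ[ℝ] V →ₗ[ℝ] V} {q : LinearMap.BilinForm ℝ V}

lemma isoRep_apply (P : V) (Y : S.𝔪) :
    S.isoRep b q P Y = S.nomizu b q (S.projM P) Y + S.projM (b (S.projH P) Y) := rfl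

lemma isoRep_of_mem_𝔥 {P : V} (hP : P ∈ 𝔥) (Y : S.𝔪) : S.isoRep b q P Y = S.projM (b P Y) := by
  rw [isoRep_apply, S.projM_of_mem_𝔥 hP, map_zero, LinearMap.zero_apply, zero_add,
    S.projH_of_mem hP]

lemma isoRep_coe (X Y : S.𝔪) : S.isoRep b q X Y = S.nomizu b q X Y := by
  rw [isoRep_apply, S.projM_coe, S.projH_of_mem_𝔪 X.2, map_zero, LinearMap.zero_apply, map_zero,
    add_zero]

namespace IsGeometry

variable (hg : S.IsGeometry b q)

include hg

lemma nomizu_skew (X Y Z : S.𝔪) : q (S.nomizu b q X Y) Z = -q Y (S.nomizu b q X Z) := by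
  rw [hg.metric.symm Y, hg.metric.nomizu_apply, hg.metric.nomizu_apply, hg.swap Z Y, hg.swap Z X,
    hg.swap Y X]
  simp only [map_neg, LinearMap.neg_apply]
  ring

lemma nomizu_sub (X Y : S.𝔪) : S.nomizu b q X Y - S.nomizu b q Y X = S.projM (b X Y) := by
  refine hg.metric.eq_of_forall fun Z => ?_
  rw [Submodule.coe_sub, map_sub, LinearMap.sub_apply, hg.metric.nomizu_apply,
    hg.metric.nomizu_apply, hg.metric.projM_left, hg.swap Z Y, hg.swap Z X, hg.swap Y X]
  simp only [map_neg, LinearMap.neg_apply]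
  ring

lemma coe_projM_lie {P : V} (hP : P ∈ 𝔥) (Y : S.𝔪) : (S.projM (b P Y) : V) = b P Y := by
  rw [S.projM_of_mem (hg.mem_𝔪 P hP Y Y.2)]

/-- The Koszul expression involves only b and q; ad P is a derivation of b and skew for q. -/
lemma lie_nomizu {P : V} (hP : P ∈ 𝔥) (X Y : S.𝔪) : S.projM (b P (S.nomizu b q X Y)) =
    S.nomizu b q (S.projM (b P X)) Y + S.nomizu b q X (S.projM (b P Y)) := by
  refine hg.metric.eq_of_forall fun Z => ?_
  rw [hg.metric.projM_left, hg.skew P hP, Submodule.coe_add, map_add, LinearMap.add_apply,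
    ← hg.coe_projM_lie hP Z, hg.metric.nomizu_apply, hg.metric.nomizu_apply,
    hg.metric.nomizu_apply]
  simp only [hg.coe_projM_lie hP]
  have h1 : ∀ A B C : V, q (b (b P A) B) C + q (b A (b P B)) C + q (b A B) (b P C) = 0 := by
    intro A B C
    have h2 := hg.skew P hP (b A B) C
    rw [hg.jacobi P hP, map_add, LinearMap.add_apply] at h2
    linarith
  have e1 := h1 X Y Z
  have e2 := h1 Y Z X
  have e3 := h1 Z X Y
  linarith

lemma isoRep_skew (P : V) (Y Z : S.𝔪) : q (S.isoRep b q P Y) Z = -q Y (S.isoRep b q P Z) := by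
  rw [isoRep_apply, isoRep_apply, Submodule.coe_add, Submodule.coe_add, map_add, map_add,
    LinearMap.add_apply, hg.nomizu_skew, hg.metric.projM_left, hg.metric.projM_right,
    hg.skew _ (S.projH_mem P)]
  ring

/-- Torsion-freeness of the Levi-Civita connection, in the form of a cocycle identity for the
projection to 𝔪. -/
lemma isoRep_projM (P P' : V) : S.isoRep b q P (S.projM P') - S.isoRep b q P' (S.projM P) =
    S.projM (b P P') := by
  have key : ∀ P, P ∈ 𝔥 → ∀ P', S.isoRep b q P (S.projM P') - S.isoRep b q P' (S.projM P) =
      S.projM (b P P') := by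
    intro P hP P'
    have h0 : S.projM (b P (S.projH P')) = 0 :=
      S.projM_of_mem_𝔥 (hg.mem_𝔥 P hP _ (S.projH_mem P'))
    conv_rhs => rw [← S.projH_add_projM P', map_add, map_add, h0, zero_add]
    rw [S.projM_of_mem_𝔥 hP, map_zero, sub_zero, isoRep_of_mem_𝔥 hP]
  have hX : ∀ X : S.𝔪, ∀ P', S.isoRep b q X (S.projM P') - S.isoRep b q P' (S.projM X) =
      S.projM (b X P') := by
    intro X P'
    have h1 := key _ (S.projH_mem P') X
    have h2 := hg.nomizu_sub X (S.projM P')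
    conv_lhs => rw [← S.projH_add_projM P']
    conv_rhs => rw [← S.projH_add_projM P', map_add, hg.swap X (S.projH P'), map_add, map_neg]
    rw [← h1, ← h2]
    simp only [map_add, S.projM_coe, isoRep_coe, LinearMap.add_apply,
      S.projM_of_mem_𝔥 (S.projH_mem P'), map_zero, zero_add]
    abel
  have e1 := key _ (S.projH_mem P) P'
  have e2 := hX (S.projM P) P'
  conv_lhs => rw [← S.projH_add_projM P]
  conv_rhs => rw [← S.projH_add_projM P]
  rw [map_add, map_add, map_add, map_add, LinearMap.add_apply, LinearMap.add_apply, map_add,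
    ← e1, ← e2]
  abel

/-- On 𝔪 × 𝔪 the defect of multiplicativity is the curvature; on pairs involving 𝔥 it vanishes by
the derivation property. -/
lemma isoRep_lie (hflat : S.IsLocallyEuclidean b q) (P P' : V) (Y : S.𝔪) :
    S.isoRep b q (b P P') Y =
      S.isoRep b q P (S.isoRep b q P' Y) - S.isoRep b q P' (S.isoRep b q P Y) := by
  have hhh : ∀ P ∈ 𝔥, ∀ P' ∈ 𝔥, ∀ Y : S.𝔪, S.isoRep b q (b P P') Y =
      S.isoRep b q P (S.isoRep b q P' Y) - S.isoRep b q P' (S.isoRep b q P Y) := by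
    intro P hP P' hP' Y
    rw [isoRep_of_mem_𝔥 (hg.mem_𝔥 P hP P' hP'), isoRep_of_mem_𝔥 hP, isoRep_of_mem_𝔥 hP',
      isoRep_of_mem_𝔥 hP, isoRep_of_mem_𝔥 hP', hg.coe_projM_lie hP, hg.coe_projM_lie hP',
      hg.jacobi P hP P' Y, map_add]
    abel
  have hhm : ∀ P ∈ 𝔥, ∀ X Y : S.𝔪, S.isoRep b q (b P X) Y =
      S.isoRep b q P (S.isoRep b q X Y) - S.isoRep b q X (S.isoRep b q P Y) := by
    intro P hP X Y
    rw [← hg.coe_projM_lie hP X, isoRep_coe, isoRep_coe, isoRep_coe, isoRep_of_mem_𝔥 hP,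
      isoRep_of_mem_𝔥 hP, hg.lie_nomizu hP]
    abel
  have hmm : ∀ X X' Y : S.𝔪, S.isoRep b q (b X X') Y =
      S.isoRep b q X (S.isoRep b q X' Y) - S.isoRep b q X' (S.isoRep b q X Y) := by
    intro X X' Y
    have h1 := hflat X X' Y
    rw [riemann_apply] at h1
    rw [isoRep_apply, isoRep_coe, isoRep_coe, isoRep_coe, isoRep_coe]
    rw [sub_sub, sub_eq_zero] at h1
    exact h1.symm
  have e1 := hhh _ (S.projH_mem P) _ (S.projH_mem P') Y
  have e2 := hhm _ (S.projH_mem P) (S.projM P') Y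
  have e3 := hhm _ (S.projH_mem P') (S.projM P) Y
  have e4 := hmm (S.projM P) (S.projM P') Y
  rw [hg.swap, map_neg, LinearMap.neg_apply, neg_eq_iff_eq_neg] at e3
  conv_lhs => rw [← S.projH_add_projM P, ← S.projH_add_projM P']
  conv_rhs => rw [← S.projH_add_projM P, ← S.projH_add_projM P']
  simp only [map_add, LinearMap.add_apply, e1, e2, e3, e4]
  abel

/-- In a flat geometry, a vector orthogonal to the transvections is parallel. -/
lemma isoRep_eq_zero (hflat : S.IsLocallyEuclidean b q) {X : S.𝔪}
    (hX : ∀ A, S.isoRep b q A = 0 → q X A = 0) (P : V) : S.isoRep b q P X = 0 := by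
  refine cocycle_invariant (q := q.restrict S.𝔪) (fun X Y => hg.metric.symm _ _)
    (fun X hX => hg.metric.pos _ X.2 (by simpa using hX)) b (S.isoRep b q) S.projM
    (fun X => ⟨X, S.projM_coe X⟩) (hg.isoRep_lie hflat) hg.isoRep_skew hg.isoRep_projM
    (fun A hA => ?_) P
  have := hX A hA
  rw [← hg.metric.projM_right] at this
  exact this

/-- In a flat geometry with an effective action, `(ad A)² = 0` for a transvection `A`. -/
lemma lie_lie_eq_zero (hflat : S.IsLocallyEuclidean b q)
    (heff : ∀ X ∈ 𝔥, (∀ Y ∈ S.𝔪, b X Y = 0) → X = 0) {A : V} (hA : S.isoRep b q A = 0) (Z : V) :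
    b A (b A Z) = 0 := by
  have hideal : ∀ Z, S.isoRep b q (b A Z) = 0 := fun Z => by
    ext1 Y
    -- The kernel of `isoRep` is stable under b A. The cocycle identity then puts b A (b A Z) in 𝔥,
    -- where acting trivially on 𝔪 means being zero.
    rw [hg.isoRep_lie hflat, hA]; simp
  have hmem : b A (b A Z) ∈ 𝔥 := by
    have h1 := hg.isoRep_projM A (b A Z)
    rw [hA, hideal, LinearMap.zero_apply, LinearMap.zero_apply, sub_zero] at h1
    have h2 := S.projH_add_projM (b A (b A Z))
    rw [← h1, ZeroMemClass.coe_zero, add_zero] at h2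
    rw [← h2]; exact S.projH_mem _
  refine heff _ hmem fun Y hY => ?_
  have h1 : S.isoRep b q (b A (b A Z)) ⟨Y, hY⟩ = 0 := by rw [hideal, LinearMap.zero_apply]
  rw [isoRep_of_mem_𝔥 hmem] at h1
  rw [← hg.coe_projM_lie hmem ⟨Y, hY⟩, h1, ZeroMemClass.coe_zero]

end IsGeometry

end Splitting

/-! ### Limits of the rescaled brackets. -/

namespace Splitting

variable {𝔤 : Type*} [LieRing 𝔤] [LieAlgebra ℝ 𝔤] [FiniteDimensional ℝ 𝔤]
  {𝔥 : Submodule ℝ 𝔤} {d : ℕ} {S : Splitting 𝔥 d} {g₁ Q : LinearMap.BilinForm ℝ 𝔤}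
  {Γ : Set (𝔤 →ₗ[ℝ] 𝔤)}
  (M : S.IsReductiveModel g₁ Q Γ) {ι : Type*} [Fintype ι] (F : S.Frame g₁ ι)

lemma IsLocallyEuclidean.ricci_eq_zero {V : Type*} [AddCommGroup V] [Module ℝ V]
    [FiniteDimensional ℝ V] {𝔥 : Submodule ℝ V} {S : Splitting 𝔥 d} {b : V →ₗ[ℝ] V →ₗ[ℝ] V}
    {q : LinearMap.BilinForm ℝ V} (h : S.IsLocallyEuclidean b q) (Y Z : S.𝔪) :
    S.ricci b q Y Z = 0 := by
  have : ((S.riemann b q).flip Y).flip Z = 0 := by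
    refine LinearMap.ext fun X => ?_
    rw [LinearMap.flip_apply, LinearMap.flip_apply, h, LinearMap.zero_apply]
  rw [ricci_apply, this, map_zero]

section Equivariance

lemma map_T_of_map_proj {A : 𝔤 →ₗ[ℝ] 𝔤} (h𝔥 : ∀ X ∈ 𝔥, A X ∈ 𝔥)
    (hc : ∀ i, ∀ X ∈ S.comp i, A X ∈ S.comp i) (a : Fin d → ℝ) (X : 𝔤) :
    S.T a (A X) = A (S.T a X) := by
  induction X using S.induction with
  | h𝔥 X hX => rw [S.T_of_mem_𝔥 _ hX, S.T_of_mem_𝔥 _ (h𝔥 X hX)]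
  | hcomp i X hX => rw [S.T_of_mem_comp _ hX, S.T_of_mem_comp _ (hc i X hX), map_smul]
  | hadd X Y h h' => simp only [map_add, h, h']

include M

lemma T_lie {X : 𝔤} (hX : X ∈ 𝔥) (a : Fin d → ℝ) (Y : 𝔤) : S.T a ⁅X, Y⁆ = ⁅X, S.T a Y⁆ :=
  map_T_of_map_proj (A := LieAlgebra.ad ℝ 𝔤 X) (M.lie_𝔥 X hX) (fun i => M.lie_comp i X hX) a Y

lemma lie_interiorBracket {X : 𝔤} (hX : X ∈ 𝔥) (s : Fin d → ℝ) (Y Z : 𝔤) :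
    ⁅X, S.interiorBracket g₁ s Y Z⁆ =
      S.interiorBracket g₁ s ⁅X, Y⁆ Z + S.interiorBracket g₁ s Y ⁅X, Z⁆ := by
  simp only [interiorBracket_apply, T_lie M hX]
  rw [← T_lie M hX, leibniz_lie, map_add]

lemma map_interiorBracket {A : 𝔤 →ₗ[ℝ] 𝔤} (hA : A ∈ Γ) (s : Fin d → ℝ) (Y Z : 𝔤) :
    S.interiorBracket g₁ s (A Y) (A Z) = A (S.interiorBracket g₁ s Y Z) := by
  have hT := fun a X => map_T_of_map_proj (S := S) (M.map_𝔥 A hA)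
    (fun i => M.map_comp i A hA) a X
  simp only [interiorBracket_apply]
  rw [hT, hT, ← M.map_lie A hA, hT]

end Equivariance

section Scaling

variable {l : Filter (Fin d → ℝ)} {P : (ι × ι × ι) ⊕ ι → ℝ}

include M

lemma tendsto_scaling_inv (hF : ∃ τ, F.coeff 0 τ ≠ 0) (hl : ∀ᶠ s in l, ∀ i, 0 < s i)
    (hP : ∀ τ, F.coeff 0 τ ≠ 0 →
      Filter.Tendsto (fun s => F.monom s τ / S.ell 0 (S.metric g₁ s)) l (𝓝 (P τ)))
    {α : ι} (hα : F.coeff 0 (.inr α) ≠ 0) :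
    Filter.Tendsto (fun s => (S.scaling g₁ s (F.idx α))⁻¹) l
      (𝓝 (√(S.ell 0 g₁ * P (.inr α)))) := by
  refine (((hP _ hα).const_mul (S.ell 0 g₁)).sqrt).congr' ?_
  filter_upwards [hl] with s hs
  rw [← scaling_inv_sq M F hF hs, Real.sqrt_sq (inv_nonneg.2 (scaling_pos M F hF hs _).le)]

lemma tendsto_scaling_ratio (hF : ∃ τ, F.coeff 0 τ ≠ 0) (hl : ∀ᶠ s in l, ∀ i, 0 < s i)
    (hP : ∀ τ, F.coeff 0 τ ≠ 0 →
      Filter.Tendsto (fun s => F.monom s τ / S.ell 0 (S.metric g₁ s)) l (𝓝 (P τ)))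
    {α β γ : ι} (hτ : F.coeff 0 (.inl (α, β, γ)) ≠ 0) :
    Filter.Tendsto (fun s => S.scaling g₁ s (F.idx γ) /
      (S.scaling g₁ s (F.idx α) * S.scaling g₁ s (F.idx β))) l
      (𝓝 (√(S.ell 0 g₁ * P (.inl (α, β, γ))))) := by
  refine (((hP _ hτ).const_mul (S.ell 0 g₁)).sqrt).congr' ?_
  filter_upwards [hl] with s hs
  rw [← scaling_ratio_sq M F hF hs, Real.sqrt_sq]
  have := scaling_pos M F hF hs
  exact (div_pos (this _) (mul_pos (this _) (this _))).le

end Scaling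

section Limit

variable [TopologicalSpace 𝔤] [IsTopologicalAddGroup 𝔤] [ContinuousSMul ℝ 𝔤] [T2Space 𝔤]
  {l : Filter (Fin d → ℝ)} [l.NeBot] {b : 𝔤 →ₗ[ℝ] 𝔤 →ₗ[ℝ] 𝔤}

include M

lemma limit_of_mem_𝔥 (hF : ∃ τ, F.coeff 0 τ ≠ 0) (hl : ∀ᶠ s in l, ∀ i, 0 < s i)
    (hb : ∀ Y Z, Filter.Tendsto (fun s => S.interiorBracket g₁ s Y Z) l (𝓝 (b Y Z)))
    {X : 𝔤} (hX : X ∈ 𝔥) (Y : 𝔤) : b X Y = ⁅X, Y⁆ := by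
  refine tendsto_nhds_unique (hb X Y) (tendsto_const_nhds.congr' ?_)
  filter_upwards [hl] with s hs
  exact (interiorBracket_of_mem_𝔥 M (fun i => (scaling_pos M F hF hs i).ne') hX Y).symm

/-- Bracketing with 𝔥 is unaffected by the rescaling, since T_a commutes with ad 𝔥; the remaining
identities pass to the limit. -/
lemma isGeometry_limit (hF : ∃ τ, F.coeff 0 τ ≠ 0) (hl : ∀ᶠ s in l, ∀ i, 0 < s i)
    (hb : ∀ Y Z, Filter.Tendsto (fun s => S.interiorBracket g₁ s Y Z) l (𝓝 (b Y Z))) :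
    S.IsGeometry b g₁ where
  metric := M.metric
  swap X Y := by
    refine tendsto_nhds_unique (hb X Y) (((hb Y X).neg).congr fun s => ?_)
    rw [← interiorBracket_swap]
  mem_𝔥 X hX Y hY := by
    rw [limit_of_mem_𝔥 M F hF hl hb hX]; exact M.lie_𝔥 X hX Y hY
  mem_𝔪 X hX Y hY := by
    rw [limit_of_mem_𝔥 M F hF hl hb hX]; exact M.lie_𝔪 hX hY
  skew X hX Y Z := by
    rw [limit_of_mem_𝔥 M F hF hl hb hX, limit_of_mem_𝔥 M F hF hl hb hX]
    exact M.skew_𝔥 X hX Y Z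
  jacobi X hX Y Z := by
    simp only [limit_of_mem_𝔥 M F hF hl hb hX]
    have hc : Continuous (LieAlgebra.ad ℝ 𝔤 X) := LinearMap.continuous_of_finiteDimensional _
    refine tendsto_nhds_unique ((hc.tendsto _).comp (hb Y Z))
      (((hb ⁅X, Y⁆ Z).add (hb Y ⁅X, Z⁆)).congr fun s => ?_)
    exact (lie_interiorBracket M hX s Y Z).symm

lemma map_limit
    (hb : ∀ Y Z, Filter.Tendsto (fun s => S.interiorBracket g₁ s Y Z) l (𝓝 (b Y Z)))
    {A : 𝔤 →ₗ[ℝ] 𝔤} (hA : A ∈ Γ) (Y Z : 𝔤) : b (A Y) (A Z) = A (b Y Z) := by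
  have hc : Continuous A := LinearMap.continuous_of_finiteDimensional _
  refine tendsto_nhds_unique (hb _ _) (((hc.tendsto _).comp (hb Y Z)).congr fun s => ?_)
  exact (map_interiorBracket M hA s Y Z).symm

lemma trace_limit (hF : ∃ τ, F.coeff 0 τ ≠ 0) (hl : ∀ᶠ s in l, ∀ i, 0 < s i)
    (hb : ∀ Y Z, Filter.Tendsto (fun s => S.interiorBracket g₁ s Y Z) l (𝓝 (b Y Z))) (X : 𝔤) :
    LinearMap.trace ℝ 𝔤 (b X) = 0 := by
  refine tendsto_nhds_unique (tendsto_trace (hb X)) (tendsto_const_nhds.congr' ?_)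
  filter_upwards [hl] with s hs
  exact (trace_interiorBracket M (fun i => (scaling_pos M F hF hs i).ne') X).symm

/-- The Killing form of a limit of brackets is the limit of the rescaled Killing forms. -/
lemma tendsto_killingForm (hF : ∃ τ, F.coeff 0 τ ≠ 0) (hl : ∀ᶠ s in l, ∀ i, 0 < s i)
    (hb : ∀ Y Z, Filter.Tendsto (fun s => S.interiorBracket g₁ s Y Z) l (𝓝 (b Y Z))) (X : 𝔤) :
    Filter.Tendsto (fun s => killingForm ℝ 𝔤 (S.T (S.scaling g₁ s)⁻¹ X)
      (S.T (S.scaling g₁ s)⁻¹ X)) l (𝓝 (LinearMap.trace ℝ 𝔤 (b X ∘ₗ b X))) := by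
  refine (tendsto_trace (f := fun s => S.interiorBracket g₁ s X ∘ₗ S.interiorBracket g₁ s X)
    fun Y => tendsto_linearMap_apply (g := b X) (Y := b X Y) (hb X) (hb X Y)).congr' ?_
  filter_upwards [hl] with s hs
  exact trace_interiorBracket_sq M (fun i => (scaling_pos M F hF hs i).ne') X

variable {P : (ι × ι × ι) ⊕ ι → ℝ}

/-- If the coefficient is zero, the bracket coefficient vanishes along the whole filter, so the
value of P there does not matter. -/
lemma apply_limit_sq (hF : ∃ τ, F.coeff 0 τ ≠ 0) (hl : ∀ᶠ s in l, ∀ i, 0 < s i)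
    (hb : ∀ Y Z, Filter.Tendsto (fun s => S.interiorBracket g₁ s Y Z) l (𝓝 (b Y Z)))
    (hP0 : ∀ τ, 0 ≤ P τ)
    (hP : ∀ τ, F.coeff 0 τ ≠ 0 →
      Filter.Tendsto (fun s => F.monom s τ / S.ell 0 (S.metric g₁ s)) l (𝓝 (P τ)))
    (α β γ : ι) : g₁ (b (F.vec α) (F.vec β)) (F.vec γ) ^ 2 =
      4 * S.ell 0 g₁ * (F.coeff 0 (.inl (α, β, γ)) * P (.inl (α, β, γ))) := by
  have hc : Continuous (g₁.flip (F.vec γ)) := LinearMap.continuous_of_finiteDimensional _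
  have h1 := (hc.tendsto _).comp (hb (F.vec α) (F.vec β))
  have hcoeff : F.coeff 0 (.inl (α, β, γ)) = 1 / 4 * F.structConst α β γ ^ 2 := by
    simp [Frame.coeff]
  have h2 : g₁ (b (F.vec α) (F.vec β)) (F.vec γ) =
      √(S.ell 0 g₁ * P (.inl (α, β, γ))) * F.structConst α β γ := by
    refine tendsto_nhds_unique h1 ?_
    by_cases hτ : F.coeff 0 (.inl (α, β, γ)) = 0
    · have h0 : F.structConst α β γ = 0 := by
        rw [hcoeff] at hτ
        simpa using hτ
      rw [h0, mul_zero]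
      refine tendsto_const_nhds.congr fun s => ?_
      have := apply_interiorBracket M F s α β γ
      rw [h0, mul_zero] at this
      exact this.symm
    · refine ((tendsto_scaling_ratio M F hF hl hP hτ).mul_const _).congr fun s => ?_
      exact (apply_interiorBracket M F s α β γ).symm
  rw [h2, mul_pow, Real.sq_sqrt (mul_nonneg (ell_zero_pos M F hF).le (hP0 _)), hcoeff]
  ring

lemma trace_limit_sq (hF : ∃ τ, F.coeff 0 τ ≠ 0) (hl : ∀ᶠ s in l, ∀ i, 0 < s i)
    (hb : ∀ Y Z, Filter.Tendsto (fun s => S.interiorBracket g₁ s Y Z) l (𝓝 (b Y Z)))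
    (hP0 : ∀ τ, 0 ≤ P τ)
    (hP : ∀ τ, F.coeff 0 τ ≠ 0 →
      Filter.Tendsto (fun s => F.monom s τ / S.ell 0 (S.metric g₁ s)) l (𝓝 (P τ)))
    (α : ι) : LinearMap.trace ℝ 𝔤 (b (F.vec α) ∘ₗ b (F.vec α)) =
      -(2 * S.ell 0 g₁ * (F.coeff 0 (.inr α) * P (.inr α))) := by
  have hcoeff : F.coeff 0 (.inr α) = -(1 / 2 * killingForm ℝ 𝔤 (F.vec α) (F.vec α)) := by
    simp [Frame.coeff]
  have e : ∀ s, killingForm ℝ 𝔤 (S.T (S.scaling g₁ s)⁻¹ (F.vec α))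
      (S.T (S.scaling g₁ s)⁻¹ (F.vec α)) =
      (S.scaling g₁ s (F.idx α))⁻¹ ^ 2 * killingForm ℝ 𝔤 (F.vec α) (F.vec α) := fun s => by
    rw [S.T_of_mem_comp _ (F.mem α), map_smul, map_smul, LinearMap.smul_apply, smul_eq_mul,
      smul_eq_mul, Pi.inv_apply]
    ring
  have h1 := tendsto_killingForm M F hF hl hb (F.vec α)
  simp only [e] at h1
  refine tendsto_nhds_unique h1 ?_
  by_cases hτ : F.coeff 0 (.inr α) = 0
  · have h0 : killingForm ℝ 𝔤 (F.vec α) (F.vec α) = 0 := by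
      rw [hcoeff] at hτ
      simpa using hτ
    rw [hτ, h0]
    simp
  · refine (((tendsto_scaling_inv M F hF hl hP hτ).pow 2).mul_const _).trans_eq ?_
    rw [Real.sq_sqrt (mul_nonneg (ell_zero_pos M F hF).le (hP0 _)), hcoeff]
    congr 1
    ring

/-- If the limit geometry is Ricci flat, the limit of the barycentre of the exponents of `ℓ₀`
involves only the Killing form. -/
lemma sum_coeff_limit_of_flat (hF : ∃ τ, F.coeff 0 τ ≠ 0) (hl : ∀ᶠ s in l, ∀ i, 0 < s i)
    (hb : ∀ Y Z, Filter.Tendsto (fun s => S.interiorBracket g₁ s Y Z) l (𝓝 (b Y Z)))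
    (hP0 : ∀ τ, 0 ≤ P τ)
    (hP : ∀ τ, F.coeff 0 τ ≠ 0 →
      Filter.Tendsto (fun s => F.monom s τ / S.ell 0 (S.metric g₁ s)) l (𝓝 (P τ)))
    (hflat : S.IsLocallyEuclidean b g₁) (θ : ℝ) (φ : Fin d → ℝ) :
    ∑ τ, F.coeff θ τ * P τ * ∑ i, F.wt τ i * φ i =
      2 * ∑ α, F.coeff 0 (.inr α) * P (.inr α) * φ (F.idx α) := by
  have hg := isGeometry_limit M F hF hl hb
  have hL := ell_zero_pos M F hF
  obtain ⟨R, hR⟩ : ∃ R : ι → ι → ι → ℝ, ∀ α β γ,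
      F.coeff 0 (.inl (α, β, γ)) * P (.inl (α, β, γ)) = R α β γ := ⟨_, fun _ _ _ => rfl⟩
  obtain ⟨K, hK⟩ : ∃ K : ι → ℝ, ∀ α, F.coeff 0 (.inr α) * P (.inr α) = K α := ⟨_, fun _ => rfl⟩
  have hsq := apply_limit_sq M F hF hl hb hP0 hP
  have htr := trace_limit_sq M F hF hl hb hP0 hP
  simp only [hR] at hsq
  simp only [hK] at htr
  have hRsymm : ∀ α β γ, R β α γ = R α β γ := fun α β γ => by
    have h1 := hsq α β γ
    rw [hg.swap, map_neg, LinearMap.neg_apply, neg_sq, hsq β α γ] at h1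
    exact mul_left_cancel₀ (by positivity) h1
  -- Vanishing of ric(e_α,e_α), with K the limits of the Killing terms of ℓ₀ and R those of its
  -- bracket terms.
  have hric : ∀ α, K α - 2 * ∑ β, ∑ γ, R α β γ + ∑ β, ∑ γ, R β γ α = 0 := by
    intro α
    have h1 := ricci_self F b hg.swap hg.mem_𝔪
      (fun W hW => F.sum_ad_eq_zero M.metric hg.swap hg.mem_𝔪 hW (trace_limit M F hF hl hb W))
      M.metric (F.vecM α)
    rw [hflat.ricci_eq_zero] at h1
    simp only [Frame.coe_vecM, hsq, htr, ← Finset.mul_sum] at h1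
    have h2 : S.ell 0 g₁ * (K α - 2 * ∑ β, ∑ γ, R α β γ + ∑ β, ∑ γ, R β γ α) = 0 := by
      linarith
    exact (mul_eq_zero.1 h2).resolve_left hL.ne'
  have hsum : ∑ α, ∑ β, ∑ γ, R α β γ * (φ (F.idx α) + φ (F.idx β) - φ (F.idx γ)) =
      ∑ α, K α * φ (F.idx α) := by
    have e1 : ∑ α, ∑ β, ∑ γ, R α β γ * φ (F.idx β) = ∑ α, (∑ β, ∑ γ, R α β γ) * φ (F.idx α) := by
      rw [Finset.sum_comm]
      refine Finset.sum_congr rfl fun α _ => ?_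
      rw [Finset.sum_mul]
      refine Finset.sum_congr rfl fun β _ => ?_
      rw [Finset.sum_mul]
      exact Finset.sum_congr rfl fun γ _ => by rw [hRsymm]
    have e2 : ∑ α, ∑ β, ∑ γ, R α β γ * φ (F.idx γ) = ∑ α, (∑ β, ∑ γ, R β γ α) * φ (F.idx α) := by
      simp only [Finset.sum_mul]
      rw [show (∑ α, ∑ β, ∑ γ, R β γ α * φ (F.idx α)) = ∑ β, ∑ α, ∑ γ, R β γ α * φ (F.idx α) from
        Finset.sum_comm]
      exact Finset.sum_congr rfl fun α _ => Finset.sum_comm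
    have e3 : ∑ α, ∑ β, ∑ γ, R α β γ * φ (F.idx α) = ∑ α, (∑ β, ∑ γ, R α β γ) * φ (F.idx α) := by
      simp only [Finset.sum_mul]
    simp only [mul_sub, mul_add, Finset.sum_sub_distrib, Finset.sum_add_distrib, e1, e2, e3]
    rw [← Finset.sum_add_distrib, ← Finset.sum_sub_distrib]
    refine Finset.sum_congr rfl fun α _ => ?_
    have := hric α
    linear_combination (-φ (F.idx α)) * this
  -- By `hsum` the bracket terms pair with φ exactly as the Killing terms do. The factors 1+θ and
  -- 1-θ add up to 2, so θ disappears.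
  have hθ : ∀ τ, F.coeff θ τ * P τ * ∑ i, F.wt τ i * φ i =
      Frame.factor θ τ * (F.coeff 0 τ * P τ * ∑ i, F.wt τ i * φ i) := fun τ => by
    rw [F.coeff_eq]; ring
  rw [Finset.sum_congr rfl fun τ _ => hθ τ]
  simp only [F.sum_wt_mul, Fintype.sum_sum_type, Fintype.sum_prod_type, Frame.factor, hR, hK,
    ← Finset.mul_sum]
  rw [hsum]
  ring

end Limit

end Splitting

/-! ### Central summands, and transvections of a flat limit. -/

namespace Splitting

variable {𝔤 : Type*} [LieRing 𝔤] [LieAlgebra ℝ 𝔤] [FiniteDimensional ℝ 𝔤]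
  {𝔥 : Submodule ℝ 𝔤} {d : ℕ} {S : Splitting 𝔥 d} {g₁ Q : LinearMap.BilinForm ℝ 𝔤}
  {Γ : Set (𝔤 →ₗ[ℝ] 𝔤)}
  (M : S.IsReductiveModel g₁ Q Γ) {ι : Type*} [Fintype ι] (F : S.Frame g₁ ι)

lemma mem_𝔪sub {I : Set (Fin d)} {i : Fin d} (hi : i ∈ I) {X : 𝔤} (hX : X ∈ S.comp i) :
    X ∈ S.𝔪sub I := (le_iSup₂_of_le i hi le_rfl : S.comp i ≤ S.𝔪sub I) hX

lemma 𝔪sub_induction {I : Set (Fin d)} {p : 𝔤 → Prop} (h0 : p 0)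
    (hadd : ∀ X Y, p X → p Y → p (X + Y)) (hc : ∀ i ∈ I, ∀ X ∈ S.comp i, p X) {X : 𝔤}
    (hX : X ∈ S.𝔪sub I) : p X := by
  refine Submodule.iSup_induction (fun i => ⨆ _ : i ∈ I, S.comp i) (motive := p) hX
    (fun i Y hY => ?_) h0 hadd
  by_cases hi : i ∈ I
  · simp only [hi, iSup_pos] at hY
    exact hc i hi Y hY
  · simp only [hi, iSup_neg, not_false_eq_true, Submodule.mem_bot] at hY
    rw [hY]; exact h0

lemma 𝔪sub_le (I : Set (Fin d)) : S.𝔪sub I ≤ S.𝔪 :=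
  iSup₂_le fun i _ => S.comp_le_𝔪 i

section

include M

lemma Frame.apply_vec_eq_zero {i : Fin d} {X : 𝔤} (hX : X ∈ S.comp i) {α : ι}
    (hα : F.idx α ≠ i) : g₁ (F.vec α) X = 0 := M.orthogonal _ _ hα _ (F.mem α) _ hX

/-- A summand on which the Killing form vanishes is central. -/
lemma central_of_coeff_eq_zero {i : Fin d} (h : ∀ α, F.idx α = i → F.coeff 0 (.inr α) = 0)
    {X : 𝔤} (hX : X ∈ S.comp i) (Y : 𝔤) : ⁅X, Y⁆ = 0 := by
  have hα : ∀ α, F.idx α = i → ⁅F.vec α, Y⁆ = 0 := fun α hα => by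
    refine M.lie_eq_zero_of_killingForm_eq_zero ?_ Y
    have := h α hα
    simpa [Frame.coeff] using this
  have hXX := F.expand i X hX
  rw [hXX, sum_lie]
  refine Finset.sum_eq_zero fun α _ => ?_
  by_cases h' : F.idx α = i
  · rw [smul_lie, hα α h', smul_zero]
  · rw [F.apply_vec_eq_zero M hX h', zero_smul, zero_lie]

lemma exists_coeff_ne_zero_of_not_central {i : Fin d} {X Y : 𝔤} (hX : X ∈ S.comp i)
    (h : ⁅X, Y⁆ ≠ 0) : ∃ α, F.idx α = i ∧ F.coeff 0 (.inr α) ≠ 0 := by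
  by_contra! hne
  exact h (central_of_coeff_eq_zero M F hne hX Y)

lemma exists_coeff_ne_zero_of_polytope (h : (S.polytope g₁).Nonempty) :
    ∃ τ, F.coeff 0 τ ≠ 0 := by
  by_contra! hne
  have hc : ∀ i, ∀ X ∈ S.comp i, ∀ Y : 𝔤, ⁅X, Y⁆ = 0 := fun i X hX Y =>
    central_of_coeff_eq_zero M F (fun α _ => hne _) hX Y
  rw [polytope, convexHull_nonempty_iff] at h
  obtain ⟨w, ⟨i, j, k, ⟨X, hX, Y, hY, Z, hZ, hXYZ⟩, -⟩ | ⟨r, ⟨X, hX, Y, hY, hXY⟩, -⟩⟩ := h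
  · rw [hc i X hX Y] at hXYZ; simp at hXYZ
  · have : LieAlgebra.ad ℝ 𝔤 X = 0 := by ext Z; exact hc r X hX Z
    rw [killingForm_apply_apply, this] at hXY
    simp at hXY

lemma proj_lie_eq_zero {i j k : Fin d}
    (h : ∀ α β γ, F.idx α = i → F.idx β = j → F.idx γ = k → F.structConst α β γ = 0)
    {X Y : 𝔤} (hX : X ∈ S.comp i) (hY : Y ∈ S.comp j) : S.proj k ⁅X, Y⁆ = 0 := by
  rw [F.expand k _ (S.proj_mem k ⁅X, Y⁆)]
  refine Finset.sum_eq_zero fun γ _ => ?_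
  by_cases hγ : F.idx γ = k
  · have hmem : F.vec γ ∈ S.comp k := hγ ▸ F.mem γ
    rw [apply_proj_right M.metric M.orthogonal hmem, F.expand i X hX, F.expand j Y hY]
    rw [sum_lie, map_sum, Finset.sum_eq_zero, zero_smul]
    intro α _
    rw [smul_lie, map_smul]
    by_cases hα : F.idx α = i
    · rw [lie_sum, map_sum, Finset.sum_eq_zero, smul_zero]
      intro β _
      rw [lie_smul, map_smul]
      by_cases hβ : F.idx β = j
      · have := h α β γ hα hβ hγ
        rw [Frame.structConst, M.metric.symm] at this
        rw [this, smul_zero]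
      · rw [F.apply_vec_eq_zero M hY hβ, zero_smul]
    · rw [F.apply_vec_eq_zero M hX hα, zero_smul]
  · rw [F.apply_vec_eq_zero M (S.proj_mem k _) hγ, zero_smul]

/-- The Nomizu operators depend only on b and g₁, both preserved by A; test vectors are moved by an
inverse of A in Γ. -/
lemma map_isoRep {b : 𝔤 →ₗ[ℝ] 𝔤 →ₗ[ℝ] 𝔤} {A : 𝔤 →ₗ[ℝ] 𝔤} (hA : A ∈ Γ)
    (hb : ∀ Y Z, b (A Y) (A Z) = A (b Y Z)) (P : 𝔤) (Y : S.𝔪) :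
    (S.isoRep b g₁ (A P) ⟨A Y, M.map_𝔪 hA Y.2⟩ : 𝔤) = A (S.isoRep b g₁ P Y) := by
  have hH : S.projH (A P) = A (S.projH P) := by
    conv_lhs => rw [← S.projH_add_projM P, map_add, map_add,
      S.projH_of_mem (M.map_𝔥 A hA _ (S.projH_mem P)),
      S.projH_of_mem_𝔪 (M.map_𝔪 hA (S.projM P).2), add_zero]
  have hMM : ∀ P, S.projM (A P) = ⟨A (S.projM P), M.map_𝔪 hA (S.projM P).2⟩ := fun P => by
    conv_lhs => rw [← S.projH_add_projM P, map_add, map_add,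
      S.projM_of_mem_𝔥 (M.map_𝔥 A hA _ (S.projH_mem P)),
      S.projM_of_mem (M.map_𝔪 hA (S.projM P).2), zero_add]
  have hnom : ∀ X Y : S.𝔪, S.nomizu b g₁ ⟨A X, M.map_𝔪 hA X.2⟩ ⟨A Y, M.map_𝔪 hA Y.2⟩ =
      ⟨A (S.nomizu b g₁ X Y), M.map_𝔪 hA (S.nomizu b g₁ X Y).2⟩ := fun X Y => by
    refine M.metric.eq_of_forall fun Z => ?_
    obtain ⟨A', hA', hAA'⟩ := M.inv A hA
    have hZ : Z = ⟨A (A' Z), M.map_𝔪 hA (M.map_𝔪 hA' Z.2)⟩ := Subtype.ext (hAA' Z).symm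
    rw [hZ, M.metric.nomizu_apply]
    simp only [hb, M.map_metric A hA]
    exact (M.metric.nomizu_apply b X Y ⟨A' Z, M.map_𝔪 hA' Z.2⟩).symm
  rw [isoRep_apply, isoRep_apply, hMM, hnom, hH, Submodule.coe_add, Submodule.coe_add, map_add]
  congr 1
  rw [hb, hMM]

/-- The subspace `𝔪_I` spanned by flat summands meets the centre trivially as soon as no summand
is central. -/
lemma 𝔪sub_inf_center {I : Set (Fin d)}
    (hI : ∀ i ∈ I, ∃ α, F.idx α = i ∧ F.coeff 0 (.inr α) ≠ 0) :
    S.𝔪sub I ⊓ (LieAlgebra.center ℝ 𝔤).toSubmodule = ⊥ := by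
  set Z := (LieAlgebra.center ℝ 𝔤).toSubmodule ⊓ S.𝔪 with hZ
  have hcent : ∀ X, X ∈ (LieAlgebra.center ℝ 𝔤).toSubmodule ↔ ∀ Y : 𝔤, ⁅Y, X⁆ = 0 := fun X =>
    LieModule.mem_maxTrivSubmodule ℝ 𝔤 𝔤 X
  -- The central part of 𝔪 is Γ-invariant, so it contains 𝔪ᵢ or is orthogonal to it. A nonzero
  -- Killing coefficient excludes containment.
  have horth : ∀ i ∈ I, ∀ X ∈ S.comp i, ∀ Y ∈ Z, g₁ Y X = 0 := by
    intro i hi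
    refine (M.le_or_orthogonal (U := Z) inf_le_right (fun A hA X hX => ?_) i).resolve_left ?_
    · refine Submodule.mem_inf.2 ⟨(hcent _).2 fun Y => ?_, M.map_𝔪 hA hX.2⟩
      obtain ⟨A', hA', hAA'⟩ := M.inv A hA
      rw [← hAA' Y, ← M.map_lie A hA, (hcent X).1 hX.1, map_zero]
    · intro hle
      obtain ⟨α, hα, hne⟩ := hI i hi
      refine hne ?_
      have h1 : F.vec α ∈ Z := hle (hα ▸ F.mem α)
      have h2 : LieAlgebra.ad ℝ 𝔤 (F.vec α) = 0 := by
        ext Y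
        rw [LieAlgebra.ad_apply, ← lie_skew, (hcent _).1 h1.1, neg_zero, LinearMap.zero_apply]
      simp [Frame.coeff, killingForm_apply_apply, h2]
  refine (Submodule.eq_bot_iff _).2 fun X hX => ?_
  have hXm := 𝔪sub_le I hX.1
  refine M.metric.eq_zero hXm ?_
  exact 𝔪sub_induction (p := fun Y => g₁ X Y = 0) (map_zero _)
    (fun Y Y' h h' => by rw [map_add, h, h', add_zero])
    (fun i hi Y hY => horth i hi Y hY X ⟨hX.2, hXm⟩) hX.1

end

section Limit

variable [TopologicalSpace 𝔤] [IsTopologicalAddGroup 𝔤] [ContinuousSMul ℝ 𝔤] [T2Space 𝔤]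
  {l : Filter (Fin d → ℝ)} [l.NeBot] {b : 𝔤 →ₗ[ℝ] 𝔤 →ₗ[ℝ] 𝔤} {P : (ι × ι × ι) ⊕ ι → ℝ}

include M

/-- The limit of the moment map in a flat limit geometry. -/
lemma limit_moment_of_flat {θ : ℝ} (hθ : |θ| < 1) {x : Fin d → ℝ}
    (hF : ∃ τ, F.coeff 0 τ ≠ 0) (hl : ∀ᶠ s in l, ∀ i, 0 < s i)
    (hx : ∀ i, Filter.Tendsto (fun s => S.moment θ (S.metric g₁ s) i) l (𝓝 (x i)))
    (hb : ∀ Y Z, Filter.Tendsto (fun s => S.interiorBracket g₁ s Y Z) l (𝓝 (b Y Z)))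
    (hP0 : ∀ τ, 0 ≤ P τ)
    (hP : ∀ τ, F.coeff 0 τ ≠ 0 →
      Filter.Tendsto (fun s => F.monom s τ / S.ell 0 (S.metric g₁ s)) l (𝓝 (P τ)))
    (hflat : S.IsLocallyEuclidean b g₁) :
    ∃ ρ : ℝ, 0 < ρ ∧ ∀ i, x i * ρ =
      2 * ∑ α, F.coeff 0 (.inr α) * P (.inr α) * if F.idx α = i then 1 else 0 := by
  have hcP : ∀ τ, 0 ≤ F.coeff θ τ * P τ := fun τ => mul_nonneg (F.coeff_nonneg M hθ τ) (hP0 τ)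
  -- ρ is the limit of ℓ_θ/ℓ₀. It is positive because the coefficients for θ and for 0 differ by
  -- positive factors.
  refine ⟨∑ τ, F.coeff θ τ * P τ, ?_, fun i => ?_⟩
  · refine lt_of_le_of_ne (Finset.sum_nonneg fun τ _ => hcP τ) fun h0 => ?_
    have h1 := (Finset.sum_eq_zero_iff_of_nonneg fun τ _ => hcP τ).1 h0.symm
    have h2 := sum_coeff_limit_eq_one M F (θ := 0) (by simp) hF hl hP
    rw [Finset.sum_eq_zero] at h2
    · exact zero_ne_one h2
    · intro τ hτ
      have h3 := h1 τ hτ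
      rw [F.coeff_eq, mul_assoc] at h3
      exact (mul_eq_zero.1 h3).resolve_left (Frame.factor_pos hθ τ).ne'
  · have h1 := sum_coeff_limit_of_flat M F hF hl hb hP0 hP hflat θ fun j => if j = i then 1 else 0
    simp only [mul_ite, mul_one, mul_zero, Finset.sum_ite_eq', Finset.mem_univ, if_true] at h1 ⊢
    rw [← h1]
    refine tendsto_nhds_unique ((hx i).mul (tendsto_ell_div_ell M F θ hl hP)) ?_
    have h2 := tendsto_sum_monom_div_ell M F (c := fun τ => F.coeff θ τ * F.wt τ i)
      (fun τ hτ => by rw [F.coeff_eq, hτ, mul_zero, zero_mul]) hP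
    refine (h2.congr' ?_).trans_eq ?_
    · filter_upwards [hl] with s hs
      have h3 := (ell_pos M F hθ hF hs).ne'
      rw [moment_eq M F θ hs, ← ell_eq M F θ hs, div_mul_div_cancel₀ h3, Finset.sum_div]
      exact Finset.sum_congr rfl fun τ _ => by ring
    · congr 1
      exact Finset.sum_congr rfl fun τ _ => by ring

/-- A transvection of a flat limit geometry with component `X ∈ 𝔪ᵢ` comes from a central
element of `𝔤`. -/
lemma central_of_transvection (hF : ∃ τ, F.coeff 0 τ ≠ 0) (hl : ∀ᶠ s in l, ∀ i, 0 < s i)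
    (hb : ∀ Y Z, Filter.Tendsto (fun s => S.interiorBracket g₁ s Y Z) l (𝓝 (b Y Z)))
    (hflat : S.IsLocallyEuclidean b g₁) {i : Fin d} {t : ℝ}
    (ht : Filter.Tendsto (fun s => (S.scaling g₁ s i)⁻¹) l (𝓝 t)) {X Y : 𝔤}
    (hX : X ∈ S.comp i) (hY : Y ∈ 𝔥) (hXY : S.isoRep b g₁ (X + Y) = 0) (Z : 𝔤) :
    ⁅t • X + Y, Z⁆ = 0 := by
  have hg := isGeometry_limit M F hF hl hb
  have h1 : b (X + Y) ∘ₗ b (X + Y) = 0 := by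
    refine LinearMap.ext fun Z => hg.lie_lie_eq_zero hflat (fun W hW h => ?_) hXY Z
    exact M.effective W hW fun Z hZ => by rw [← limit_of_mem_𝔥 M F hF hl hb hW]; exact h Z hZ
  -- The square of the limiting ad(X+Y) is zero, so the rescaled Killing forms tend to 0 there. They
  -- also tend to the Killing form of 𝔤 at tX+Y, whose null vectors are central.
  have h2 := tendsto_killingForm M F hF hl hb (X + Y)
  rw [h1, map_zero] at h2
  refine M.lie_eq_zero_of_killingForm_eq_zero ?_ Z
  refine tendsto_nhds_unique ?_ h2
  have e : ∀ s, S.T (S.scaling g₁ s)⁻¹ (X + Y) = (S.scaling g₁ s i)⁻¹ • X + Y := fun s => by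
    rw [map_add, S.T_of_mem_comp _ hX, S.T_of_mem_𝔥 _ hY, Pi.inv_apply]
  simp only [e]
  simp only [map_add, map_smul, LinearMap.add_apply, LinearMap.smul_apply, smul_eq_mul]
  exact ((ht.mul ((ht.mul_const _).add_const _)).add ((ht.mul_const _).add_const _))

end Limit

end Splitting

/-! ### From a flat limit to commuting summands. -/

namespace Splitting

variable {𝔤 : Type*} [LieRing 𝔤] [LieAlgebra ℝ 𝔤] [FiniteDimensional ℝ 𝔤]
  {𝔥 : Submodule ℝ 𝔤} {d : ℕ} {S : Splitting 𝔥 d} {g₁ Q : LinearMap.BilinForm ℝ 𝔤}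
  {Γ : Set (𝔤 →ₗ[ℝ] 𝔤)}
  (M : S.IsReductiveModel g₁ Q Γ) {ι : Type*} [Fintype ι] (F : S.Frame g₁ ι)

lemma eq_zero_of_mem_𝔥_of_mem_𝔪 {X : 𝔤} (h𝔥 : X ∈ 𝔥) (h𝔪 : X ∈ S.𝔪) : X = 0 := by
  rw [← S.projH_of_mem h𝔥, S.projH_of_mem_𝔪 h𝔪]

lemma approach_spec {𝔥 : Submodule ℝ 𝔤} (S : Splitting 𝔥 d) (g₁ : LinearMap.BilinForm ℝ 𝔤) {θ : ℝ} {x : Fin d → ℝ} :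
    (∀ᶠ s in S.approach θ g₁ x, ∀ i, 0 < s i) ∧ ∀ i, Filter.Tendsto
      (fun s => S.moment θ (S.metric g₁ s) i) (S.approach θ g₁ x) (𝓝 (x i)) := by
  refine ⟨Filter.mem_inf_of_right (Filter.mem_principal_self _), fun i => ?_⟩
  have h1 : Filter.Tendsto (fun s => S.moment θ (S.metric g₁ s)) (S.approach θ g₁ x) (𝓝 x) :=
    Filter.tendsto_comap.mono_left inf_le_left
  exact ((continuous_apply i).tendsto x).comp h1

section Limit

variable [TopologicalSpace 𝔤] [IsTopologicalAddGroup 𝔤] [ContinuousSMul ℝ 𝔤] [T2Space 𝔤]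
  {l : Filter (Fin d → ℝ)} [l.NeBot] {b : 𝔤 →ₗ[ℝ] 𝔤 →ₗ[ℝ] 𝔤} {P : (ι × ι × ι) ⊕ ι → ℝ}

include M

/-- The 𝔪-components of transvections form a Γ-invariant subspace U. Either 𝔪ᵢ lies in U and its
vectors extend to transvections, or it is orthogonal to U and its vectors are parallel. -/
lemma central_or_parallel (hF : ∃ τ, F.coeff 0 τ ≠ 0) (hl : ∀ᶠ s in l, ∀ i, 0 < s i)
    (hb : ∀ Y Z, Filter.Tendsto (fun s => S.interiorBracket g₁ s Y Z) l (𝓝 (b Y Z)))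
    (hflat : S.IsLocallyEuclidean b g₁) {i : Fin d} {t : ℝ}
    (ht : Filter.Tendsto (fun s => (S.scaling g₁ s i)⁻¹) l (𝓝 t)) :
    (∀ X ∈ S.comp i, ∃ Y ∈ 𝔥, ∀ Z : 𝔤, ⁅t • X + Y, Z⁆ = 0) ∨
      ∀ X : S.𝔪, (X : 𝔤) ∈ S.comp i → ∀ P, S.isoRep b g₁ P X = 0 := by
  have hg := isGeometry_limit M F hF hl hb
  set U : Submodule ℝ 𝔤 := (LinearMap.ker (S.isoRep b g₁)).map (S.𝔪.subtype ∘ₗ S.projM) with hU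
  have hU𝔪 : U ≤ S.𝔪 := by
    rintro _ ⟨A, -, rfl⟩
    exact (S.projM A).2
  have hUΓ : ∀ A ∈ Γ, ∀ X ∈ U, A X ∈ U := by
    rintro A hA _ ⟨B, hB, rfl⟩
    refine ⟨A B, ?_, ?_⟩
    · refine LinearMap.mem_ker.2 (LinearMap.ext fun Y => ?_)
      obtain ⟨A', hA', hAA'⟩ := M.inv A hA
      have h1 := map_isoRep M hA (fun Y Z => map_limit M hb hA Y Z) B ⟨A' Y, M.map_𝔪 hA' Y.2⟩
      rw [LinearMap.mem_ker.1 hB, LinearMap.zero_apply, ZeroMemClass.coe_zero, map_zero] at h1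
      have h2 : (⟨A (A' Y), M.map_𝔪 hA (M.map_𝔪 hA' Y.2)⟩ : S.𝔪) = Y := Subtype.ext (hAA' Y)
      rw [h2] at h1
      exact Subtype.ext h1
    · change (S.projM (A B) : 𝔤) = A (S.projM B)
      rw [S.coe_projM, S.coe_projM, map_sum]
      exact Finset.sum_congr rfl fun j _ => (M.map_proj hA j B).symm
  rcases M.le_or_orthogonal hU𝔪 hUΓ i with h | h
  · left
    intro X hX
    obtain ⟨A, hA, hAX⟩ := h hX
    have hAX' : (S.projM A : 𝔤) = X := hAX
    refine ⟨S.projH A, S.projH_mem A, fun Z => ?_⟩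
    refine central_of_transvection M F hF hl hb hflat ht hX (S.projH_mem A) ?_ Z
    rw [add_comm, ← hAX', S.projH_add_projM]
    exact hA
  · right
    intro X hX P
    refine hg.isoRep_eq_zero hflat (fun A hA => ?_) P
    rw [M.metric.symm, ← M.metric.projM_left]
    exact h X hX _ ⟨A, hA, rfl⟩

/-- If tX+Y is central, then [W,tX] = -[W,Y] lies in 𝔪 ∩ 𝔥 = 0. If X is parallel, the isotropy
action of W kills it directly. -/
lemma lie_𝔥_of_flat (hF : ∃ τ, F.coeff 0 τ ≠ 0) (hl : ∀ᶠ s in l, ∀ i, 0 < s i)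
    (hb : ∀ Y Z, Filter.Tendsto (fun s => S.interiorBracket g₁ s Y Z) l (𝓝 (b Y Z)))
    (hflat : S.IsLocallyEuclidean b g₁) {i : Fin d} {t : ℝ} (ht0 : 0 < t)
    (ht : Filter.Tendsto (fun s => (S.scaling g₁ s i)⁻¹) l (𝓝 t)) {W X : 𝔤} (hW : W ∈ 𝔥)
    (hX : X ∈ S.comp i) : ⁅W, X⁆ = 0 := by
  have hX𝔪 := S.comp_le_𝔪 i hX
  rcases central_or_parallel M F hF hl hb hflat ht with h | h
  · obtain ⟨Y, hY, hXY⟩ := h X hX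
    have h1 : t • ⁅W, X⁆ + ⁅W, Y⁆ = 0 := by
      rw [← lie_smul, ← lie_add, ← lie_skew, hXY, neg_zero]
    have h2 : t • ⁅W, X⁆ ∈ 𝔥 := by
      rw [eq_neg_of_add_eq_zero_left h1]
      exact neg_mem (M.lie_𝔥 W hW Y hY)
    have h3 := S.eq_zero_of_mem_𝔥_of_mem_𝔪 h2 (Submodule.smul_mem _ _ (M.lie_𝔪 hW hX𝔪))
    exact (smul_eq_zero.1 h3).resolve_left ht0.ne'
  · have hg := isGeometry_limit M F hF hl hb
    have h1 := h ⟨X, hX𝔪⟩ hX W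
    rw [isoRep_of_mem_𝔥 hW] at h1
    have h2 := hg.coe_projM_lie hW ⟨X, hX𝔪⟩
    rw [h1, limit_of_mem_𝔥 M F hF hl hb hW] at h2
    exact h2.symm

lemma lie_of_flat (hF : ∃ τ, F.coeff 0 τ ≠ 0) (hl : ∀ᶠ s in l, ∀ i, 0 < s i)
    (hb : ∀ Y Z, Filter.Tendsto (fun s => S.interiorBracket g₁ s Y Z) l (𝓝 (b Y Z)))
    (hP0 : ∀ τ, 0 ≤ P τ)
    (hP : ∀ τ, F.coeff 0 τ ≠ 0 →
      Filter.Tendsto (fun s => F.monom s τ / S.ell 0 (S.metric g₁ s)) l (𝓝 (P τ)))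
    (hflat : S.IsLocallyEuclidean b g₁) {i j : Fin d} {t t' : ℝ} (ht0 : 0 < t) (ht0' : 0 < t')
    (ht : Filter.Tendsto (fun s => (S.scaling g₁ s i)⁻¹) l (𝓝 t))
    (ht' : Filter.Tendsto (fun s => (S.scaling g₁ s j)⁻¹) l (𝓝 t')) {X Y : 𝔤}
    (hX : X ∈ S.comp i) (hY : Y ∈ S.comp j) : ⁅X, Y⁆ = 0 := by
  have hg := isGeometry_limit M F hF hl hb
  have hXh : ∀ W ∈ 𝔥, ∀ X ∈ S.comp i, ⁅W, X⁆ = 0 := fun W hW X hX =>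
    lie_𝔥_of_flat M F hF hl hb hflat ht0 ht hW hX
  have hYh : ∀ W ∈ 𝔥, ∀ Y ∈ S.comp j, ⁅W, Y⁆ = 0 := fun W hW Y hY =>
    lie_𝔥_of_flat M F hF hl hb hflat ht0' ht' hW hY
  rcases central_or_parallel M F hF hl hb hflat ht with h | h
  · obtain ⟨W, hW, hXW⟩ := h X hX
    have h1 := hXW Y
    rw [add_lie, smul_lie, hYh W hW Y hY, add_zero] at h1
    exact (smul_eq_zero.1 h1).resolve_left ht0.ne'
  rcases central_or_parallel M F hF hl hb hflat ht' with h' | h'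
  · obtain ⟨W, hW, hYW⟩ := h' Y hY
    have h1 := hYW X
    rw [add_lie, smul_lie, hXh W hW X hX, add_zero] at h1
    rw [← lie_skew, (smul_eq_zero.1 h1).resolve_left ht0'.ne', neg_zero]
  -- Both summands are parallel, so the limit bracket has no 𝔪-part. A nonzero constant would give
  -- a_γ/(a_α a_β) → 0, while by skewness a_β/(a_α a_γ) converges. Their product is a_α⁻², whose
  -- limit t² is positive.
  have hc : ∀ α β γ, F.idx α = i → F.idx β = j → F.structConst α β γ = 0 := by
    intro α β γ hα hβ
    by_contra hne
    have hskew : F.structConst α γ β = -F.structConst α β γ := by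
      have h1 := M.skew_commutant (F.vec α) (fun W hW => hXh W hW _ (hα ▸ F.mem α)) (F.vec γ)
        (F.vec β)
      rw [M.metric.symm (F.vec γ)] at h1
      exact h1
    have hcoeff : ∀ α β γ, F.structConst α β γ ≠ 0 → F.coeff 0 (.inl (α, β, γ)) ≠ 0 :=
      fun α β γ h => by
        simp only [Frame.coeff]
        positivity
    have hbz : S.projM (b (F.vec α) (F.vec β)) = 0 := by
      have h1 := hg.isoRep_projM (F.vec α) (F.vec β)
      rw [S.projM_of_mem (F.mem_𝔪 β), S.projM_of_mem (F.mem_𝔪 α),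
        h' ⟨F.vec β, F.mem_𝔪 β⟩ (hβ ▸ F.mem β), h ⟨F.vec α, F.mem_𝔪 α⟩ (hα ▸ F.mem α),
        sub_zero] at h1
      exact h1.symm
    have hPz : S.ell 0 g₁ * P (.inl (α, β, γ)) = 0 := by
      have h1 := apply_limit_sq M F hF hl hb hP0 hP α β γ
      rw [← M.metric.projM_left, hbz, ZeroMemClass.coe_zero, map_zero, LinearMap.zero_apply] at h1
      have h2 : F.coeff 0 (.inl (α, β, γ)) * (S.ell 0 g₁ * P (.inl (α, β, γ))) = 0 := by
        linarith
      exact (mul_eq_zero.1 h2).resolve_left (hcoeff _ _ _ hne)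
    have l1 := tendsto_scaling_ratio M F hF hl hP (hcoeff _ _ _ hne)
    have l2 := tendsto_scaling_ratio M F hF hl hP (hcoeff α γ β (by rw [hskew]; simpa using hne))
    rw [hPz, Real.sqrt_zero] at l1
    have l3 := l1.mul l2
    rw [zero_mul, hα, hβ] at l3
    have l4 := tendsto_nhds_unique (ht.mul ht) (l3.congr' (by
      filter_upwards [hl] with s hs
      have h1 := fun i => (scaling_pos M F hF hs i).ne'
      have h2 := h1 i
      have h3 := h1 j
      have h4 := h1 (F.idx γ)
      field_simp))
    exact (mul_pos ht0 ht0).ne' l4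
  have hmem : ⁅X, Y⁆ ∈ 𝔥 := S.mem_𝔥_of_proj_eq_zero fun k =>
    proj_lie_eq_zero M F (fun α β γ hα hβ _ => hc α β γ hα hβ) hX hY
  -- The bracket lies in 𝔥, which commutes with X, so Q([X,Y],[X,Y]) = -Q(Y,[X,[X,Y]]) = 0.
  by_contra hne
  have h1 := M.Q_pos _ hne
  rw [M.Q_skew X Y, ← lie_skew, hXh _ hmem X hX, neg_zero, map_zero, neg_zero] at h1
  exact lt_irrefl _ h1

end Limit

section Forward

variable [TopologicalSpace 𝔤] [IsTopologicalAddGroup 𝔤] [ContinuousSMul ℝ 𝔤] [T2Space 𝔤]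

include M

theorem exists_flat_summands {θ : ℝ} (hθ : |θ| < 1) {x : Fin d → ℝ} (hx : x ∈ S.infinity g₁)
    (hflat : S.IsLocallyEuclideanAt θ g₁ x) :
    ∃ I : Set (Fin d), x ∈ convexHull ℝ (weight '' I) ∧
        (∀ X ∈ S.𝔪sub I, ∀ Y ∈ S.𝔪sub I, ⁅X, Y⁆ = 0) ∧
        (∀ X ∈ S.𝔪sub I, ∀ Y ∈ 𝔥, ⁅X, Y⁆ = 0) ∧
        S.𝔪sub I ⊓ (LieAlgebra.center ℝ 𝔤).toSubmodule = ⊥ := by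
  obtain ⟨F⟩ := M.exists_frame
  have hF : ∃ τ, F.coeff 0 τ ≠ 0 := by
    refine exists_coeff_ne_zero_of_polytope M F ?_
    by_contra h
    rw [infinity, Set.not_nonempty_iff_eq_empty.1 h, intrinsicFrontier_empty] at hx
    exact hx
  obtain ⟨b, ⟨hne, hb⟩, hflat⟩ := hflat
  obtain ⟨happ, hmom⟩ := approach_spec S g₁ (θ := θ) (x := x)
  set 𝒰 : Ultrafilter (Fin d → ℝ) := Ultrafilter.of (S.approach θ g₁ x) with h𝒰
  have hle : (𝒰 : Filter (Fin d → ℝ)) ≤ S.approach θ g₁ x := Ultrafilter.of_le _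
  have hl := happ.filter_mono hle
  replace hb := fun Y Z => (hb Y Z).mono_left hle
  -- The quotients by ℓ₀ are used, whatever θ is, because ℓ₀ normalizes the rescaled brackets.
  obtain ⟨P, hP0, hP⟩ := exists_tendsto_monom_div_ell M F (θ := 0) (by simp) hF 𝒰 hl
  obtain ⟨ρ, hρ, hxρ⟩ := limit_moment_of_flat M F hθ hF hl (fun i => (hmom i).mono_left hle) hb
    hP0 hP hflat
  have hcP : ∀ α, 0 ≤ F.coeff 0 (.inr α) * P (.inr α) := fun α =>
    mul_nonneg (F.coeff_nonneg M (by simp) _) (hP0 _)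
  have hx0 : ∀ i, 0 ≤ x i := fun i => by
    have : 0 ≤ x i * ρ := by
      rw [hxρ]
      refine mul_nonneg zero_le_two (Finset.sum_nonneg fun α _ => mul_nonneg (hcP α) ?_)
      split_ifs <;> norm_num
    exact nonneg_of_mul_nonneg_left this hρ
  have hx1 : ∑ i, x i = 1 := by
    refine tendsto_nhds_unique (tendsto_finsetSum _ fun i _ => (hmom i).mono_left hle)
      (tendsto_const_nhds.congr' ?_)
    filter_upwards [hl] with s hs
    have h1 := (ell_pos M F hθ hF hs).ne'
    simp only [moment_eq M F θ hs]
    rw [← Finset.sum_div, Finset.sum_comm]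
    simp only [← Finset.mul_sum, F.sum_wt, mul_one]
    rw [← ell_eq M F θ hs, div_self h1]
  -- By flatness x is carried by Killing terms alone, so x i > 0 requires one that survives in the
  -- limit. It gives a positive limit of 1/a_i and shows that 𝔪ᵢ is not central.
  have hex : ∀ i, 0 < x i → ∃ α, F.idx α = i ∧ F.coeff 0 (.inr α) ≠ 0 ∧ 0 < P (.inr α) := by
    intro i hi
    by_contra! hno
    have h1 := hxρ i
    rw [Finset.sum_eq_zero, mul_zero] at h1
    · exact (mul_pos hi hρ).ne' h1
    · intro α _
      by_cases hα : F.idx α = i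
      · by_cases h0 : F.coeff 0 (.inr α) = 0
        · rw [h0, zero_mul, zero_mul]
        · rw [le_antisymm (hno α hα h0) (hP0 _), mul_zero, zero_mul]
      · rw [if_neg hα, mul_zero]
  have ht : ∀ i, 0 < x i → ∃ t : ℝ, 0 < t ∧
      Filter.Tendsto (fun s => (S.scaling g₁ s i)⁻¹) 𝒰 (𝓝 t) := by
    intro i hi
    obtain ⟨α, rfl, hα0, hPα⟩ := hex i hi
    exact ⟨_, Real.sqrt_pos.2 (mul_pos (ell_zero_pos M F hF) hPα),
      tendsto_scaling_inv M F hF hl hP hα0⟩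
  refine ⟨{i | 0 < x i}, ?_, ?_, ?_, ?_⟩
  · have h1 : x = ∑ i ∈ Finset.univ.filter fun i => 0 < x i, x i • weight i := by
      rw [Finset.sum_filter_of_ne]
      · ext j
        simp [weight, Finset.sum_apply, Pi.single_apply]
      · intro i _ hi
        refine lt_of_le_of_ne (hx0 i) fun h => hi ?_
        rw [← h, zero_smul]
    nth_rw 2 [h1]
    refine (convex_convexHull ℝ _).sum_mem (fun i _ => hx0 i) ?_ fun i hi =>
      subset_convexHull ℝ _ ⟨i, (Finset.mem_filter.1 hi).2, rfl⟩
    rw [Finset.sum_filter_of_ne, hx1]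
    intro i _ hi
    exact lt_of_le_of_ne (hx0 i) (Ne.symm hi)
  · intro X hX Y hY
    refine 𝔪sub_induction (p := fun X => ⁅X, Y⁆ = 0) (zero_lie _)
      (fun X X' h h' => by rw [add_lie, h, h', add_zero]) (fun i hi X hX => ?_) hX
    refine 𝔪sub_induction (p := fun Y : 𝔤 => ⁅X, Y⁆ = 0) (lie_zero _)
      (fun X X' h h' => by rw [lie_add, h, h', add_zero]) (fun j hj Y hY => ?_) hY
    obtain ⟨t, ht0, ht1⟩ := ht i hi
    obtain ⟨t', ht0', ht1'⟩ := ht j hj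
    exact lie_of_flat M F hF hl hb hP0 hP hflat ht0 ht0' ht1 ht1' hX hY
  · intro X hX Y hY
    refine 𝔪sub_induction (p := fun X => ⁅X, Y⁆ = 0) (zero_lie _)
      (fun X X' h h' => by rw [add_lie, h, h', add_zero]) (fun i hi X hX => ?_) hX
    obtain ⟨t, ht0, ht1⟩ := ht i hi
    rw [← lie_skew, lie_𝔥_of_flat M F hF hl hb hflat ht0 ht1 hY hX, neg_zero]
  · refine 𝔪sub_inf_center M F fun i hi => ?_
    obtain ⟨α, hα, hα0, -⟩ := hex i hi
    exact ⟨α, hα, hα0⟩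

end Forward

end Splitting

/-! ### Metrics shrinking commuting summands. -/

namespace Splitting

variable {𝔤 : Type*} [LieRing 𝔤] [LieAlgebra ℝ 𝔤] [FiniteDimensional ℝ 𝔤]
  {𝔥 : Submodule ℝ 𝔤} {d : ℕ} {S : Splitting 𝔥 d} {g₁ Q : LinearMap.BilinForm ℝ 𝔤}
  {Γ : Set (𝔤 →ₗ[ℝ] 𝔤)}
  (M : S.IsReductiveModel g₁ Q Γ) {ι : Type*} [Fintype ι] (F : S.Frame g₁ ι)

/-- The summands `𝔪ᵢ` with `uᵢ ≠ 0` commute with each other and with `𝔥`. -/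
structure IsFlatWeight (S : Splitting 𝔥 d) (u : Fin d → ℝ) : Prop where
  nonneg : ∀ i, 0 ≤ u i
  abelian : ∀ i j, u i ≠ 0 → u j ≠ 0 → ∀ X ∈ S.comp i, ∀ Y ∈ S.comp j, ⁅X, Y⁆ = 0
  fixed : ∀ i, u i ≠ 0 → ∀ X ∈ 𝔥, ∀ Y ∈ S.comp i, ⁅X, Y⁆ = 0

/-- The limits of the monomials of `ℓ_θ` along the curve of metrics shrinking the flat
summands. -/
def Frame.flatLimit (u : Fin d → ℝ) : (ι × ι × ι) ⊕ ι → ℝ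
  | .inl (α, β, _) => u (F.idx α) + u (F.idx β)
  | .inr α => u (F.idx α)

/-- The metrics shrinking the flat summands. -/
def flatCurve (u : Fin d → ℝ) (r : ℝ) (i : Fin d) : ℝ := if u i = 0 then 1 else r / u i

lemma IsFlatWeight.flatCurve_pos {u : Fin d → ℝ} (hu : S.IsFlatWeight u) {r : ℝ} (hr : 0 < r)
    (i : Fin d) : 0 < flatCurve u r i := by
  rw [flatCurve]
  split_ifs with h
  · exact one_pos
  · exact div_pos hr (lt_of_le_of_ne (hu.nonneg i) (Ne.symm h))

lemma Frame.flatLimit_nonneg {u : Fin d → ℝ} (hu : S.IsFlatWeight u) (τ : (ι × ι × ι) ⊕ ι) :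
    0 ≤ F.flatLimit u τ := by
  rcases τ with ⟨α, β, γ⟩ | α
  · exact add_nonneg (hu.nonneg _) (hu.nonneg _)
  · exact hu.nonneg _

lemma Frame.structConst_eq_zero {u : Fin d → ℝ} (hu : S.IsFlatWeight u) {α β : ι}
    (hα : u (F.idx α) ≠ 0) (hβ : u (F.idx β) ≠ 0) (γ : ι) : F.structConst α β γ = 0 := by
  rw [structConst, hu.abelian _ _ hα hβ _ (F.mem α) _ (F.mem β), map_zero, LinearMap.zero_apply]

include M

/-- X commutes with 𝔥, so this is where invariance of g₁ under the centralizer of H⁰ enters the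
construction of the flat limit. -/
lemma IsFlatWeight.skew {u : Fin d → ℝ} (hu : S.IsFlatWeight u) {i : Fin d} (hi : u i ≠ 0)
    {X : 𝔤} (hX : X ∈ S.comp i) (Y Z : 𝔤) : g₁ ⁅X, Y⁆ Z = -g₁ Y ⁅X, Z⁆ :=
  M.skew_commutant X (fun W hW => hu.fixed i hi W hW X hX) Y Z

lemma Frame.structConst_skew {u : Fin d → ℝ} (hu : S.IsFlatWeight u) {α : ι}
    (hα : u (F.idx α) ≠ 0) (β γ : ι) : F.structConst α γ β = -F.structConst α β γ := by
  rw [structConst, hu.skew M hα (F.mem α), M.metric.symm, structConst]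

/-- By commutativity and skewness a nonzero structure constant has at most one index in a flat
summand. If it is an input, r times the monomial is constant; otherwise it is of order r or r². -/
lemma Frame.tendsto_mul_monom {u : Fin d → ℝ} (hu : S.IsFlatWeight u) {τ : (ι × ι × ι) ⊕ ι}
    (hτ : F.coeff 0 τ ≠ 0) :
    Filter.Tendsto (fun r => r * F.monom (flatCurve u r) τ) (𝓝[>] 0)
      (𝓝 (F.flatLimit u τ)) := by
  have hid : Filter.Tendsto (fun r : ℝ => r) (𝓝[>] 0) (𝓝 0) :=
    Filter.tendsto_id.mono_left nhdsWithin_le_nhds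
  have hpos : ∀ᶠ r : ℝ in 𝓝[>] 0, 0 < r := eventually_mem_nhdsWithin
  rcases τ with ⟨α, β, γ⟩ | α
  · have hne : F.structConst α β γ ≠ 0 := fun h => hτ (by simp [coeff, h])
    simp only [monom, flatLimit]
    by_cases hα : u (F.idx α) = 0
    · by_cases hβ : u (F.idx β) = 0
      · rw [hα, hβ, add_zero]
        simp only [flatCurve, hα, hβ, if_true, mul_one, div_one]
        split_ifs with hγ
        · simpa using hid
        · simpa using hid.mul (hid.div_const (u (F.idx γ)))
      · have hγ : u (F.idx γ) = 0 := by
          by_contra hγ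
          have h1 := F.structConst_eq_zero hu hβ hγ α
          rw [F.structConst_skew M hu hβ, F.structConst_swap, neg_neg] at h1
          exact hne h1
        rw [hα, zero_add]
        refine tendsto_const_nhds.congr' ?_
        filter_upwards [hpos] with r hr
        have := hr.ne'
        simp only [flatCurve, hα, hβ, hγ, if_true, if_false, one_mul]
        field_simp
    · have hβ : u (F.idx β) = 0 := by
        by_contra hβ
        exact hne (F.structConst_eq_zero hu hα hβ γ)
      have hγ : u (F.idx γ) = 0 := by
        by_contra hγ
        have h1 := F.structConst_eq_zero hu hα hγ β
        rw [F.structConst_skew M hu hα, neg_eq_zero] at h1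
        exact hne h1
      rw [hβ, add_zero]
      refine tendsto_const_nhds.congr' ?_
      filter_upwards [hpos] with r hr
      have := hr.ne'
      simp only [flatCurve, hα, hβ, hγ, if_true, if_false, mul_one]
      field_simp
  · simp only [monom, flatLimit]
    by_cases hα : u (F.idx α) = 0
    · rw [hα]
      simpa [flatCurve, hα] using hid
    · refine tendsto_const_nhds.congr' ?_
      filter_upwards [hpos] with r hr
      have := hr.ne'
      simp only [flatCurve, hα, if_false]
      field_simp

/-- The total coefficient of the monomials in which a flat summand dominates. -/
lemma Frame.sum_coeff_mul_flatLimit {u : Fin d → ℝ} (hu : S.IsFlatWeight u) (θ : ℝ)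
    (φ : Fin d → ℝ) : ∑ τ, F.coeff θ τ * F.flatLimit u τ * ∑ i, F.wt τ i * φ i =
      ∑ α, (2 * ∑ β, ∑ γ, F.coeff θ (.inl (α, β, γ)) + F.coeff θ (.inr α)) *
        u (F.idx α) * φ (F.idx α) := by
  obtain ⟨R, hR⟩ : ∃ R : ι → ι → ι → ℝ, ∀ α β γ, F.coeff θ (.inl (α, β, γ)) = R α β γ :=
    ⟨_, fun _ _ _ => rfl⟩
  have hRsymm : ∀ α β γ, R β α γ = R α β γ := fun α β γ => by
    rw [← hR, ← hR]
    simp only [coeff]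
    rw [F.structConst_swap, neg_sq]
  have hRskew : ∀ α β γ, R α γ β * u (F.idx α) = R α β γ * u (F.idx α) := fun α β γ => by
    by_cases hα : u (F.idx α) = 0
    · rw [hα, mul_zero, mul_zero]
    · rw [← hR, ← hR]
      simp only [coeff]
      rw [F.structConst_skew M hu hα, neg_sq]
  have e1 : ∑ α, ∑ β, ∑ γ, R α β γ * u (F.idx α) * (φ (F.idx α) + φ (F.idx β) - φ (F.idx γ)) =
      ∑ α, (∑ β, ∑ γ, R α β γ) * u (F.idx α) * φ (F.idx α) := by
    refine Finset.sum_congr rfl fun α _ => ?_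
    -- Skewness of ad e_α exchanges β and γ, so ε_β and -ε_γ cancel in the sum and only ε_α remains.
    have h1 : ∑ β, ∑ γ, R α β γ * u (F.idx α) * φ (F.idx γ) =
        ∑ β, ∑ γ, R α β γ * u (F.idx α) * φ (F.idx β) := by
      rw [Finset.sum_comm]
      exact Finset.sum_congr rfl fun β _ => Finset.sum_congr rfl fun γ _ => by rw [hRskew]
    simp only [mul_sub, mul_add, Finset.sum_sub_distrib, Finset.sum_add_distrib, h1,
      add_sub_cancel_right, Finset.sum_mul]
  have e2 : ∑ α, ∑ β, ∑ γ, R α β γ * u (F.idx β) * (φ (F.idx α) + φ (F.idx β) - φ (F.idx γ)) =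
      ∑ α, ∑ β, ∑ γ, R α β γ * u (F.idx α) * (φ (F.idx α) + φ (F.idx β) - φ (F.idx γ)) := by
    rw [Finset.sum_comm]
    exact Finset.sum_congr rfl fun α _ => Finset.sum_congr rfl fun β _ =>
      Finset.sum_congr rfl fun γ _ => by rw [hRsymm, add_comm (φ (F.idx β))]
  simp only [F.sum_wt_mul, Fintype.sum_sum_type, Fintype.sum_prod_type, flatLimit, hR]
  simp only [mul_add (R _ _ _), add_mul (R _ _ _ * _), Finset.sum_add_distrib]
  rw [e2, e1, ← two_mul, Finset.mul_sum, ← Finset.sum_add_distrib]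
  exact Finset.sum_congr rfl fun α _ => by ring

end Splitting

/-! ### The moment map near a flat point. -/

namespace Splitting

variable {𝔤 : Type*} [LieRing 𝔤] [LieAlgebra ℝ 𝔤] [FiniteDimensional ℝ 𝔤]
  {𝔥 : Submodule ℝ 𝔤} {d : ℕ} {S : Splitting 𝔥 d} {g₁ Q : LinearMap.BilinForm ℝ 𝔤}
  {Γ : Set (𝔤 →ₗ[ℝ] 𝔤)}
  (M : S.IsReductiveModel g₁ Q Γ) {ι : Type*} [Fintype ι] (F : S.Frame g₁ ι)

/-- The point of the simplex to which the moment map tends along the curve of metrics shrinking the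
flat summands. -/
def Frame.flatPoint (θ : ℝ) (u : Fin d → ℝ) (l : Fin d) : ℝ :=
  ∑ α, (2 * ∑ β, ∑ γ, F.coeff θ (.inl (α, β, γ)) + F.coeff θ (.inr α)) *
    u (F.idx α) * if F.idx α = l then 1 else 0

section

include M

variable {θ : ℝ} {u x : Fin d → ℝ}

lemma Frame.sum_coeff_flatLimit_wt (hu : S.IsFlatWeight u) (l : Fin d) :
    ∑ τ, F.coeff θ τ * F.flatLimit u τ * F.wt τ l = F.flatPoint θ u l := by
  have := F.sum_coeff_mul_flatLimit M hu θ fun j => if j = l then 1 else 0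
  simpa only [mul_ite, mul_one, mul_zero, Finset.sum_ite_eq', Finset.mem_univ, if_true,
    flatPoint] using this

lemma Frame.sum_coeff_flatLimit (hu : S.IsFlatWeight u) (h1 : ∑ l, F.flatPoint θ u l = 1) :
    ∑ τ, F.coeff θ τ * F.flatLimit u τ = 1 := by
  rw [← h1]
  simp only [← F.sum_coeff_flatLimit_wt M hu]
  rw [Finset.sum_comm]
  simp only [← Finset.mul_sum, F.sum_wt, mul_one]

/-- Multiply numerator and denominator by r; the normalization makes r ℓ_θ tend to 1. -/
lemma Frame.tendsto_monom_flatCurve (hu : S.IsFlatWeight u) (h1 : ∑ l, F.flatPoint θ u l = 1)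
    (τ : (ι × ι × ι) ⊕ ι) (hτ : F.coeff 0 τ ≠ 0) :
    Filter.Tendsto (fun s => F.monom s τ / S.ell θ (S.metric g₁ s))
      (Filter.map (flatCurve u) (𝓝[>] 0)) (𝓝 (F.flatLimit u τ)) := by
  have hell : Filter.Tendsto (fun r => ∑ τ, F.coeff θ τ * (r * F.monom (flatCurve u r) τ))
      (𝓝[>] 0) (𝓝 1) := by
    rw [← F.sum_coeff_flatLimit M hu h1]
    refine tendsto_finsetSum _ fun τ _ => ?_
    by_cases hτ : F.coeff 0 τ = 0
    · simp only [F.coeff_eq θ, hτ, mul_zero, zero_mul]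
      exact tendsto_const_nhds
    · exact (F.tendsto_mul_monom M hu hτ).const_mul _
  have h2 := (F.tendsto_mul_monom M hu hτ).div hell one_ne_zero
  rw [div_one] at h2
  rw [Filter.tendsto_map'_iff]
  refine h2.congr' ?_
  filter_upwards [eventually_mem_nhdsWithin] with r hr
  have hr' : (0 : ℝ) < r := hr
  rw [Function.comp_apply, ell_eq M F θ (hu.flatCurve_pos hr')]
  rw [Pi.div_apply]
  simp only [mul_left_comm _ r, ← Finset.mul_sum]
  rw [mul_div_mul_left _ _ hr'.ne']

lemma eventually_flatCurve_pos (hu : S.IsFlatWeight u) :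
    ∀ᶠ s in Filter.map (flatCurve u) (𝓝[>] 0), ∀ i, 0 < s i := by
  rw [Filter.eventually_map]
  filter_upwards [eventually_mem_nhdsWithin] with r hr
  exact hu.flatCurve_pos hr

lemma approach_neBot (hu : S.IsFlatWeight u) (hx : ∀ l, F.flatPoint θ u l = x l)
    (h1 : ∑ l, x l = 1) : (S.approach θ g₁ x).NeBot := by
  have hl := eventually_flatCurve_pos M hu
  have h1' : ∑ l, F.flatPoint θ u l = 1 := by simp only [hx, h1]
  have hle : Filter.map (flatCurve u) (𝓝[>] 0) ≤ S.approach θ g₁ x := by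
    refine le_inf ?_ (Filter.le_principal_iff.2 hl)
    rw [← Filter.tendsto_iff_comap]
    refine tendsto_pi_nhds.2 fun i => ?_
    have := tendsto_moment M F (θ := θ) hl (F.tendsto_monom_flatCurve M hu h1') i
    rwa [F.sum_coeff_flatLimit_wt M hu, hx] at this
  exact Filter.NeBot.mono inferInstance hle

/-- The shrinking curve is one way of approaching x. By `limit_unique` every ultrafilter approaching
x yields the same limits. -/
lemma tendsto_monom_approach (hθ : |θ| < 1) (hF : ∃ τ, F.coeff 0 τ ≠ 0)
    (hu : S.IsFlatWeight u) (hx : ∀ l, F.flatPoint θ u l = x l)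
    (h1 : ∑ l, x l = 1) (τ : (ι × ι × ι) ⊕ ι) (hτ : F.coeff 0 τ ≠ 0) :
    Filter.Tendsto (fun s => F.monom s τ / S.ell θ (S.metric g₁ s)) (S.approach θ g₁ x)
      (𝓝 (F.flatLimit u τ)) := by
  have h1' : ∑ l, F.flatPoint θ u l = 1 := by simp only [hx, h1]
  have happ := approach_spec S g₁ (θ := θ) (x := x)
  rw [Filter.tendsto_iff_ultrafilter]
  intro 𝒰 h𝒰
  have hl := happ.1.filter_mono h𝒰
  have hl' := eventually_flatCurve_pos M hu
  have hP' := F.tendsto_monom_flatCurve M hu h1'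
  obtain ⟨P, -, hP⟩ := exists_tendsto_monom_div_ell M F hθ hF 𝒰 hl
  rw [← limit_unique M F hθ hF hl hl' hP hP' (fun i => ?_) hτ]
  · exact hP τ hτ
  · rw [F.sum_coeff_flatLimit_wt M hu, hx]
    exact tendsto_nhds_unique (tendsto_moment M F hl hP i) ((happ.2 i).mono_left h𝒰)

lemma Frame.sum_coeff_zero_flatLimit_pos (hu : S.IsFlatWeight u)
    (h1 : ∑ l, F.flatPoint θ u l = 1) : 0 < ∑ τ, F.coeff 0 τ * F.flatLimit u τ := by
  have hnn : ∀ τ, 0 ≤ F.coeff 0 τ * F.flatLimit u τ := fun τ =>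
    mul_nonneg (F.coeff_nonneg M (by simp) τ) (F.flatLimit_nonneg hu τ)
  refine lt_of_le_of_ne (Finset.sum_nonneg fun τ _ => hnn τ) fun h0 => ?_
  have h2 := (Finset.sum_eq_zero_iff_of_nonneg fun τ _ => hnn τ).1 h0.symm
  have h3 := F.sum_coeff_flatLimit M hu h1
  rw [Finset.sum_eq_zero] at h3
  · exact zero_ne_one h3
  · intro τ hτ
    rw [F.coeff_eq, mul_assoc, h2 τ hτ, mul_zero]

/-- The moment map is normalized by ℓ_θ but the bracket by ℓ₀; the limit of ℓ₀/ℓ_θ converts one into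
the other. -/
lemma tendsto_monom_approach_zero (hθ : |θ| < 1) (hF : ∃ τ, F.coeff 0 τ ≠ 0)
    (hu : S.IsFlatWeight u) (hx : ∀ l, F.flatPoint θ u l = x l)
    (h1 : ∑ l, x l = 1) (τ : (ι × ι × ι) ⊕ ι) (hτ : F.coeff 0 τ ≠ 0) :
    Filter.Tendsto (fun s => F.monom s τ / S.ell 0 (S.metric g₁ s)) (S.approach θ g₁ x)
      (𝓝 (F.flatLimit u τ / ∑ σ, F.coeff 0 σ * F.flatLimit u σ)) := by
  have h1' : ∑ l, F.flatPoint θ u l = 1 := by simp only [hx, h1]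
  have hP := tendsto_monom_approach M F hθ hF hu hx h1
  have hl : ∀ᶠ s in S.approach θ g₁ x, ∀ i, 0 < s i :=
    Filter.mem_inf_of_right (Filter.mem_principal_self _)
  refine ((hP τ hτ).div (tendsto_ell_div_ell M F 0 hl hP)
    (F.sum_coeff_zero_flatLimit_pos M hu h1').ne').congr' ?_
  filter_upwards [hl] with s hs
  have := (ell_pos M F hθ hF hs).ne'
  rw [Pi.div_apply, div_div_div_cancel_right₀ this]

end

end Splitting

/-! ### The limit bracket at a flat point and its curvature. -/

namespace Splitting

variable {𝔤 : Type*} [LieRing 𝔤] [LieAlgebra ℝ 𝔤] [FiniteDimensional ℝ 𝔤]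
  {𝔥 : Submodule ℝ 𝔤} {d : ℕ} {S : Splitting 𝔥 d} {g₁ Q : LinearMap.BilinForm ℝ 𝔤}
  {Γ : Set (𝔤 →ₗ[ℝ] 𝔤)}

/-- The operator which is `tᵢ` on `𝔪ᵢ` and zero on `𝔥`. -/
def weighted (S : Splitting 𝔥 d) (t : Fin d → ℝ) : 𝔤 →ₗ[ℝ] 𝔤 := ∑ i, t i • S.proj i

lemma weighted_apply (t : Fin d → ℝ) (X : 𝔤) : S.weighted t X = ∑ i, t i • S.proj i X := by
  simp [weighted]

lemma weighted_of_mem_𝔥 (t : Fin d → ℝ) {X : 𝔤} (hX : X ∈ 𝔥) : S.weighted t X = 0 := by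
  rw [weighted_apply]
  exact Finset.sum_eq_zero fun i _ => by rw [S.proj_of_mem_𝔥 i hX, smul_zero]

lemma weighted_of_mem_comp (t : Fin d → ℝ) {i : Fin d} {X : 𝔤} (hX : X ∈ S.comp i) :
    S.weighted t X = t i • X := by
  rw [weighted_apply, Finset.sum_eq_single i, S.proj_of_mem hX]
  · intro j _ hj; rw [S.proj_of_mem_ne hj.symm hX, smul_zero]
  · simp

/-- The projection onto `𝔪` as an operator. -/
def projEnd (S : Splitting 𝔥 d) : 𝔤 →ₗ[ℝ] 𝔤 := S.𝔪.subtype ∘ₗ S.projM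

/-- The limit bracket at a flat point. -/
def flatBracket (S : Splitting 𝔥 d) (t : Fin d → ℝ) : 𝔤 →ₗ[ℝ] 𝔤 →ₗ[ℝ] 𝔤 :=
  (lieBracket 𝔤).comp S.projH + (lieBracket 𝔤).compl₁₂ S.projEnd S.projH +
    ((lieBracket 𝔤).compl₁₂ (S.weighted t) S.projEnd +
      (lieBracket 𝔤).compl₁₂ S.projEnd (S.weighted t)).compr₂ S.projEnd

lemma flatBracket_apply (t : Fin d → ℝ) (X Y : 𝔤) : S.flatBracket t X Y =
    ⁅S.projH X, Y⁆ + ⁅(S.projM X : 𝔤), S.projH Y⁆ +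
      (S.projM (⁅S.weighted t X, (S.projM Y : 𝔤)⁆ + ⁅(S.projM X : 𝔤), S.weighted t Y⁆) : 𝔤) := rfl

lemma flatBracket_of_mem_𝔥 (t : Fin d → ℝ) {X : 𝔤} (hX : X ∈ 𝔥) (Y : 𝔤) :
    S.flatBracket t X Y = ⁅X, Y⁆ := by
  simp [flatBracket_apply, S.projH_of_mem hX, S.projM_of_mem_𝔥 hX, weighted_of_mem_𝔥 t hX]

lemma flatBracket_of_mem_𝔥_right (t : Fin d → ℝ) {X Y : 𝔤} (hX : X ∈ S.𝔪) (hY : Y ∈ 𝔥) :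
    S.flatBracket t X Y = ⁅X, Y⁆ := by
  simp [flatBracket_apply, S.projH_of_mem hY, S.projM_of_mem_𝔥 hY, weighted_of_mem_𝔥 t hY,
    S.projH_of_mem_𝔪 hX, S.projM_of_mem hX]

lemma flatBracket_of_mem_𝔪 (t : Fin d → ℝ) {X Y : 𝔤} (hX : X ∈ S.𝔪) (hY : Y ∈ S.𝔪) :
    S.flatBracket t X Y = S.projM (⁅S.weighted t X, Y⁆ + ⁅X, S.weighted t Y⁆) := by
  simp [flatBracket_apply, S.projH_of_mem_𝔪 hY, S.projM_of_mem hY,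
    S.projH_of_mem_𝔪 hX, S.projM_of_mem hX]

lemma flatBracket_of_mem_comp (t : Fin d → ℝ) {i j : Fin d} {X Y : 𝔤} (hX : X ∈ S.comp i)
    (hY : Y ∈ S.comp j) : S.flatBracket t X Y = ∑ k, (t i + t j) • S.proj k ⁅X, Y⁆ := by
  rw [flatBracket_of_mem_𝔪 t (S.comp_le_𝔪 i hX) (S.comp_le_𝔪 j hY), weighted_of_mem_comp t hX,
    weighted_of_mem_comp t hY, smul_lie, lie_smul, ← add_smul, map_smul, Submodule.coe_smul,
    S.coe_projM, Finset.smul_sum]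

section Limit

variable (M : S.IsReductiveModel g₁ Q Γ) {ι : Type*} [Fintype ι] (F : S.Frame g₁ ι)
  [TopologicalSpace 𝔤] [IsTopologicalAddGroup 𝔤] [ContinuousSMul ℝ 𝔤]

include M

lemma tendsto_interiorBracket_flat {θ : ℝ} {u x : Fin d → ℝ} (hθ : |θ| < 1)
    (hF : ∃ τ, F.coeff 0 τ ≠ 0)
    (hu : S.IsFlatWeight u) (hx : ∀ l, F.flatPoint θ u l = x l) (h1 : ∑ l, x l = 1) :
    ∃ t : Fin d → ℝ, (∀ i, t i ≠ 0 → u i ≠ 0) ∧ ∀ Y Z : 𝔤,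
      Filter.Tendsto (fun s => S.interiorBracket g₁ s Y Z) (S.approach θ g₁ x)
        (𝓝 (S.flatBracket t Y Z)) := by
  set N := ∑ σ, F.coeff 0 σ * F.flatLimit u σ with hN
  set L := S.ell 0 g₁ with hL
  have hl : ∀ᶠ s in S.approach θ g₁ x, ∀ i, 0 < s i :=
    Filter.mem_inf_of_right (Filter.mem_principal_self _)
  have hP := tendsto_monom_approach_zero M F hθ hF hu hx h1
  -- This is the limit of 1/a_i on every noncentral summand.
  set t : Fin d → ℝ := fun i => √(L * (u i / N)) with ht
  have ht0 : ∀ i, t i ≠ 0 → u i ≠ 0 := fun i h h0 => h (by simp [ht, h0])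
  refine ⟨t, ht0, fun Y Z => ?_⟩
  induction Y using S.induction with
  | hadd Y Y' h h' =>
    simp only [map_add, LinearMap.add_apply]
    exact h.add h'
  | h𝔥 Y hY =>
    rw [flatBracket_of_mem_𝔥 t hY]
    refine tendsto_const_nhds.congr' ?_
    filter_upwards [hl] with s hs
    exact (interiorBracket_of_mem_𝔥 M (fun i => (scaling_pos M F hF hs i).ne') hY Z).symm
  | hcomp i Y hY =>
    induction Z using S.induction with
    | hadd Z Z' h h' =>
      simp only [map_add]
      exact h.add h'
    | h𝔥 Z hZ =>
      rw [flatBracket_of_mem_𝔥_right t (S.comp_le_𝔪 i hY) hZ]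
      refine tendsto_const_nhds.congr' ?_
      filter_upwards [hl] with s hs
      rw [interiorBracket_swap,
        interiorBracket_of_mem_𝔥 M (fun i => (scaling_pos M F hF hs i).ne') hZ, lie_skew]
    | hcomp j Z hZ =>
      rw [flatBracket_of_mem_comp t hY hZ]
      simp only [interiorBracket_comp _ hY hZ]
      have hH : Filter.Tendsto (fun s => ((S.scaling g₁ s i)⁻¹ * (S.scaling g₁ s j)⁻¹) •
          S.projH ⁅Y, Z⁆) (S.approach θ g₁ x) (𝓝 0) := by
        by_cases h0 : ⁅Y, Z⁆ = 0
        · simp only [h0, map_zero, smul_zero]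
          exact tendsto_const_nhds
        obtain ⟨α, hα, hαc⟩ := exists_coeff_ne_zero_of_not_central M F hY h0
        obtain ⟨β, hβ, hβc⟩ := exists_coeff_ne_zero_of_not_central M F (Y := Y) hZ (by
          rw [← lie_skew]; exact neg_ne_zero.2 h0)
        have l1 := tendsto_scaling_inv M F hF hl hP hαc
        have l2 := tendsto_scaling_inv M F hF hl hP hβc
        rw [hα] at l1
        rw [hβ] at l2
        have l3 := (l1.mul l2).smul_const (S.projH ⁅Y, Z⁆)
        refine l3.trans_eq ?_
        congr 1
        -- The 𝔥-part disappears in the limit: if both factors were nonzero, the two summands would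
        -- commute.
        have hz : t i * t j = 0 := by
          by_contra hne
          obtain ⟨hi, hj⟩ := mul_ne_zero_iff.1 hne
          exact h0 (hu.abelian i j (ht0 i hi) (ht0 j hj) Y hY Z hZ)
        have e1 : √(L * (F.flatLimit u (.inr α) / N)) = t i := by rw [← hα]; rfl
        have e2 : √(L * (F.flatLimit u (.inr β) / N)) = t j := by rw [← hβ]; rfl
        rw [e1, e2, hz, zero_smul]
      rw [← zero_add (∑ k, (t i + t j) • S.proj k ⁅Y, Z⁆)]
      refine hH.add (tendsto_finsetSum _ fun k _ => ?_)
      by_cases hk : S.proj k ⁅Y, Z⁆ = 0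
      · simp only [hk, smul_zero]
        exact tendsto_const_nhds
      have hex : ∃ α β γ, F.idx α = i ∧ F.idx β = j ∧ F.idx γ = k ∧ F.structConst α β γ ≠ 0 := by
        by_contra! hno
        exact hk (proj_lie_eq_zero M F hno hY hZ)
      obtain ⟨α, β, γ, hα, hβ, hγ, hne⟩ := hex
      have hcoeff : F.coeff 0 (.inl (α, β, γ)) ≠ 0 := by
        simp only [Frame.coeff]
        positivity
      have l1 := (tendsto_scaling_ratio M F hF hl hP hcoeff).smul_const (S.proj k ⁅Y, Z⁆)
      rw [hα, hβ, hγ] at l1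
      refine l1.trans_eq ?_
      congr 2
      have e1 : F.flatLimit u (.inl (α, β, γ)) = u i + u j := by rw [← hα, ← hβ]; rfl
      rw [e1]
      -- The square root is additive here because u i or u j is zero when the bracket is not.
      change √(L * ((u i + u j) / N)) = √(L * (u i / N)) + √(L * (u j / N))
      by_cases hi : u i = 0
      · rw [hi, zero_add, zero_div, mul_zero, Real.sqrt_zero, zero_add]
      · have hj : u j = 0 := by
          by_contra hj
          exact hne (F.structConst_eq_zero hu (hα ▸ hi) (hβ ▸ hj) γ)
        rw [hj, add_zero, zero_div, mul_zero, Real.sqrt_zero, add_zero]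

end Limit

section Flat

variable (M : S.IsReductiveModel g₁ Q Γ) {u t : Fin d → ℝ} (hu : S.IsFlatWeight u)
  (ht : ∀ i, t i ≠ 0 → u i ≠ 0)

include hu ht in
lemma lie_weighted_weighted (X Y : 𝔤) : ⁅S.weighted t X, S.weighted t Y⁆ = 0 := by
  rw [weighted_apply, weighted_apply, sum_lie]
  refine Finset.sum_eq_zero fun i _ => ?_
  rw [lie_sum]
  refine Finset.sum_eq_zero fun j _ => ?_
  rw [smul_lie, lie_smul]
  by_cases hi : t i = 0
  · rw [hi, zero_smul]
  by_cases hj : t j = 0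
  · rw [hj, zero_smul, smul_zero]
  rw [hu.abelian i j (ht i hi) (ht j hj) _ (S.proj_mem i X) _ (S.proj_mem j Y), smul_zero,
    smul_zero]

include hu ht in
lemma lie_𝔥_weighted {X : 𝔤} (hX : X ∈ 𝔥) (Y : 𝔤) : ⁅X, S.weighted t Y⁆ = 0 := by
  rw [weighted_apply, lie_sum]
  refine Finset.sum_eq_zero fun i _ => ?_
  rw [lie_smul]
  by_cases hi : t i = 0
  · rw [hi, zero_smul]
  · rw [hu.fixed i (ht i hi) X hX _ (S.proj_mem i Y), smul_zero]

include M hu ht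

lemma weighted_skew (X Y Z : 𝔤) :
    g₁ ⁅S.weighted t X, Y⁆ Z = -g₁ Y ⁅S.weighted t X, Z⁆ :=
  M.skew_commutant _ (fun _ hW => lie_𝔥_weighted hu ht hW X) Y Z

/-- A component V in a summand with t i ≠ 0 lies in the image of the weighted operator, so it
commutes with the weighted X; by skewness V is then orthogonal to the bracket, that is, to itself.
-/
lemma weighted_lie_weighted (X Y : 𝔤) : S.weighted t ⁅S.weighted t X, Y⁆ = 0 := by
  rw [weighted_apply]
  refine Finset.sum_eq_zero fun i _ => ?_
  by_cases hi : t i = 0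
  · rw [hi, zero_smul]
  set V := S.proj i ⁅S.weighted t X, Y⁆ with hV
  have hVm : V ∈ S.comp i := S.proj_mem i _
  have h1 : g₁ V V = 0 := by
    conv_lhs => rw [hV]
    rw [apply_proj_right M.metric M.orthogonal hVm, M.metric.symm, weighted_skew M hu ht]
    have h2 : V = S.weighted t ((t i)⁻¹ • V) := by
      rw [map_smul, weighted_of_mem_comp t hVm, smul_smul, inv_mul_cancel₀ hi, one_smul]
    rw [h2, lie_weighted_weighted hu ht, map_zero, neg_zero]
  rw [M.metric.eq_zero (S.comp_le_𝔪 i hVm) h1, smul_zero]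

/-- On 𝔪 the bracket has the form D(X)Y - D(Y)X with D(X) skew for g₁, so the Koszul formula returns
D(X)Y. -/
lemma nomizu_flatBracket (X Y : S.𝔪) :
    S.nomizu (S.flatBracket t) g₁ X Y = S.projM ⁅S.weighted t X, (Y : 𝔤)⁆ := by
  refine M.metric.eq_of_forall fun Z => ?_
  have e : ∀ X Y : S.𝔪, ∀ Z : 𝔤, g₁ (S.flatBracket t X Y) Z =
      g₁ ⁅S.weighted t X, (Y : 𝔤)⁆ Z - g₁ ⁅S.weighted t Y, (X : 𝔤)⁆ Z := fun X Y Z => by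
    rw [flatBracket_of_mem_𝔪 t X.2 Y.2, M.metric.projM_left, ← lie_skew (X : 𝔤), map_add, map_neg,
      LinearMap.add_apply, LinearMap.neg_apply, sub_eq_add_neg]
  rw [M.metric.nomizu_apply, M.metric.projM_left, e, e, e]
  have s1 := weighted_skew M hu ht Y Z X
  have s2 := weighted_skew M hu ht Z Y X
  rw [M.metric.symm Z] at s1
  rw [M.metric.symm Y] at s2
  have s3 := weighted_skew M hu ht X Z Y
  rw [M.metric.symm Z] at s3
  linarith

/-- The Nomizu operators come from derivations of 𝔤 that commute by the Jacobi identity, since the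
weighted vectors commute. They vanish on brackets of 𝔪, and such brackets have no 𝔥-part. -/
lemma isLocallyEuclidean_flatBracket : S.IsLocallyEuclidean (S.flatBracket t) g₁ := by
  intro X Y Z
  have hn := nomizu_flatBracket M hu ht
  have hH : S.projH (S.flatBracket t X Y) = 0 := by
    rw [flatBracket_of_mem_𝔪 t X.2 Y.2]
    exact S.projH_of_mem_𝔪 (S.projM _).2
  have hcomp : ∀ (X : 𝔤) (V : 𝔤), ⁅S.weighted t X, (S.projM V : 𝔤)⁆ = ⁅S.weighted t X, V⁆ := by
    intro X V
    conv_rhs => rw [← S.projH_add_projM V, lie_add, ← lie_skew,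
      lie_𝔥_weighted hu ht (S.projH_mem V), neg_zero, zero_add]
  have hw : ∀ V : 𝔤, S.weighted t (S.projM V) = S.weighted t V := fun V => by
    conv_rhs => rw [← S.projH_add_projM V, map_add, weighted_of_mem_𝔥 t (S.projH_mem V), zero_add]
  have hW : S.weighted t (S.projM (S.flatBracket t X Y)) = 0 := by
    rw [hw, flatBracket_of_mem_𝔪 t X.2 Y.2, hw, map_add, weighted_lie_weighted M hu ht,
      ← lie_skew (X : 𝔤), map_neg, weighted_lie_weighted M hu ht, neg_zero, add_zero]
  rw [riemann_apply, hn, hn, hn, hn, hn, hH, hW, hcomp, hcomp, zero_lie, map_zero, map_zero,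
    LinearMap.zero_apply, map_zero, sub_zero, sub_zero, ← map_sub]
  have h1 := leibniz_lie (S.weighted t X) (S.weighted t Y) (Z : 𝔤)
  rw [lie_weighted_weighted hu ht, zero_lie, zero_add] at h1
  rw [h1, sub_self, map_zero]

end Flat

end Splitting

/-! ### From commuting summands to a flat point at infinity. -/

/-- A point at which a nonconstant linear function attains its maximum lies on the frontier. -/
lemma mem_intrinsicFrontier_of_forall_le {V : Type*} [NormedAddCommGroup V] [NormedSpace ℝ V]
    {s : Set V} {x y : V} (hx : x ∈ s) (f : V →ₗ[ℝ] ℝ) (hf : ∀ z ∈ s, f z ≤ f x) (hy : y ∈ s)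
    (hfy : f y < f x) : x ∈ intrinsicFrontier ℝ s := by
  rw [← intrinsicClosure_sdiff_intrinsicInterior]
  refine ⟨subset_intrinsicClosure hx, fun hint => ?_⟩
  obtain ⟨x', hx', hxx'⟩ := mem_intrinsicInterior.1 hint
  have hxs := subset_affineSpan ℝ s hx
  have hys := subset_affineSpan ℝ s hy
  set g : ℝ → affineSpan ℝ s := fun t =>
    ⟨AffineMap.lineMap x y t, AffineMap.lineMap_mem t hxs hys⟩ with hg
  have hgc : Continuous g := AffineMap.lineMap_continuous.subtype_mk _
  have hg0 : g 0 = x' := Subtype.ext (by simp [hg, hxx'])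
  have hev : ∀ᶠ t in 𝓝 (0 : ℝ), g t ∈ interior ((↑) ⁻¹' s : Set (affineSpan ℝ s)) :=
    hgc.continuousAt.eventually_mem (by rw [hg0]; exact isOpen_interior.mem_nhds hx')
  -- A negative parameter continues the segment from y past x, where f would exceed its maximum.
  have hev' : ∀ᶠ t in 𝓝[<] (0 : ℝ), g t ∈ interior ((↑) ⁻¹' s : Set (affineSpan ℝ s)) :=
    hev.filter_mono nhdsWithin_le_nhds
  obtain ⟨t, ht, ht0⟩ := (hev'.and eventually_mem_nhdsWithin).exists
  have ht0' : t < 0 := ht0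
  have h0 : g t ∈ ((↑) ⁻¹' s : Set (affineSpan ℝ s)) := interior_subset ht
  have h1 : AffineMap.lineMap x y t ∈ s := h0
  have h2 := hf _ h1
  rw [AffineMap.lineMap_apply_module, map_add, map_smul, map_smul, smul_eq_mul, smul_eq_mul] at h2
  nlinarith

namespace Splitting

variable {𝔤 : Type*} [LieRing 𝔤] [LieAlgebra ℝ 𝔤] [FiniteDimensional ℝ 𝔤]
  {𝔥 : Submodule ℝ 𝔤} {d : ℕ} {S : Splitting 𝔥 d} {g₁ Q : LinearMap.BilinForm ℝ 𝔤}
  {Γ : Set (𝔤 →ₗ[ℝ] 𝔤)}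

lemma mem_simplex_of_mem_convexHull {I : Set (Fin d)} {x : Fin d → ℝ}
    (hx : x ∈ convexHull ℝ (weight '' I)) :
    (∀ i, 0 ≤ x i) ∧ (∀ i, i ∉ I → x i = 0) ∧ ∑ i, x i = 1 := by
  have hconv : Convex ℝ {x : Fin d → ℝ | (∀ i, 0 ≤ x i) ∧ (∀ i, i ∉ I → x i = 0) ∧
      ∑ i, x i = 1} := by
    intro x hx y hy a b ha hb hab
    refine ⟨fun i => ?_, fun i hi => ?_, ?_⟩
    · exact add_nonneg (mul_nonneg ha (hx.1 i)) (mul_nonneg hb (hy.1 i))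
    · simp [hx.2.1 i hi, hy.2.1 i hi]
    · simp only [Pi.add_apply, Pi.smul_apply, smul_eq_mul, Finset.sum_add_distrib,
        ← Finset.mul_sum, hx.2.2, hy.2.2, mul_one, hab]
  refine convexHull_min ?_ hconv hx
  rintro _ ⟨i, hi, rfl⟩
  refine ⟨fun j => ?_, fun j hj => ?_, ?_⟩
  · simp only [weight, Pi.single_apply]
    split_ifs <;> norm_num
  · have : j ≠ i := fun h => hj (h ▸ hi)
    simp [weight, this]
  · simp [weight]

section

variable (M : S.IsReductiveModel g₁ Q Γ) {I : Set (Fin d)} {x : Fin d → ℝ}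
  (hab : ∀ X ∈ S.𝔪sub I, ∀ Y ∈ S.𝔪sub I, ⁅X, Y⁆ = 0)
  (hfix : ∀ X ∈ S.𝔪sub I, ∀ Y ∈ 𝔥, ⁅X, Y⁆ = 0)
  (hcen : S.𝔪sub I ⊓ (LieAlgebra.center ℝ 𝔤).toSubmodule = ⊥)
  (hx : x ∈ convexHull ℝ (weight '' I))

include M hcen

lemma exists_lie_ne_zero {i : Fin d} (hi : i ∈ I) : ∃ X ∈ S.comp i, ∃ Y : 𝔤, ⁅X, Y⁆ ≠ 0 := by
  by_contra! h
  refine M.ne_bot i ((Submodule.eq_bot_iff _).2 fun X hX => ?_)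
  have h1 : X ∈ S.𝔪sub I ⊓ (LieAlgebra.center ℝ 𝔤).toSubmodule := by
    refine ⟨mem_𝔪sub hi hX, (LieModule.mem_maxTrivSubmodule ℝ 𝔤 𝔤 X).2 fun Y => ?_⟩
    rw [← lie_skew, h X hX Y, neg_zero]
  rw [hcen] at h1
  exact (Submodule.mem_bot ℝ).1 h1

include hab hfix hx

theorem mem_infinity : x ∈ S.infinity g₁ := by
  obtain ⟨hx0, hxI, hx1⟩ := mem_simplex_of_mem_convexHull hx
  have hkill : ∀ i ∈ I, ∃ X ∈ S.comp i, ∃ Y ∈ S.comp i, killingForm ℝ 𝔤 X Y ≠ 0 := by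
    intro i hi
    obtain ⟨X, hX, Y, hXY⟩ := exists_lie_ne_zero M hcen hi
    exact ⟨X, hX, X, hX, fun h => hXY (M.lie_eq_zero_of_killingForm_eq_zero h Y)⟩
  classical
  -- A supporting functional of Δ at x: it exceeds 1 on ε_i+ε_j-ε_k only if i and j are in I, and
  -- then [𝔪ᵢ,𝔪ⱼ] = 0.
  set f : (Fin d → ℝ) →ₗ[ℝ] ℝ := ∑ i, (if i ∈ I then (1 : ℝ) else 0) • LinearMap.proj i with hf
  have hfa : ∀ y, f y = ∑ i, (if i ∈ I then (1 : ℝ) else 0) * y i := fun y => by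
    rw [hf, LinearMap.sum_apply]
    rfl
  have hfw : ∀ i, f (weight i) = if i ∈ I then 1 else 0 := fun i => by
    rw [hfa]; simp [weight, Pi.single_apply]
  have hfx : f x = 1 := by
    rw [hfa]
    refine (Finset.sum_congr rfl fun i _ => ?_).trans hx1
    split_ifs with h
    · rw [one_mul]
    · rw [zero_mul, hxI i h]
  have hxΔ : x ∈ S.polytope g₁ := by
    refine convexHull_mono ?_ hx
    rintro _ ⟨i, hi, rfl⟩
    exact Or.inr ⟨i, hkill i hi, rfl⟩
  have hle : ∀ z ∈ S.polytope g₁, f z ≤ f x := by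
    intro z hz
    rw [hfx]
    refine convexHull_min (t := {z | f z ≤ 1}) ?_ (convex_halfSpace_le f.isLinear 1) hz
    rintro _ (⟨i, j, k, ⟨X, hX, Y, hY, Z, hZ, hXYZ⟩, rfl⟩ | ⟨r, -, rfl⟩)
    · simp only [Set.mem_ofPred_eq, map_sub, map_add, hfw]
      by_cases hi : i ∈ I
      · by_cases hj : j ∈ I
        · rw [hab X (mem_𝔪sub hi hX) Y (mem_𝔪sub hj hY)] at hXYZ
          simp at hXYZ
        · rw [if_pos hi, if_neg hj]; split_ifs <;> norm_num
      · rw [if_neg hi]; split_ifs <;> norm_num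
    · simp only [Set.mem_ofPred_eq, hfw]
      split_ifs <;> norm_num
  -- Otherwise every summand outside I is central, so 𝔪_I commutes with all of 𝔤, contrary to its
  -- trivial intersection with the centre.
  have hex : ∃ r, r ∉ I ∧ ∃ X ∈ S.comp r, ∃ Y ∈ S.comp r, killingForm ℝ 𝔤 X Y ≠ 0 := by
    by_contra! hno
    obtain ⟨i, hi⟩ : I.Nonempty := by
      rw [← Set.image_nonempty (f := weight), ← convexHull_nonempty_iff (𝕜 := ℝ)]
      exact ⟨x, hx⟩
    obtain ⟨X, hX, Y, hXY⟩ := exists_lie_ne_zero M hcen hi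
    refine hXY ?_
    induction Y using S.induction with
    | h𝔥 Y hY => exact hfix X (mem_𝔪sub hi hX) Y hY
    | hcomp j Y hY =>
      by_cases hj : j ∈ I
      · exact hab X (mem_𝔪sub hi hX) Y (mem_𝔪sub hj hY)
      · rw [← lie_skew, M.lie_eq_zero_of_killingForm_eq_zero (hno j hj Y hY Y hY), neg_zero]
    | hadd Y Y' h h' =>
      by_contra hne
      rw [lie_add] at hne
      by_cases h0 : ⁅X, Y⁆ = 0
      · by_cases h0' : ⁅X, Y'⁆ = 0
        · rw [h0, h0', add_zero] at hne; exact hne rfl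
        · exact h0' (h' h0')
      · exact h0 (h h0)
  obtain ⟨r, hr, hrk⟩ := hex
  refine mem_intrinsicFrontier_of_forall_le hxΔ f hle
    (subset_convexHull ℝ _ (Or.inr ⟨r, hrk, rfl⟩)) ?_
  rw [hfw, if_neg hr, hfx]
  exact one_pos

theorem isLocallyEuclideanAt [TopologicalSpace 𝔤] [IsTopologicalAddGroup 𝔤]
    [ContinuousSMul ℝ 𝔤] {θ : ℝ} (hθ : |θ| < 1) : S.IsLocallyEuclideanAt θ g₁ x := by
  obtain ⟨F⟩ := M.exists_frame
  obtain ⟨hx0, hxI, hx1⟩ := mem_simplex_of_mem_convexHull hx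
  have hcoeff : ∀ i ∈ I, ∃ α, F.idx α = i ∧ F.coeff 0 (.inr α) ≠ 0 := fun i hi => by
    obtain ⟨X, hX, Y, hXY⟩ := exists_lie_ne_zero M hcen hi
    exact exists_coeff_ne_zero_of_not_central M F hX hXY
  have hF : ∃ τ, F.coeff 0 τ ≠ 0 := by
    obtain ⟨i, hi⟩ : I.Nonempty := by
      rw [← Set.image_nonempty (f := weight), ← convexHull_nonempty_iff (𝕜 := ℝ)]
      exact ⟨x, hx⟩
    obtain ⟨α, -, hα⟩ := hcoeff i hi
    exact ⟨_, hα⟩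
  obtain ⟨K, hK⟩ : ∃ K : _ → ℝ, ∀ α, 2 * ∑ β, ∑ γ, F.coeff θ (.inl (α, β, γ)) +
      F.coeff θ (.inr α) = K α := ⟨_, fun _ => rfl⟩
  have hKnn : ∀ α, 0 ≤ K α := fun α => by
    rw [← hK]
    exact add_nonneg (mul_nonneg zero_le_two (Finset.sum_nonneg fun β _ =>
      Finset.sum_nonneg fun γ _ => F.coeff_nonneg M hθ _)) (F.coeff_nonneg M hθ _)
  have hKle : ∀ α, F.coeff θ (.inr α) ≤ K α := fun α => by
    rw [← hK]
    exact le_add_of_nonneg_left (mul_nonneg zero_le_two (Finset.sum_nonneg fun β _ =>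
      Finset.sum_nonneg fun γ _ => F.coeff_nonneg M hθ _))
  set κ : Fin d → ℝ := fun i => ∑ α, K α * if F.idx α = i then 1 else 0 with hκ
  have hterm : ∀ i α, 0 ≤ K α * if F.idx α = i then (1 : ℝ) else 0 := fun i α =>
    mul_nonneg (hKnn α) (by split_ifs <;> norm_num)
  have hκnn : ∀ i, 0 ≤ κ i := fun i => Finset.sum_nonneg fun α _ => hterm i α
  have hκpos : ∀ i ∈ I, κ i ≠ 0 := fun i hi h => by
    obtain ⟨α, hα, hne⟩ := hcoeff i hi
    have h1 := (Finset.sum_eq_zero_iff_of_nonneg fun α _ => hterm i α).1 h α (Finset.mem_univ α)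
    rw [if_pos hα, mul_one] at h1
    have h2 := hKle α
    rw [h1] at h2
    exact (F.coeff_ne_zero_iff hθ _).2 hne (le_antisymm h2 (F.coeff_nonneg M hθ _))
  -- κ i is the total coefficient with which u i enters the limit of the moment map, so the quotient
  -- makes that limit equal to x.
  set u : Fin d → ℝ := fun i => x i / κ i with hu
  have huI : ∀ i, u i ≠ 0 → i ∈ I := fun i h => by
    by_contra hi
    exact h (by simp [hu, hxI i hi])
  have hflat : S.IsFlatWeight u :=
    { nonneg := fun i => div_nonneg (hx0 i) (hκnn i)
      abelian := fun i j hi hj X hX Y hY =>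
        hab X (mem_𝔪sub (huI i hi) hX) Y (mem_𝔪sub (huI j hj) hY)
      fixed := fun i hi X hX Y hY => by
        rw [← lie_skew, hfix Y (mem_𝔪sub (huI i hi) hY) X hX, neg_zero] }
  have hpoint : ∀ l, F.flatPoint θ u l = x l := fun l => by
    have h1 : F.flatPoint θ u l = u l * κ l := by
      rw [Frame.flatPoint, hκ, Finset.mul_sum]
      refine Finset.sum_congr rfl fun α _ => ?_
      rw [hK]
      split_ifs with h
      · rw [h]; ring
      · simp
    rw [h1, hu]
    by_cases hl : l ∈ I
    · exact div_mul_cancel₀ _ (hκpos l hl)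
    · simp [hxI l hl]
  obtain ⟨t, ht, hlim⟩ := tendsto_interiorBracket_flat M F hθ hF hflat hpoint hx1
  exact ⟨S.flatBracket t, ⟨approach_neBot M F hflat hpoint hx1, hlim⟩,
    isLocallyEuclidean_flatBracket M hflat ht⟩

end

end Splitting

/-! ### From the compact Lie group to the algebraic model. -/

section Model

variable {E : Type*} [NormedAddCommGroup E] [NormedSpace ℝ E]
  {G : Type*} [TopologicalSpace G] [ChartedSpace E G] [Group G]

instance : T2Space (GroupLieAlgebra 𝓘(ℝ, E) G) := inferInstanceAs (T2Space E)

variable (E) in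
/-- The operators `Ad a`, `a ∈ H`. -/
def isotropyOperators (H : Subgroup G) :
    Set (GroupLieAlgebra 𝓘(ℝ, E) G →ₗ[ℝ] GroupLieAlgebra 𝓘(ℝ, E) G) :=
  {A | ∃ a ∈ H, ∀ X, A X = Ad E a X}

lemma Ad_mem_isotropyOperators {H : Subgroup G} {a : G} (ha : a ∈ H) :
    (Ad E a : GroupLieAlgebra 𝓘(ℝ, E) G →ₗ[ℝ] GroupLieAlgebra 𝓘(ℝ, E) G) ∈
      isotropyOperators E H := ⟨a, ha, fun _ => rfl⟩

variable [FiniteDimensional ℝ E] [LieGroup 𝓘(ℝ, E) ∞ G] [CompactSpace G] [T2Space G]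

lemma lie_mem_of_Ad_mem {H : Subgroup G} (hH : IsClosed (H : Set G))
    {X : GroupLieAlgebra 𝓘(ℝ, E) G} (hX : X ∈ lieAlgebraOf E H)
    {W : Submodule ℝ (GroupLieAlgebra 𝓘(ℝ, E) G)} {Y : GroupLieAlgebra 𝓘(ℝ, E) G}
    (hW : ∀ a ∈ H, Ad E a Y ∈ W) : ⁅X, Y⁆ ∈ W := by
  obtain ⟨γ, hγ, hγH⟩ := exists_of_mem_lieAlgebraOf (E := E) hH hX
  exact hγ.groupBracket_mem (W := W) (Y := Y) fun t => hW _ (hγH t)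

theorem exists_isReductiveModel (H : Subgroup G) (hH : IsClosed (H : Set G))
    (hker : HasFiniteIsotropyKernel E H) {d : ℕ} (S : Splitting (lieAlgebraOf E H) d)
    (hS : IsIsotropyDecomposition H S) (g₁ : LinearMap.BilinForm ℝ (GroupLieAlgebra 𝓘(ℝ, E) G))
    (hg₁ : IsBaseMetric H g₁) :
    ∃ Q, S.IsReductiveModel g₁ Q (isotropyOperators E H) := by
  obtain ⟨Q, hQs, hQp, hQ⟩ := exists_adInvariant_form (E := E) G
  refine ⟨Q, ?_⟩
  exact
    { metric :=
        { symm := hg₁.symm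
          kernel := hg₁.kernel
          pos := fun X hX h0 => hg₁.pos X fun hX' => h0
            ((Submodule.disjoint_def.1 S.isCompl.disjoint) X hX' hX) }
      Q_symm := hQs
      Q_pos := hQp
      Q_skew := hQ
      lie_𝔥 := fun X hX Y hY => lie_mem_of_Ad_mem hH hX fun a ha =>
        adjointOp_mem_lieAlgebraOf (E := E) hH ha hY
      lie_comp := fun i X hX Y hY => lie_mem_of_Ad_mem hH hX fun a ha =>
        hS.invariant i a ha Y hY
      skew_𝔥 := fun X hX Y Z => by
        obtain ⟨γ, hγ, hγH⟩ := exists_of_mem_lieAlgebraOf (E := E) hH hX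
        exact IsOneParameterSubgroup.skew_of_invariant (E := E) hγ g₁
          (fun t => hg₁.invariant _ (hγH t)) Y Z
      -- X is killed by 𝔥, so its one-parameter subgroup centralizes H⁰ and preserves g₁;
      -- differentiate at 0.
      skew_commutant := fun X hX Y Z => by
        obtain ⟨γ, hγ⟩ := exists_oneParameterSubgroup (E := E) G X
        exact IsOneParameterSubgroup.skew_of_invariant (E := E) hγ g₁
          (fun t => hg₁.invariant_centralizer _
            (IsOneParameterSubgroup.mem_centralizer (E := E) hH hX hγ t)) Y Z
      effective := fun Y hY h => by
        have hm : ∀ X, X - S.projH X ∈ S.𝔪 := fun X => by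
          have h1 : X - S.projH X = S.projM X :=
            sub_eq_iff_eq_add'.2 (S.projH_add_projM X).symm
          exact h1 ▸ (S.projM X).2
        exact eq_zero_of_finite_isotropyKernel (E := E) hH hker hY fun X =>
          ⟨S.projH X, S.projH_mem X, h _ (hm X)⟩
      map_lie := by
        rintro A ⟨a, -, hA⟩ X Y
        rw [hA, hA, hA]
        exact adjointOp_groupBracket (E := E) a X Y
      map_𝔥 := by
        rintro A ⟨a, ha, hA⟩ X hX
        rw [hA]
        exact adjointOp_mem_lieAlgebraOf (E := E) hH ha hX
      map_comp := by
        rintro i A ⟨a, ha, hA⟩ X hX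
        rw [hA]
        exact hS.invariant i a ha X hX
      map_metric := by
        rintro A ⟨a, ha, hA⟩ X Y
        rw [hA, hA]
        exact hg₁.invariant a ha X Y
      inv := by
        rintro A ⟨a, ha, hA⟩
        refine ⟨_, Ad_mem_isotropyOperators (H.inv_mem ha), fun X => ?_⟩
        rw [hA]
        exact adjointOp_apply_inv (E := E) a X
      ne_bot := hS.ne_bot
      irreducible := fun i W hW h => hS.irreducible i W hW fun a ha =>
        h _ (Ad_mem_isotropyOperators ha)
      inequivalent := fun i j hij => by
        rintro ⟨f, hf⟩
        exact hS.inequivalent i j hij ⟨f, fun a ha => hf _ (Ad_mem_isotropyOperators ha)⟩ }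

end Model

end LocalGeometry

end

theorem mainTheorem5
    {E : Type*} [NormedAddCommGroup E] [NormedSpace ℝ E] [FiniteDimensional ℝ E]
    {G : Type*} [TopologicalSpace G] [ChartedSpace E G] [Group G] [LieGroup 𝓘(ℝ, E) ∞ G]
    [CompactSpace G] [T2Space G]
    (H : Subgroup G) (hH : IsClosed (H : Set G)) [SimplyConnectedSpace (G ⧸ H)]
    (hker : LocalGeometry.HasFiniteIsotropyKernel E H)
    {d : ℕ} (hd : 1 < d)
    (S : LocalGeometry.Splitting (LocalGeometry.lieAlgebraOf E H) d)
    (hS : LocalGeometry.IsIsotropyDecomposition H S)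
    (g₁ : LinearMap.BilinForm ℝ (GroupLieAlgebra 𝓘(ℝ, E) G))
    (hg₁ : LocalGeometry.IsBaseMetric H g₁)
    (θ : ℝ) (hθ : |θ| < 1) (x : Fin d → ℝ) :
    (x ∈ S.infinity g₁ ∧ S.IsLocallyEuclideanAt θ g₁ x) ↔
      ∃ I : Set (Fin d), x ∈ convexHull ℝ (LocalGeometry.Splitting.weight '' I) ∧
        (∀ X ∈ S.𝔪sub I, ∀ Y ∈ S.𝔪sub I, ⁅X, Y⁆ = 0) ∧
        (∀ X ∈ S.𝔪sub I, ∀ Y ∈ LocalGeometry.lieAlgebraOf E H, ⁅X, Y⁆ = 0) ∧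
        S.𝔪sub I ⊓ (LieAlgebra.center ℝ (GroupLieAlgebra 𝓘(ℝ, E) G)).toSubmodule = ⊥ := by
  obtain ⟨Q, M⟩ := LocalGeometry.exists_isReductiveModel H hH hker S hS g₁ hg₁
  constructor
  · rintro ⟨hx, hflat⟩
    exact LocalGeometry.Splitting.exists_flat_summands M hθ hx hflat
  · rintro ⟨I, hx, hab, hfix, hcen⟩
    exact ⟨LocalGeometry.Splitting.mem_infinity M hab hfix hcen hx,
      LocalGeometry.Splitting.isLocallyEuclideanAt M hab hfix hcen hx hθ⟩
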